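/- Let $G$ be a connected non-compact simple Lie group with Lie algebra $\mathfrak g$ and Killing form $B$. Let $K$ be a maximal compact subgroup of $G$ with Lie algebra $\mathfrak k$, and let $\mathfrak p$ be the $B$-orthogonal complement of $\mathfrak k$ in $\mathfrak g$. Assume that $\mathfrak g=\mathfrak p\oplus\mathfrak k$ is a Cartan decomposition (as is the case when $G$ has finite centre), so that $Q=B|_{\mathfrak p}-B|_{\mathfrak k}$ is an inner product on $\mathfrak g$. Let $\mathfrak k_1,\dots,\mathfrak k_r$ be the simple ideals of $[\mathfrak k,\mathfrak k]$, and let $\mathfrak k_{r+1}$ be the centre of $\mathfrak k$; put $s=0$ if this centre is trivial and $s=1$ otherwise, so that $\mathfrak k=\mathfrak k_1\oplus\dots\oplus\mathfrak k_{r+s}$. Put $n=\dim\mathfrak p$ and $d_i=\dim\mathfrak k_i$, and let $\kappa_i\in\mathbb R$ be the number such that the Killing form of $\mathfrak k_i$ equals $\kappa_iB|_{\mathfrak k_i}$. Identify left-invariant $(0,2)$-tensor fields on $G$ with bilinear forms on $\mathfrak g$. Let $\mathcal M_K$ be the set of left-invariant Riemannian metrics on $G$ that are naturally reductive with respect to $G\times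 K$, acting by $(x,k)\,y=xyk^{-1}$, and some reductive decomposition of the Lie algebra of $G\times K$. For $g\in\mathcal M_K$ let $S(g)$ be the scalar curvature of $g$. Let $$T=-T_{\mathfrak p}\,Q|_{\mathfrak p}+T_1\,Q|_{\mathfrak k_1}+\dots+T_{r+s}\,Q|_{\mathfrak k_{r+s}},\qquad T_{\mathfrak p},T_1,\dots,T_{r+s}>0,$$ and let $\mathcal M_T^+=\{g\in\mathcal M_K : \operatorname{tr}_gT=1\}$. Let $m\in\{1,\dots,r\}$ be an index such that $\frac{\kappa_m}{T_m}=\max_{i=1,\dots,r}\frac{\kappa_i}{T_i}$. If $$\frac{\kappa_m\operatorname{tr}_QT}{T_m}<\dim\mathfrak k+d_m(1-\kappa_m)-3n$$ and $$\sum_{i=1}^{r+s}\frac{n^2\kappa_iT_{\mathfrak p}^2-d_i^2(1-\kappa_i)T_i^2}{nT_{\mathfrak p}T_i}-2n<0,$$ then the functional $S|_{\mathcal M_T^+}$ attains its global maximum: there is $g\in\mathcal M_T^+$ with $S(h)\le S(g)$ for all $h\in\mathcal M_T^+$. -/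

import Mathlib

open scoped Manifold ContDiff

namespace NatRed

noncomputable section

/-! ### Inner products on a vector space -/

/-- An inner product on a real vector space. On the Lie algebra of a Lie group `G` this is the same
thing as a left-invariant Riemannian metric on `G`. -/
structure InnerForm (V : Type*) [AddCommGroup V] [Module ℝ V] where
  form : LinearMap.BilinForm ℝ V
  symm : ∀ x y, form x y = form y x
  pos : ∀ x, x ≠ 0 → 0 < form x x

namespace InnerForm

variable {V : Type*} [AddCommGroup V] [Module ℝ V]

lemma isRefl (g : InnerForm V) : g.form.IsRefl := fun x y h => by rw [g.symm, h]

lemma eq_zero (g : InnerForm V) {x : V} (h : g.form x x = 0) : x = 0 := by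
  by_contra hx
  exact (g.pos x hx).ne' h

lemma nondegenerate (g : InnerForm V) : g.form.Nondegenerate :=
  ⟨fun x h => g.eq_zero (h x), fun x h => g.eq_zero (h x)⟩

variable [FiniteDimensional ℝ V]

/-- The vector dual to a linear form: `g (g.sharp f) v = f v`. -/
def sharp (g : InnerForm V) : Module.Dual ℝ V ≃ₗ[ℝ] V := (g.form.toDual g.nondegenerate).symm

lemma form_sharp (g : InnerForm V) (f : Module.Dual ℝ V) (v : V) : g.form (g.sharp f) v = f v :=
  LinearMap.BilinForm.apply_toDual_symm_apply f v

/-- The trace `tr_g h` of a bilinear form `h` with respect to an inner product `g`: the trace of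
the endomorphism `A` with `g (A x) y = h x y`. -/
def traceForm (g : InnerForm V) (h : LinearMap.BilinForm ℝ V) : ℝ :=
  LinearMap.trace ℝ V (g.sharp.toLinearMap ∘ₗ h)

lemma isCompl_orthogonal (g : InnerForm V) (U : Submodule ℝ V) :
    IsCompl U (g.form.orthogonal U) := by
  refine LinearMap.BilinForm.isCompl_orthogonal_of_restrict_nondegenerate g.isRefl
    ⟨fun x h => ?_, fun x h => ?_⟩ <;>
  exact Subtype.ext (g.eq_zero (h x))

/-- The `g`-orthogonal projection of `V` onto `U`. -/
def proj (g : InnerForm V) (U : Submodule ℝ V) : V →ₗ[ℝ] V :=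
  U.projection (g.form.orthogonal U) (g.isCompl_orthogonal U)

/-- The form `g|_U`, extended by zero to the `g`-orthogonal complement of `U`. -/
def restr (g : InnerForm V) (U : Submodule ℝ V) : LinearMap.BilinForm ℝ V :=
  g.form.compl₁₂ (g.proj U) (g.proj U)

end InnerForm

/-! ### Curvature of left-invariant metrics -/

section Curvature

variable {𝔤 : Type*} [LieRing 𝔤] [LieAlgebra ℝ 𝔤] [FiniteDimensional ℝ 𝔤]

/-- The linear form `Z ↦ (g([X, Y], Z) - g([Y, Z], X) + g([Z, X], Y)) / 2`. -/
def koszul (g : InnerForm 𝔤) (X Y : 𝔤) : Module.Dual ℝ 𝔤 where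
  toFun Z := (g.form ⁅X, Y⁆ Z - g.form ⁅Y, Z⁆ X + g.form ⁅Z, X⁆ Y) / 2
  map_add' Z W := by
    simp only [lie_add, add_lie, map_add, LinearMap.add_apply]; ring
  map_smul' c Z := by
    simp only [lie_smul, smul_lie, map_smul, LinearMap.smul_apply, smul_eq_mul,
      RingHom.id_apply]; ring

/-- The Levi-Civita connection `(X, Y) ↦ ∇_X Y` of a left-invariant metric `g`, on left-invariant
vector fields. It is given by the Koszul formula
`2 g(∇_X Y, Z) = g([X, Y], Z) - g([Y, Z], X) + g([Z, X], Y)`. -/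
def leviCivita (g : InnerForm 𝔤) : 𝔤 →ₗ[ℝ] 𝔤 →ₗ[ℝ] 𝔤 :=
  LinearMap.mk₂ ℝ (fun X Y => g.sharp (koszul g X Y))
    (fun X X' Y => by
      rw [← map_add]; congr 1; ext Z
      simp only [koszul, LinearMap.coe_mk, AddHom.coe_mk, LinearMap.add_apply, lie_add, add_lie,
        map_add]; ring)
    (fun c X Y => by
      rw [← map_smul]; congr 1; ext Z
      simp only [koszul, LinearMap.coe_mk, AddHom.coe_mk, LinearMap.smul_apply, lie_smul, smul_lie,
        map_smul, smul_eq_mul]; ring)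
    (fun X Y Y' => by
      rw [← map_add]; congr 1; ext Z
      simp only [koszul, LinearMap.coe_mk, AddHom.coe_mk, LinearMap.add_apply, lie_add, add_lie,
        map_add]; ring)
    (fun c X Y => by
      rw [← map_smul]; congr 1; ext Z
      simp only [koszul, LinearMap.coe_mk, AddHom.coe_mk, LinearMap.smul_apply, lie_smul, smul_lie,
        map_smul, smul_eq_mul]; ring)

lemma form_leviCivita (g : InnerForm 𝔤) (X Y Z : 𝔤) :
    g.form (leviCivita g X Y) Z =
      (g.form ⁅X, Y⁆ Z - g.form ⁅Y, Z⁆ X + g.form ⁅Z, X⁆ Y) / 2 := by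
  simp only [leviCivita, LinearMap.mk₂_apply, InnerForm.form_sharp]; rfl

/-- The endomorphism `Z ↦ R(Z, X) Y = ∇_Z ∇_X Y - ∇_X ∇_Z Y - ∇_[Z, X] Y`. -/
def curvature (g : InnerForm 𝔤) (X Y : 𝔤) : 𝔤 →ₗ[ℝ] 𝔤 where
  toFun Z := leviCivita g Z (leviCivita g X Y) - leviCivita g X (leviCivita g Z Y)
    - leviCivita g ⁅Z, X⁆ Y
  map_add' Z W := by
    simp only [add_lie, map_add, LinearMap.add_apply]; abel
  map_smul' c Z := by
    simp only [smul_lie, map_smul, LinearMap.smul_apply, RingHom.id_apply, smul_sub]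

/-- The Ricci curvature `Ric(X, Y) = tr (Z ↦ R(Z, X) Y)` of a left-invariant metric. -/
def ricci (g : InnerForm 𝔤) : LinearMap.BilinForm ℝ 𝔤 :=
  LinearMap.mk₂ ℝ (fun X Y => LinearMap.trace ℝ 𝔤 (curvature g X Y))
    (fun X X' Y => by
      rw [← map_add]; congr 1; ext Z
      simp only [curvature, LinearMap.coe_mk, AddHom.coe_mk, LinearMap.add_apply, lie_add,
        map_add]; abel)
    (fun c X Y => by
      rw [← map_smul]; congr 1; ext Z
      simp only [curvature, LinearMap.coe_mk, AddHom.coe_mk, LinearMap.smul_apply, lie_smul,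
        map_smul, smul_sub])
    (fun X Y Y' => by
      rw [← map_add]; congr 1; ext Z
      simp only [curvature, LinearMap.coe_mk, AddHom.coe_mk, LinearMap.add_apply,
        map_add]; abel)
    (fun c X Y => by
      rw [← map_smul]; congr 1; ext Z
      simp only [curvature, LinearMap.coe_mk, AddHom.coe_mk, LinearMap.smul_apply,
        map_smul, smul_sub])

/-- The scalar curvature `S(g) = tr_g Ric(g)` of a left-invariant metric. -/
def scalarCurvature (g : InnerForm 𝔤) : ℝ := g.traceForm (ricci g)

end Curvature

/-! ### Cartan decompositions -/

section Cartan

variable {𝔤 : Type*} [LieRing 𝔤] [LieAlgebra ℝ 𝔤]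

/-- The orthogonal complement `𝔭` of `𝔨` with respect to the Killing form of `𝔤`. -/
def pPart (𝔨 : LieSubalgebra ℝ 𝔤) : Submodule ℝ 𝔤 :=
  (killingForm ℝ 𝔤).orthogonal 𝔨.toSubmodule

/-- `𝔤 = 𝔭 ⊕ 𝔨`, with `𝔭` the Killing-orthogonal complement of `𝔨`, is a Cartan decomposition. -/
structure IsCartanDecomposition (𝔨 : LieSubalgebra ℝ 𝔤) : Prop where
  isCompl : IsCompl (pPart 𝔨) 𝔨.toSubmodule
  lie_k_p : ∀ X ∈ 𝔨, ∀ Y ∈ pPart 𝔨, ⁅X, Y⁆ ∈ pPart 𝔨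
  lie_p_p : ∀ X ∈ pPart 𝔨, ∀ Y ∈ pPart 𝔨, ⁅X, Y⁆ ∈ 𝔨
  killing_pos : ∀ X ∈ pPart 𝔨, X ≠ 0 → 0 < killingForm ℝ 𝔤 X X
  killing_neg : ∀ X ∈ 𝔨, X ≠ 0 → killingForm ℝ 𝔤 X X < 0

/-- The inner product `Q = B|_𝔭 - B|_𝔨` of a Cartan decomposition, `B` being the Killing form. -/
def cartanInner {𝔨 : LieSubalgebra ℝ 𝔤} (h : IsCartanDecomposition 𝔨) : InnerForm 𝔤 where
  form := (killingForm ℝ 𝔤).compl₁₂ ((pPart 𝔨).projection 𝔨.toSubmodule h.isCompl)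
      ((pPart 𝔨).projection 𝔨.toSubmodule h.isCompl)
    - (killingForm ℝ 𝔤).compl₁₂ (𝔨.toSubmodule.projection (pPart 𝔨) h.isCompl.symm)
      (𝔨.toSubmodule.projection (pPart 𝔨) h.isCompl.symm)
  symm x y := by
    simp only [LinearMap.sub_apply, LinearMap.compl₁₂_apply]
    rw [LieModule.traceForm_comm ℝ 𝔤 𝔤 ((pPart 𝔨).projection _ h.isCompl x),
      LieModule.traceForm_comm ℝ 𝔤 𝔤 (𝔨.toSubmodule.projection _ h.isCompl.symm x)]
  pos x hx := by
    simp only [LinearMap.sub_apply, LinearMap.compl₁₂_apply]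
    set a := (pPart 𝔨).projection 𝔨.toSubmodule h.isCompl x with ha
    set b := 𝔨.toSubmodule.projection (pPart 𝔨) h.isCompl.symm x with hb
    have ha' : a ∈ pPart 𝔨 := Submodule.projection_apply_mem _ _
    have hb' : b ∈ 𝔨 := (Submodule.projection_apply_mem h.isCompl.symm x :)
    have hab : a + b = x := Submodule.projection_add_projection_eq_self h.isCompl x
    by_cases ha0 : a = 0
    · by_cases hb0 : b = 0
      · exact absurd (by rw [← hab, ha0, hb0, add_zero]) hx
      · have := h.killing_neg b hb' hb0
        rw [ha0]; simp only [map_zero]; linarith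
    · have h1 := h.killing_pos a ha' ha0
      by_cases hb0 : b = 0
      · rw [hb0]; simp only [map_zero]; linarith
      · have := h.killing_neg b hb' hb0
        linarith

end Cartan

/-! ### The simple ideals and the centre of `𝔨` -/

section Factors

/-- The summands `𝔨₁, …, 𝔨_{r+s}` of `𝔨`: the simple (in particular non-abelian) ideals, and the
centre if it is not trivial. (As `𝔨` is reductive, the simple ideals of `𝔨` and of `[𝔨, 𝔨]` are
the same.) -/
def Factor (𝔨 : Type*) [LieRing 𝔨] [LieAlgebra ℝ 𝔨] : Type _ :=
  {I : LieIdeal ℝ 𝔨 // LieAlgebra.IsSimple ℝ I ∨ (I = LieAlgebra.center ℝ 𝔨 ∧ I ≠ ⊥)}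

/-- The ideal of `𝔨` underlying a summand. -/
def Factor.ideal {𝔨 : Type*} [LieRing 𝔨] [LieAlgebra ℝ 𝔨] (i : Factor 𝔨) : LieIdeal ℝ 𝔨 := i.1

lemma sSupIndep_isSimple (L : Type*) [LieRing L] [LieAlgebra ℝ L] :
    sSupIndep {I : LieIdeal ℝ L | LieAlgebra.IsSimple ℝ I} := by
  have key : ∀ I J : LieIdeal ℝ L, LieAlgebra.IsSimple ℝ I → I ⊓ J = ⊥ ∨ I ≤ J := by
    intro I J hI
    rcases hI.eq_bot_or_eq_top (J.comap I.incl) with h | h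
    · left
      rw [eq_bot_iff]
      rintro x ⟨hxI, hxJ⟩
      have : (⟨x, hxI⟩ : I) ∈ J.comap I.incl := by simpa [LieIdeal.mem_comap] using hxJ
      rw [h, LieSubmodule.mem_bot] at this
      rw [LieSubmodule.mem_bot]
      exact congrArg Subtype.val this
    · right
      intro x hx
      have : (⟨x, hx⟩ : I) ∈ J.comap I.incl := by rw [h]; exact LieSubmodule.mem_top _
      simpa [LieIdeal.mem_comap] using this
  intro I hI
  rw [disjoint_iff, eq_bot_iff]
  rintro x ⟨hxI, hxS⟩
  have hI' : LieAlgebra.IsSimple ℝ I := hI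
  let C : LieIdeal ℝ L :=
    { carrier := {y | ∀ z ∈ I, ⁅z, y⁆ = 0}
      add_mem' := fun {a b} ha hb z hz => by rw [lie_add, ha z hz, hb z hz, add_zero]
      zero_mem' := fun z _ => lie_zero z
      smul_mem' := fun c y hy z hz => by rw [lie_smul, hy z hz, smul_zero]
      lie_mem := fun {w y} hy z hz => by
        have h1 : ⁅⁅z, w⁆, y⁆ = 0 := hy _ (lie_mem_left ℝ L I z w hz)
        have h2 : ⁅z, y⁆ = 0 := hy z hz
        rw [leibniz_lie, h1, h2, lie_zero, add_zero] }
  have hle : sSup ({I : LieIdeal ℝ L | LieAlgebra.IsSimple ℝ I} \ {I}) ≤ C := by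
    refine sSup_le ?_
    rintro J ⟨hJ, hJI⟩ y hy z hz
    have hJ' : LieAlgebra.IsSimple ℝ J := hJ
    have hbot : I ⊓ J = ⊥ := by
      rcases key I J hI' with h | h
      · exact h
      · rcases key J I hJ' with h' | h'
        · rw [inf_comm]; exact h'
        · exact absurd (le_antisymm h' h) hJI
    have : ⁅z, y⁆ ∈ I ⊓ J := ⟨lie_mem_left ℝ L I z y hz, lie_mem_right ℝ L J z y hy⟩
    rwa [hbot, LieSubmodule.mem_bot] at this
  have hc : (⟨x, hxI⟩ : I) ∈ LieAlgebra.center ℝ I := by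
    intro y
    exact Subtype.ext (hle hxS y y.2)
  rw [LieAlgebra.center_eq_bot, LieSubmodule.mem_bot] at hc
  rw [LieSubmodule.mem_bot]
  exact congrArg Subtype.val hc

instance (𝔨 : Type*) [LieRing 𝔨] [LieAlgebra ℝ 𝔨] [FiniteDimensional ℝ 𝔨] : Finite (Factor 𝔨) := by
  have h1 : {I : LieIdeal ℝ 𝔨 | LieAlgebra.IsSimple ℝ I}.Finite :=
    WellFoundedGT.finite_of_sSupIndep (sSupIndep_isSimple 𝔨)
  refine Set.Finite.to_subtype ((h1.union (Set.finite_singleton (LieAlgebra.center ℝ 𝔨))).subset ?_)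
  rintro I (h | h)
  · exact Or.inl h
  · exact Or.inr h.1

instance (𝔨 : Type*) [LieRing 𝔨] [LieAlgebra ℝ 𝔨] [FiniteDimensional ℝ 𝔨] : Fintype (Factor 𝔨) :=
  Fintype.ofFinite _

variable {𝔤 : Type*} [LieRing 𝔤] [LieAlgebra ℝ 𝔤] {𝔨 : LieSubalgebra ℝ 𝔤}

/-- The summand `𝔨ᵢ` of `𝔨`, as a subspace of `𝔤`. -/
def Factor.space (i : Factor 𝔨) : Submodule ℝ 𝔤 :=
  i.ideal.toSubmodule.map 𝔨.toSubmodule.subtype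

/-- `dᵢ = dim 𝔨ᵢ`. -/
def Factor.dim (i : Factor 𝔨) : ℕ := Module.finrank ℝ i.space

open Classical in
/-- The number `κᵢ` with `Bᵢ = κᵢ B|_{𝔨ᵢ}`, where `Bᵢ` and `B` are the Killing forms of `𝔨ᵢ` and
`𝔤` (with the value `0` if there is none, which does not happen for a Cartan decomposition). -/
def Factor.kappa (i : Factor 𝔨) : ℝ :=
  if h : ∃ c : ℝ, ∀ X Y : i.ideal,
      killingForm ℝ i.ideal X Y = c * killingForm ℝ 𝔤 ((X : 𝔨) : 𝔤) ((Y : 𝔨) : 𝔤)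
  then h.choose else 0

end Factors

/-! ### Naturally reductive metrics -/

section NaturallyReductive

variable {𝔤 : Type*} [LieRing 𝔤] [LieAlgebra ℝ 𝔤]

/-- The isotropy algebra `{(Z, Z) | Z ∈ 𝔨} ⊆ 𝔤 × 𝔨` at the identity of the action
`(x, k) y = x y k⁻¹` of `G × K` on `G`. -/
def isotropy (𝔨 : LieSubalgebra ℝ 𝔤) : Submodule ℝ (𝔤 × 𝔨) :=
  LinearMap.range (LinearMap.prod 𝔨.toSubmodule.subtype LinearMap.id)

/-- The differential `(X, Z) ↦ X - Z` at the identity of the orbit map `(x, k) ↦ x k⁻¹` from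
`G × K` to `G`. Its kernel is `isotropy 𝔨`. -/
def orbitDiff (𝔨 : LieSubalgebra ℝ 𝔤) : 𝔤 × 𝔨 →ₗ[ℝ] 𝔤 :=
  LinearMap.fst ℝ 𝔤 𝔨 - 𝔨.toSubmodule.subtype ∘ₗ LinearMap.snd ℝ 𝔤 𝔨

/-- The left-invariant metric `g` is naturally reductive with respect to `G × K` and some
decomposition of the Lie algebra of `G × K`, for a connected subgroup `K` with Lie algebra `𝔨`:
the metric is `G × K`-invariant, and there is an isotropy-invariant complement `𝔪` of the isotropy
algebra in `𝔤 × 𝔨` such that `⟨[x, y]_𝔪, z⟩ + ⟨y, [x, z]_𝔪⟩ = 0` for all `x, y, z ∈ 𝔪`, where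
`⟨·, ·⟩` is the inner product on `𝔪` that corresponds to `g` under the isomorphism
`orbitDiff : 𝔪 → 𝔤`. (The projection to `𝔪` is absorbed by `orbitDiff`, which vanishes on the
isotropy algebra.) -/
structure IsNaturallyReductive (𝔨 : LieSubalgebra ℝ 𝔤) (g : InnerForm 𝔤) : Prop where
  invariant : ∀ Z ∈ 𝔨, ∀ X Y, g.form ⁅Z, X⁆ Y + g.form X ⁅Z, Y⁆ = 0
  exists_complement : ∃ 𝔪 : Submodule ℝ (𝔤 × 𝔨),
    IsCompl (isotropy 𝔨) 𝔪 ∧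
    (∀ h ∈ isotropy 𝔨, ∀ x ∈ 𝔪, ⁅h, x⁆ ∈ 𝔪) ∧
    ∀ x ∈ 𝔪, ∀ y ∈ 𝔪, ∀ z ∈ 𝔪,
      g.form (orbitDiff 𝔨 ⁅x, y⁆) (orbitDiff 𝔨 z)
        + g.form (orbitDiff 𝔨 y) (orbitDiff 𝔨 ⁅x, z⁆) = 0

/-- The set `𝓜_K` of left-invariant metrics that are naturally reductive with respect to `G × K`. -/
def metricsNR (𝔨 : LieSubalgebra ℝ 𝔤) : Set (InnerForm 𝔤) := {g | IsNaturallyReductive 𝔨 g}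

/-- The set `𝓜_T⁺ = {g ∈ 𝓜_K | tr_g T = 1}`. -/
def metricsPlus [FiniteDimensional ℝ 𝔤] (𝔨 : LieSubalgebra ℝ 𝔤) (T : LinearMap.BilinForm ℝ 𝔤) :
    Set (InnerForm 𝔤) :=
  {g ∈ metricsNR 𝔨 | g.traceForm T = 1}

end NaturallyReductive

/-! ### Lie groups -/

section LieGroup

instance : ENat.LEInfty (minSmoothness ℝ 3) :=
  ⟨by rw [minSmoothness_of_isRCLikeNormedField]; exact ENat.LEInfty.out⟩

variable {N : ℕ} {G : Type*} [TopologicalSpace G] [ChartedSpace (EuclideanSpace ℝ (Fin N)) G]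

instance (x : G) : FiniteDimensional ℝ (TangentSpace (𝓡 N) x) :=
  inferInstanceAs (FiniteDimensional ℝ (EuclideanSpace ℝ (Fin N)))

variable [Group G]

/-- The Lie algebra of a closed subgroup `K` of a Lie group `G`, as a set: the initial velocities of
the one-parameter subgroups of `G` that lie in `K`. -/
def lieAlgebraOf (N : ℕ) {G : Type*} [TopologicalSpace G]
    [ChartedSpace (EuclideanSpace ℝ (Fin N)) G] [Group G] (K : Subgroup G) :
    Set (GroupLieAlgebra (𝓡 N) G) :=
  {X | ∃ γ : ℝ → G, γ 0 = 1 ∧ (∀ s t, γ (s + t) = γ s * γ t) ∧ (∀ t, γ t ∈ K) ∧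
    HasMFDerivAt 𝓘(ℝ, ℝ) (𝓡 N) γ 0
      (ContinuousLinearMap.toSpanSingleton ℝ (X : EuclideanSpace ℝ (Fin N)))}

end LieGroup

end

end NatRed

open NatRed

/-! Write `Q` for `cartanInner hC`. A metric in `metricsNR 𝔨` is in particular `𝔨`-invariant. Since
`𝔤` is simple, `𝔨` acts irreducibly on `𝔭` (`pPart_irreducible`) and faithfully
(`eq_zero_of_lie_eq_zero`), and the centre of `𝔨` is at most a line (`center_proportional`). Schur's
lemma then makes an invariant metric a multiple `c⁻¹` of `Q` on `𝔭` and `aᵢ⁻¹` on `𝔨ᵢ`; distinct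
`𝔨ᵢ` are orthogonal. For metrics diagonal in this sense, `S = -n c / 2 + ∑ dᵢ (κᵢ aᵢ / 4 - (1 - κᵢ)
c² / (4 aᵢ))` and `tr_g T = -n T_𝔭 c + ∑ dᵢ Tᵢ aᵢ`. Conversely every diagonal metric is naturally
reductive (`isNaturallyReductive`).

An invariant metric can mix `𝔭` with `𝔨` only if `𝔭` and a summand are isomorphic `𝔨`-modules. Then
this summand is all of `𝔨` and `𝔤` behaves as its complexification (`exists_isComplexStructure`). An
explicit orthonormal frame shows that some diagonal metric has the same trace of `T` and at least
the same scalar curvature. Hence every competitor is dominated by a diagonal one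
(`exists_dominating`), and it remains to maximise `S` over positive `(c, a)` on the hyperplane `tr_g
T = 1`.

That domain is not compact, and the two inequalities control its ends. As `c → ∞`, the second
inequality forces `S < 0`, so `c` is bounded above where `S ≥ 0`
(`exists_bound_of_diagCurvature_nonneg`). As `c → 0`, the upper limit of `S` is at most `κ_m / (4
T_m)`; the first inequality says that `S` rises above this value to first order in `c` along a
suitable curve (`exists_diagCurvature_gt`). A superlevel set above `κ_m / (4 T_m)` therefore has `c`
bounded away from `0`. The terms in `c² / aᵢ` bound the `aᵢ` below, because `κᵢ < 1`, and the trace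
condition bounds them above. So this superlevel set lies in a compact set, on which `S` attains its
maximum (`exists_isMax_diagCurvature`). -/

namespace NatRed

noncomputable section

/-! ### Orthonormal bases and Schur's lemma for inner products. -/

namespace InnerForm

variable {V : Type*} [AddCommGroup V] [Module ℝ V]

/-- A basis that is orthonormal for an inner product. -/
def IsOrthonormalBasis {ι : Type*} (g : InnerForm V) (e : Module.Basis ι ℝ V) : Prop :=
  (∀ i, g.form (e i) (e i) = 1) ∧ ∀ i j, i ≠ j → g.form (e i) (e j) = 0

lemma IsOrthonormalBasis.eq_ite {ι : Type*} [DecidableEq ι] {g : InnerForm V}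
    {e : Module.Basis ι ℝ V} (he : g.IsOrthonormalBasis e) (i j : ι) :
    g.form (e i) (e j) = if i = j then 1 else 0 := by
  split_ifs with h
  · rw [h, he.1]
  · exact he.2 i j h

/-- The inner product space structure given by an inner product. -/
@[reducible] def core (g : InnerForm V) : InnerProductSpace.Core ℝ V where
  inner x y := g.form x y
  conj_inner_symm x y := g.symm y x
  re_inner_nonneg x := by
    by_cases hx : x = 0
    · simp [hx]
    · exact (g.pos x hx).le
  add_left x y z := by simp
  smul_left x y r := by simp
  definite x hx := g.eq_zero hx

lemma nonneg (g : InnerForm V) (x : V) : 0 ≤ g.form x x := by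
  by_cases hx : x = 0
  · simp [hx]
  · exact (g.pos x hx).le

lemma exists_isOrthonormalBasis (g : InnerForm V) [FiniteDimensional ℝ V] :
    ∃ e : Module.Basis (Fin (Module.finrank ℝ V)) ℝ V, g.IsOrthonormalBasis e := by
  let _ : NormedAddCommGroup V := g.core.toNormedAddCommGroup
  let _ : InnerProductSpace ℝ V := InnerProductSpace.ofCore g.core.toCore
  have h := orthonormal_iff_ite.1 (stdOrthonormalBasis ℝ V).orthonormal
  refine ⟨(stdOrthonormalBasis ℝ V).toBasis, fun i => ?_, fun i j hij => ?_⟩ <;>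
    rw [OrthonormalBasis.coe_toBasis]
  · exact (h i i).trans (if_pos rfl)
  · exact (h i j).trans (if_neg hij)

/-- The endomorphism representing `h` with respect to `g` is self-adjoint, so it has a real
eigenvector. -/
lemma exists_eigenvector (g : InnerForm V) [FiniteDimensional ℝ V] [Nontrivial V]
    (h : LinearMap.BilinForm ℝ V) (hs : ∀ x y, h x y = h y x) :
    ∃ (c : ℝ) (x : V), x ≠ 0 ∧ ∀ y, h x y = c * g.form x y := by
  let _ : NormedAddCommGroup V := g.core.toNormedAddCommGroup
  let _ : InnerProductSpace ℝ V := InnerProductSpace.ofCore g.core.toCore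
  have hT : (g.sharp.toLinearMap ∘ₗ h).IsSymmetric := by
    intro x y
    change g.form (g.sharp (h x)) y = g.form x (g.sharp (h y))
    rw [g.form_sharp, g.symm, g.form_sharp, hs]
  obtain ⟨c, hc⟩ : ∃ c : ℝ, Module.End.HasEigenvalue (g.sharp.toLinearMap ∘ₗ h) c :=
    ⟨_, hT.hasEigenvalue_iSup_of_finiteDimensional⟩
  obtain ⟨x, hx⟩ := hc.exists_hasEigenvector
  refine ⟨c, x, hx.2, fun y => ?_⟩
  have h1 := congrArg (fun z => g.form z y) hx.apply_eq_smul
  simp only [LinearMap.comp_apply, LinearEquiv.coe_coe, form_sharp, map_smul,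
    LinearMap.smul_apply, smul_eq_mul] at h1
  exact h1

/-- Schur's lemma for invariant symmetric forms on an irreducible orthogonal representation. -/
lemma eq_smul_of_irreducible (g : InnerForm V) [FiniteDimensional ℝ V]
    (h : LinearMap.BilinForm ℝ V) (hs : ∀ x y, h x y = h y x) {ι : Type*} (ρ : ι → V → V)
    (hg : ∀ i x y, g.form (ρ i x) y = -g.form x (ρ i y))
    (hh : ∀ i x y, h (ρ i x) y = -h x (ρ i y))
    (irr : ∀ W : Submodule ℝ V, (∀ i, ∀ x ∈ W, ρ i x ∈ W) → W = ⊥ ∨ W = ⊤) :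
    ∃ c : ℝ, ∀ x y, h x y = c * g.form x y := by
  rcases subsingleton_or_nontrivial V with hV | hV
  · exact ⟨0, fun x y => by simp [Subsingleton.elim x 0]⟩
  obtain ⟨c, x, hx, hxc⟩ := g.exists_eigenvector h hs
  refine ⟨c, ?_⟩
  -- The `c`-eigenspace of `h` relative to `g`: invariant because every `ρ i` is skew for both
  -- forms, and nonzero because it contains `x`.
  let W : Submodule ℝ V := LinearMap.ker (h - c • g.form)
  have hW : ∀ z, z ∈ W ↔ ∀ y, h z y = c * g.form z y := by
    intro z
    simp only [W, LinearMap.mem_ker, LinearMap.ext_iff, LinearMap.sub_apply,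
      LinearMap.smul_apply, smul_eq_mul, sub_eq_zero]
  have hinv : ∀ i, ∀ z ∈ W, ρ i z ∈ W := by
    intro i z hz
    rw [hW] at hz ⊢
    intro y
    rw [hh, hg, hz]
    ring
  rcases irr W hinv with h0 | h1
  · exact absurd ((Submodule.mem_bot ℝ).1 (h0 ▸ (hW x).2 hxc)) hx
  · intro z y
    exact (hW z).1 (h1 ▸ Submodule.mem_top) y

section Basis

variable {ι : Type*} [Fintype ι] {g : InnerForm V} {e : Module.Basis ι ℝ V}

lemma IsOrthonormalBasis.repr_eq (he : g.IsOrthonormalBasis e) (x : V) (i : ι) :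
    e.repr x i = g.form x (e i) := by
  classical
  conv_rhs => rw [← e.sum_repr x]
  rw [map_sum, LinearMap.sum_apply]
  simp only [map_smul, LinearMap.smul_apply, he.eq_ite _ i, smul_eq_mul, mul_ite, mul_one, mul_zero,
    Finset.sum_ite_eq', Finset.mem_univ, if_true]

lemma IsOrthonormalBasis.sum_eq (he : g.IsOrthonormalBasis e) (x : V) :
    ∑ i, g.form x (e i) • e i = x := by
  conv_rhs => rw [← e.sum_repr x]
  simp only [he.repr_eq]

lemma IsOrthonormalBasis.apply_eq (he : g.IsOrthonormalBasis e) (x y : V) :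
    g.form x y = ∑ i, g.form x (e i) * g.form y (e i) := by
  conv_lhs => rw [← he.sum_eq y]
  simp [mul_comm]

lemma IsOrthonormalBasis.trace_eq (he : g.IsOrthonormalBasis e) (f : V →ₗ[ℝ] V) :
    LinearMap.trace ℝ V f = ∑ i, g.form (f (e i)) (e i) := by
  classical
  rw [LinearMap.trace_eq_matrix_trace ℝ e, Matrix.trace]
  simp [LinearMap.toMatrix_apply, he.repr_eq]

lemma IsOrthonormalBasis.traceForm_eq [FiniteDimensional ℝ V] (he : g.IsOrthonormalBasis e)
    (h : LinearMap.BilinForm ℝ V) : g.traceForm h = ∑ i, h (e i) (e i) := by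
  rw [traceForm, he.trace_eq]
  simp [form_sharp]

end Basis

end InnerForm

/-! ### Scalar curvature of a unimodular metric Lie algebra. -/

section ScalarCurvature

variable {𝔤 : Type*} [LieRing 𝔤] [LieAlgebra ℝ 𝔤] [FiniteDimensional ℝ 𝔤]

lemma form_leviCivita_skew (g : InnerForm 𝔤) (X Y Z : 𝔤) :
    g.form (leviCivita g X Y) Z = -g.form Y (leviCivita g X Z) := by
  rw [g.symm Y, form_leviCivita, form_leviCivita, ← lie_skew X Y, ← lie_skew Z X,
    ← lie_skew Z Y]
  simp only [map_neg, LinearMap.neg_apply]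
  ring

variable {ι : Type*} [Fintype ι]

/-- The sum of squares of the structure constants and the sum of products of structure constants
that compute the scalar curvature of a unimodular metric Lie algebra. -/
lemma sum_structure_constants (c : ι → ι → ι → ℝ) (hc : ∀ i j k, c j i k = -c i j k) :
    ∑ i, ∑ j, ∑ k, (((c j i k - c i k j + c k j i) / 2) * ((c i j k - c j k i + c k i j) / 2)
        - c j i k * ((c k i j - c i j k + c j k i) / 2))
      = -(1 / 2) * ∑ i, ∑ j, ∑ k, c i j k * c i k j - (1 / 4) * ∑ i, ∑ j, ∑ k, c i j k ^ 2 := by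
  -- Up to cyclic relabelling and antisymmetry in the first two indices, only two quadratic sums in
  -- `c` are left.
  have rot : ∀ F : ι → ι → ι → ℝ, ∑ i, ∑ j, ∑ k, F j k i = ∑ i, ∑ j, ∑ k, F i j k := by
    intro F
    rw [Finset.sum_comm]
    refine Finset.sum_congr rfl fun j _ => ?_
    rw [Finset.sum_comm]
  have h1 := rot fun i j k => c i j k ^ 2
  have h2 := rot fun i j k => c j k i ^ 2
  have h3 := rot fun i j k => c i j k * c k i j
  have h4 := rot fun i j k => c j k i * c i j k
  have h5 : ∑ i, ∑ j, ∑ k, c i j k * c i k j = -∑ i, ∑ j, ∑ k, c i j k * c k i j := by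
    simp only [← Finset.sum_neg_distrib]
    refine Finset.sum_congr rfl fun i _ => Finset.sum_congr rfl fun j _ =>
      Finset.sum_congr rfl fun k _ => ?_
    rw [hc k i j]
    ring
  have key : ∀ i j k, (((c j i k - c i k j + c k j i) / 2) * ((c i j k - c j k i + c k i j) / 2)
        - c j i k * ((c k i j - c i j k + c j k i) / 2))
      = -(3 / 4) * c i j k ^ 2 + (1 / 4) * c j k i ^ 2 + (1 / 4) * c k i j ^ 2
        + (1 / 2) * (c i j k * c k i j) + (1 / 2) * (c j k i * c i j k)
        - (1 / 2) * (c k i j * c j k i) := by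
    intro i j k
    rw [hc i j k, hc k i j, hc j k i]
    ring
  simp only [key, Finset.sum_add_distrib, Finset.sum_sub_distrib, ← Finset.mul_sum]
  rw [h5, h4, h3, h2, h1]
  ring

variable {g : InnerForm 𝔤} {e : Module.Basis ι ℝ 𝔤}

/-- The scalar curvature of a left-invariant metric on a unimodular group, in terms of an
orthonormal basis. -/
lemma scalarCurvature_eq (he : g.IsOrthonormalBasis e)
    (huni : ∀ x : 𝔤, LinearMap.trace ℝ 𝔤 (LieAlgebra.ad ℝ 𝔤 x) = 0) :
    scalarCurvature g = -(1 / 2) * ∑ i, killingForm ℝ 𝔤 (e i) (e i)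
      - (1 / 4) * ∑ i, ∑ j, g.form ⁅e i, e j⁆ ⁅e i, e j⁆ := by
  -- Unimodularity enters here: the inner product of this vector with `Z` is the trace of `ad Z`.
  have hdiv : ∑ i, leviCivita g (e i) (e i) = 0 := by
    apply g.eq_zero
    have : ∀ Z, ∑ i, g.form (leviCivita g (e i) (e i)) Z = 0 := by
      intro Z
      have h1 := huni Z
      rw [he.trace_eq] at h1
      rw [← h1]
      refine Finset.sum_congr rfl fun i _ => ?_
      rw [form_leviCivita, lie_self, ← lie_skew Z (e i), LieAlgebra.ad_apply, ← lie_skew Z (e i)]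
      simp only [map_zero, map_neg, LinearMap.neg_apply, LinearMap.zero_apply]
      ring
    have h := this (∑ i, leviCivita g (e i) (e i))
    rwa [← LinearMap.sum_apply, ← map_sum] at h
  set c : ι → ι → ι → ℝ := fun i j k => g.form ⁅e i, e j⁆ (e k) with hcdef
  have hc : ∀ i j k, c j i k = -c i j k := by
    intro i j k
    simp only [hcdef]
    rw [← lie_skew, map_neg, LinearMap.neg_apply]
  have hG : ∀ i j k, g.form (leviCivita g (e i) (e j)) (e k) =
      (c i j k - c j k i + c k i j) / 2 := fun i j k => form_leviCivita g _ _ _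
  have hK : ∀ i, killingForm ℝ 𝔤 (e i) (e i) = ∑ j, ∑ k, c i j k * c i k j := by
    intro i
    rw [killingForm_apply_apply, he.trace_eq]
    refine Finset.sum_congr rfl fun j _ => ?_
    rw [LinearMap.comp_apply, LieAlgebra.ad_apply, LieAlgebra.ad_apply]
    conv_lhs => rw [← he.sum_eq ⁅e i, e j⁆]
    simp [lie_sum, hcdef]
  have hA : ∀ i j, g.form ⁅e i, e j⁆ ⁅e i, e j⁆ = ∑ k, c i j k ^ 2 := by
    intro i j
    rw [he.apply_eq]
    simp [hcdef, sq]
  have hS : scalarCurvature g = ∑ i, ∑ j, ∑ k,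
      (((c j i k - c i k j + c k j i) / 2) * ((c i j k - c j k i + c k i j) / 2)
        - c j i k * ((c k i j - c i j k + c j k i) / 2)) := by
    rw [scalarCurvature, he.traceForm_eq]
    simp only [ricci, LinearMap.mk₂_apply, he.trace_eq, curvature, LinearMap.coe_mk,
      AddHom.coe_mk, map_sub, LinearMap.sub_apply, Finset.sum_sub_distrib]
    have t1 : ∑ i, ∑ j, g.form (leviCivita g (e j) (leviCivita g (e i) (e i))) (e j) = 0 := by
      rw [Finset.sum_comm]
      refine Finset.sum_eq_zero fun j _ => ?_
      rw [← LinearMap.sum_apply, ← map_sum, ← map_sum, hdiv]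
      simp
    have t2 : ∀ i j, g.form (leviCivita g (e i) (leviCivita g (e j) (e i))) (e j) =
        -∑ k, ((c j i k - c i k j + c k j i) / 2) * ((c i j k - c j k i + c k i j) / 2) := by
      intro i j
      rw [form_leviCivita_skew, he.apply_eq]
      simp only [hG]
    have t3 : ∀ i j, g.form (leviCivita g ⁅e j, e i⁆ (e i)) (e j) =
        ∑ k, c j i k * ((c k i j - c i j k + c j k i) / 2) := by
      intro i j
      conv_lhs => rw [← he.sum_eq ⁅e j, e i⁆]
      simp only [map_sum, map_smul, LinearMap.sum_apply, LinearMap.smul_apply, smul_eq_mul, hG]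
      rfl
    rw [t1]
    simp only [t2, t3, Finset.sum_neg_distrib]
    ring
  rw [hS, sum_structure_constants c hc]
  simp only [hK, hA]

end ScalarCurvature

/-! ### Traces and curvature in an orthogonal basis, with weights `w i = 1 / g (e i) (e i)`. -/

section Orthogonal

variable {V : Type*} [AddCommGroup V] [Module ℝ V] {ι : Type*}

/-- The orthonormal basis obtained by rescaling an orthogonal basis. -/
lemma exists_rescaled_basis {g : InnerForm V} {e : Module.Basis ι ℝ V} {w : ι → ℝ}
    (hw : ∀ i, 0 < w i) (hd : ∀ i, g.form (e i) (e i) = (w i)⁻¹)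
    (ho : ∀ i j, i ≠ j → g.form (e i) (e j) = 0) :
    ∃ f : Module.Basis ι ℝ V, g.IsOrthonormalBasis f ∧ ∀ i, f i = √(w i) • e i := by
  have hu : ∀ i, IsUnit (√(w i)) := fun i => (Real.sqrt_pos.2 (hw i)).ne'.isUnit
  refine ⟨e.isUnitSMul hu, ⟨fun i => ?_, fun i j hij => ?_⟩, fun i => e.isUnitSMul_apply hu i⟩
  · rw [e.isUnitSMul_apply, map_smul, map_smul, LinearMap.smul_apply, hd, smul_eq_mul, smul_eq_mul,
      ← mul_assoc, Real.mul_self_sqrt (hw i).le, mul_inv_cancel₀ (hw i).ne']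
  · rw [e.isUnitSMul_apply, e.isUnitSMul_apply, map_smul, map_smul, LinearMap.smul_apply,
      ho i j hij, smul_zero, smul_zero]

lemma traceForm_eq_of_orthogonal [FiniteDimensional ℝ V] [Fintype ι] {g : InnerForm V}
    {e : Module.Basis ι ℝ V} {w : ι → ℝ}
    (hw : ∀ i, 0 < w i) (hd : ∀ i, g.form (e i) (e i) = (w i)⁻¹)
    (ho : ∀ i j, i ≠ j → g.form (e i) (e j) = 0) (h : LinearMap.BilinForm ℝ V) :
    g.traceForm h = ∑ i, w i * h (e i) (e i) := by
  obtain ⟨f, hf, hfe⟩ := exists_rescaled_basis hw hd ho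
  rw [hf.traceForm_eq]
  refine Finset.sum_congr rfl fun i _ => ?_
  rw [hfe, map_smul, map_smul, LinearMap.smul_apply, smul_eq_mul, smul_eq_mul,
      ← mul_assoc, Real.mul_self_sqrt (hw i).le]

lemma scalarCurvature_eq_of_orthogonal {𝔤 : Type*} [LieRing 𝔤] [LieAlgebra ℝ 𝔤]
    [FiniteDimensional ℝ 𝔤] [Fintype ι] {g : InnerForm 𝔤}
    {e : Module.Basis ι ℝ 𝔤} {w : ι → ℝ}
    (hw : ∀ i, 0 < w i) (hd : ∀ i, g.form (e i) (e i) = (w i)⁻¹)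
    (ho : ∀ i j, i ≠ j → g.form (e i) (e j) = 0)
    (huni : ∀ x : 𝔤, LinearMap.trace ℝ 𝔤 (LieAlgebra.ad ℝ 𝔤 x) = 0) :
    scalarCurvature g = -(1 / 2) * ∑ i, w i * killingForm ℝ 𝔤 (e i) (e i)
      - (1 / 4) * ∑ i, ∑ j, w i * w j * g.form ⁅e i, e j⁆ ⁅e i, e j⁆ := by
  obtain ⟨f, hf, hfe⟩ := exists_rescaled_basis hw hd ho
  have h1 : ∀ i, √(w i) * √(w i) = w i := fun i => Real.mul_self_sqrt (hw i).le
  rw [scalarCurvature_eq hf huni]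
  simp only [hfe, smul_lie, lie_smul, map_smul, LinearMap.smul_apply, smul_eq_mul]
  congr 2
  · exact Finset.sum_congr rfl fun i _ => by rw [← mul_assoc, h1]
  · refine Finset.sum_congr rfl fun i _ => Finset.sum_congr rfl fun j _ => ?_
    linear_combination (w j * g.form ⁅e i, e j⁆ ⁅e i, e j⁆) * h1 i
      + (√(w i) * √(w i) * g.form ⁅e i, e j⁆ ⁅e i, e j⁆) * h1 j

end Orthogonal

/-! ### Decomposition of a Lie algebra with invariant inner product into simple ideals and centre.
-/

section InvariantInner

variable {L : Type*} [LieRing L] [LieAlgebra ℝ L]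

/-- A bilinear form for which all operators `ad z` are skew. -/
def IsAdInvariant (h : LinearMap.BilinForm ℝ L) : Prop :=
  ∀ z x y : L, h ⁅z, x⁆ y = -h x ⁅z, y⁆

/-- The orthogonal complement of an ideal with respect to an invariant form. -/
def orthIdeal (h : LinearMap.BilinForm ℝ L) (hh : IsAdInvariant h)
    (J : LieIdeal ℝ L) : LieIdeal ℝ L where
  carrier := {x | ∀ y ∈ J, h x y = 0}
  add_mem' ha hb y hy := by rw [map_add, LinearMap.add_apply, ha y hy, hb y hy, add_zero]
  zero_mem' y _ := by simp
  smul_mem' c x hx y hy := by rw [map_smul, LinearMap.smul_apply, hx y hy, smul_zero]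
  lie_mem {z x} hx y hy := by
    rw [hh, hx _ (lie_mem_right ℝ L J z y hy), neg_zero]

/-- The part of `J` lying in `I` is an ideal of the simple algebra `I`. -/
lemma inf_eq_bot_or_le_of_isSimple {I : LieIdeal ℝ L} (hI : LieAlgebra.IsSimple ℝ I)
    (J : LieIdeal ℝ L) : I ⊓ J = ⊥ ∨ I ≤ J := by
  rcases hI.eq_bot_or_eq_top (J.comap I.incl) with h | h
  · left
    rw [eq_bot_iff]
    rintro x ⟨hxI, hxJ⟩
    have : (⟨x, hxI⟩ : I) ∈ J.comap I.incl := by simpa [LieIdeal.mem_comap] using hxJ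
    rw [h, LieSubmodule.mem_bot] at this
    rw [LieSubmodule.mem_bot]
    exact congrArg Subtype.val this
  · right
    intro x hx
    have : (⟨x, hx⟩ : I) ∈ J.comap I.incl := by rw [h]; exact LieSubmodule.mem_top _
    simpa [LieIdeal.mem_comap] using this

lemma lie_eq_zero_of_inf_eq_bot {I J : LieIdeal ℝ L} (h : I ⊓ J = ⊥) {x y : L} (hx : x ∈ I)
    (hy : y ∈ J) : ⁅x, y⁆ = 0 := by
  have : ⁅x, y⁆ ∈ I ⊓ J := ⟨lie_mem_left ℝ L I x y hx, lie_mem_right ℝ L J x y hy⟩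
  rwa [h, LieSubmodule.mem_bot] at this

lemma exists_lie_ne_zero {I : LieIdeal ℝ L} (hI : LieAlgebra.IsSimple ℝ I) :
    ∃ x ∈ I, ∃ y ∈ I, ⁅x, y⁆ ≠ 0 := by
  by_contra! h
  exact hI.non_abelian ⟨fun x y => Subtype.ext (h x x.2 y y.2)⟩

/-- Two simple ideals that meet nontrivially contain each other, and a simple ideal that meets the
centre would be central, hence abelian. -/
lemma Factor.inf_eq_bot {i j : Factor L} (hij : i ≠ j) : i.ideal ⊓ j.ideal = ⊥ := by
  have key : ∀ I : LieIdeal ℝ L, LieAlgebra.IsSimple ℝ I → I ⊓ LieAlgebra.center ℝ L = ⊥ := by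
    intro I hI
    refine (inf_eq_bot_or_le_of_isSimple hI _).resolve_right fun hle => ?_
    obtain ⟨x, -, y, hy, hxy⟩ := exists_lie_ne_zero hI
    exact hxy (hle hy x)
  have hij' : i.ideal ≠ j.ideal := fun h => hij (Subtype.ext h)
  rcases i.2 with hi | ⟨hi, -⟩
  · rcases j.2 with hj | ⟨hj, -⟩
    · rcases inf_eq_bot_or_le_of_isSimple (J := j.ideal) hi with h | h
      · exact h
      · rcases inf_eq_bot_or_le_of_isSimple (J := i.ideal) hj with h' | h'
        · rw [inf_comm]; exact h'
        · exact absurd (le_antisymm h h') hij'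
    · change i.1 ⊓ j.1 = ⊥
      rw [hj]; exact key _ hi
  · rcases j.2 with hj | ⟨hj, -⟩
    · change i.1 ⊓ j.1 = ⊥
      rw [hi, inf_comm]; exact key _ hj
    · exact absurd (hi.trans hj.symm) hij'

lemma Factor.lie_eq_zero {i j : Factor L} (hij : i ≠ j) {x y : L} (hx : x ∈ i.ideal)
    (hy : y ∈ j.ideal) : ⁅x, y⁆ = 0 :=
  lie_eq_zero_of_inf_eq_bot (Factor.inf_eq_bot hij) hx hy

/-- Distinct summands are orthogonal with respect to any invariant symmetric form. -/
lemma Factor.apply_eq_zero (h : LinearMap.BilinForm ℝ L)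
    (hs : ∀ x y, h x y = h y x) (hh : IsAdInvariant h) {i j : Factor L}
    (hij : i ≠ j) {x y : L} (hx : x ∈ i.ideal) (hy : y ∈ j.ideal) : h x y = 0 := by
  have key : ∀ {i j : Factor L}, i ≠ j → LieAlgebra.IsSimple ℝ i.ideal →
      ∀ {x y : L}, x ∈ i.ideal → y ∈ j.ideal → h x y = 0 := by
    intro i j hij hi x y hx hy
    -- The orthogonal ideal of the `j`-th summand contains all brackets of the simple `i`-th one, by
    -- invariance, so it cannot meet it trivially.
    rcases inf_eq_bot_or_le_of_isSimple (J := orthIdeal h hh j.ideal) hi with h0 | h0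
    · exfalso
      obtain ⟨a, ha, b, hb, hab⟩ := exists_lie_ne_zero hi
      have : ⁅a, b⁆ ∈ i.ideal ⊓ orthIdeal h hh j.ideal := by
        refine ⟨lie_mem_left ℝ L _ a b ha, fun y hy => ?_⟩
        rw [hh, Factor.lie_eq_zero hij ha hy, map_zero, neg_zero]
      rw [h0, LieSubmodule.mem_bot] at this
      exact hab this
    · exact h0 hx y hy
  rcases i.2 with hi | ⟨hi, -⟩
  · exact key hij hi hx hy
  · rcases j.2 with hj | ⟨hj, -⟩
    · rw [hs]; exact key hij.symm hj hy hx
    · exact absurd (Subtype.ext (hi.trans hj.symm)) hij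

lemma orthIdeal_inf_eq_bot (q : InnerForm L) (hq : IsAdInvariant q.form)
    (I : LieIdeal ℝ L) : I ⊓ orthIdeal q.form hq I = ⊥ := by
  rw [eq_bot_iff]
  rintro x ⟨hx, hx'⟩
  exact (LieSubmodule.mem_bot _).2 (q.eq_zero (hx' x hx))

variable [FiniteDimensional ℝ L]

lemma exists_add_orthIdeal (q : InnerForm L) (hq : IsAdInvariant q.form)
    (I : LieIdeal ℝ L) (z : L) :
    ∃ a ∈ I, ∃ b ∈ orthIdeal q.form hq I, a + b = z := by
  have h := (q.isCompl_orthogonal I.toSubmodule).sup_eq_top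
  obtain ⟨a, ha, b, hb, hab⟩ := Submodule.mem_sup.1 (h ▸ Submodule.mem_top : z ∈ _)
  refine ⟨a, ha, b, fun y hy => ?_, hab⟩
  rw [q.symm]
  exact hb y hy

/-- A minimal ideal is simple or central. -/
lemma isSimple_or_le_center_of_isAtom (q : InnerForm L) (hq : IsAdInvariant q.form)
    {I : LieIdeal ℝ L} (hI : IsAtom I) :
    LieAlgebra.IsSimple ℝ I ∨ I ≤ LieAlgebra.center ℝ L := by
  -- The complementary ideal commutes with `I`. So an abelian `I` is central, and any ideal `W` of
  -- `I` is already an ideal `W'` of `L`, to which minimality applies.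
  have hcomm : ∀ b ∈ orthIdeal q.form hq I, ∀ x ∈ I, ⁅b, x⁆ = 0 := fun b hb x hx =>
    lie_eq_zero_of_inf_eq_bot (by rw [inf_comm]; exact orthIdeal_inf_eq_bot q hq I) hb hx
  by_cases hab : IsLieAbelian I
  · right
    intro x hx z
    obtain ⟨a, ha, b, hb, rfl⟩ := exists_add_orthIdeal q hq I z
    rw [add_lie, hcomm b hb x hx, add_zero]
    exact congrArg Subtype.val (hab.trivial ⟨a, ha⟩ ⟨x, hx⟩)
  · left
    refine ⟨fun W => ?_, hab⟩
    let W' : LieIdeal ℝ L :=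
      { W.toSubmodule.map I.toSubmodule.subtype with
        lie_mem := by
          rintro z _ ⟨w, hw, rfl⟩
          obtain ⟨a, ha, b, hb, rfl⟩ := exists_add_orthIdeal q hq I z
          refine ⟨⁅(⟨a, ha⟩ : I), w⁆, lie_mem_right ℝ I W _ _ hw, ?_⟩
          simp only [Submodule.subtype_apply, add_lie]
          rw [hcomm b hb w w.2, add_zero]
          rfl }
    have hle : W' ≤ I := by
      rintro _ ⟨w, -, rfl⟩
      exact w.2
    rcases hI.le_iff.1 hle with h0 | h1
    · left
      rw [eq_bot_iff]
      intro w hw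
      have : (w : L) ∈ W' := ⟨w, hw, rfl⟩
      rw [h0, LieSubmodule.mem_bot] at this
      rw [LieSubmodule.mem_bot]
      exact Subtype.ext this
    · right
      rw [eq_top_iff]
      intro w _
      have : (w : L) ∈ W' := by rw [h1]; exact w.2
      obtain ⟨w', hw', h⟩ := this
      have : w' = w := Subtype.ext h
      exact this ▸ hw'

/-- If the orthogonal ideal of the sum were nonzero, it would contain a minimal ideal; that ideal is
simple or central, so it also lies in the sum, and the two intersect trivially. -/
lemma iSup_factor_eq_top (q : InnerForm L) (hq : IsAdInvariant q.form) :
    ⨆ i : Factor L, i.ideal = ⊤ := by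
  set S := ⨆ i : Factor L, i.ideal with hS
  suffices h : orthIdeal q.form hq S = ⊥ by
    rw [eq_top_iff]
    intro z _
    obtain ⟨a, ha, b, hb, rfl⟩ := exists_add_orthIdeal q hq S z
    rw [h, LieSubmodule.mem_bot] at hb
    rwa [hb, add_zero]
  rcases eq_bot_or_exists_atom_le (orthIdeal q.form hq S) with h | ⟨I, hI, hle⟩
  · exact h
  · exfalso
    have hIS : I ≤ S := by
      rcases isSimple_or_le_center_of_isAtom q hq hI with h | h
      · exact le_iSup (fun i : Factor L => i.ideal) ⟨I, Or.inl h⟩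
      · have hc : LieAlgebra.center ℝ L ≠ ⊥ := fun h0 => hI.1 (le_bot_iff.1 (h0 ▸ h))
        exact h.trans (le_iSup (fun i : Factor L => i.ideal) ⟨_, Or.inr ⟨rfl, hc⟩⟩)
    apply hI.1
    rw [← le_bot_iff, ← orthIdeal_inf_eq_bot q hq S]
    exact le_inf hIS hle

/-- An orthonormal basis adapted to the decomposition into simple ideals and the centre. -/
lemma exists_adapted_basis (q : InnerForm L) (hq : IsAdInvariant q.form) :
    ∃ e : Module.Basis (Σ i : Factor L, Fin (Module.finrank ℝ i.ideal)) ℝ L,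
      q.IsOrthonormalBasis e ∧ ∀ a, e a ∈ a.1.ideal := by
  have hind : iSupIndep fun i : Factor L => i.ideal.toSubmodule := by
    rw [iSupIndep_def]
    intro i
    rw [disjoint_iff, eq_bot_iff]
    rintro x ⟨hxi, hx⟩
    have hle : ⨆ j, ⨆ _ : j ≠ i, j.ideal.toSubmodule
        ≤ (orthIdeal q.form hq i.ideal).toSubmodule := by
      refine iSup₂_le fun j hji y hy z hz => ?_
      exact Factor.apply_eq_zero q.form q.symm hq hji hy hz
    exact (Submodule.mem_bot ℝ).2 (q.eq_zero (hle hx x hxi))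
  classical
  have hint : DirectSum.IsInternal fun i : Factor L => i.ideal.toSubmodule := by
    rw [DirectSum.isInternal_submodule_iff_iSupIndep_and_iSup_eq_top]
    refine ⟨hind, ?_⟩
    rw [← LieSubmodule.iSup_toSubmodule, iSup_factor_eq_top q hq]
    rfl
  have hb : ∀ i : Factor L, ∃ v : Module.Basis (Fin (Module.finrank ℝ i.ideal)) ℝ i.ideal,
      ∀ a b, q.form (v a) (v b) = if a = b then 1 else 0 := by
    intro i
    classical
    let qi : InnerForm i.ideal :=
      { form := q.form.restrict i.ideal.toSubmodule
        symm := fun x y => q.symm x y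
        pos := fun x hx => q.pos x fun h => hx (Subtype.ext h) }
    obtain ⟨v, hv⟩ := qi.exists_isOrthonormalBasis
    exact ⟨v, hv.eq_ite⟩
  choose v hv using hb
  refine ⟨hint.collectedBasis v, ⟨?_, ?_⟩, fun a => hint.collectedBasis_mem v a⟩ <;>
    rw [hint.collectedBasis_coe]
  · rintro ⟨i, a⟩
    exact (hv i a a).trans (if_pos rfl)
  rintro ⟨i, a⟩ ⟨j, b⟩ hab
  by_cases hij : i = j
  · subst hij
    exact (hv i a b).trans (if_neg fun h => hab (by rw [h]))
  · exact Factor.apply_eq_zero q.form q.symm hq hij (v i a).2 (v j b).2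

end InvariantInner

/-! ### Cartan decompositions and the isotropy representation on `𝔭`. -/

section Cartan

variable {𝔤 : Type*} [LieRing 𝔤] [LieAlgebra ℝ 𝔤]

lemma killingForm_lie (z x y : 𝔤) : killingForm ℝ 𝔤 ⁅z, x⁆ y = -killingForm ℝ 𝔤 x ⁅z, y⁆ :=
  LieModule.traceForm_apply_lie_apply' ℝ 𝔤 𝔤 z x y

variable {𝔨 : LieSubalgebra ℝ 𝔤}

lemma killingForm_of_mem_of_mem_pPart {x y : 𝔤} (hx : x ∈ 𝔨) (hy : y ∈ pPart 𝔨) :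
    killingForm ℝ 𝔤 x y = 0 := hy x hx

lemma killingForm_of_mem_pPart_of_mem {x y : 𝔤} (hx : x ∈ pPart 𝔨) (hy : y ∈ 𝔨) :
    killingForm ℝ 𝔤 x y = 0 := by
  rw [LieModule.traceForm_comm]; exact hx y hy

/-- Invariance of a bilinear form under `𝔨`. -/
def IsInvariantUnder (𝔨 : LieSubalgebra ℝ 𝔤) (h : LinearMap.BilinForm ℝ 𝔤) : Prop :=
  ∀ z ∈ 𝔨, ∀ x y, h ⁅z, x⁆ y = -h x ⁅z, y⁆

namespace IsCartanDecomposition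

lemma exists_add (hC : IsCartanDecomposition 𝔨)
    (x : 𝔤) : ∃ a ∈ pPart 𝔨, ∃ b ∈ 𝔨, a + b = x :=
  Submodule.mem_sup.1 (hC.isCompl.sup_eq_top ▸ Submodule.mem_top : x ∈ pPart 𝔨 ⊔ 𝔨.toSubmodule)

lemma eq_zero_of_mem (hC : IsCartanDecomposition 𝔨)
    {x : 𝔤} (hx : x ∈ pPart 𝔨) (hx' : x ∈ 𝔨) : x = 0 :=
  (Submodule.mem_bot ℝ).1 (hC.isCompl.inf_eq_bot ▸ ⟨hx, hx'⟩ : x ∈ (⊥ : Submodule ℝ 𝔤))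

lemma form_of_mem_pPart (hC : IsCartanDecomposition 𝔨) {x : 𝔤} (hx : x ∈ pPart 𝔨) (y : 𝔤) :
    (cartanInner hC).form x y = killingForm ℝ 𝔤 x y := by
  obtain ⟨a, ha, b, hb, rfl⟩ := hC.exists_add y
  have h1 : (pPart 𝔨).projection 𝔨.toSubmodule hC.isCompl x = x :=
    Submodule.projection_apply_left hC.isCompl ⟨x, hx⟩
  have h2 : (pPart 𝔨).projection 𝔨.toSubmodule hC.isCompl a = a :=
    Submodule.projection_apply_left hC.isCompl ⟨a, ha⟩
  have h3 : (pPart 𝔨).projection 𝔨.toSubmodule hC.isCompl b = 0 :=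
    (Submodule.projection_apply_eq_zero_iff hC.isCompl).2 hb
  have h4 : 𝔨.toSubmodule.projection (pPart 𝔨) hC.isCompl.symm x = 0 :=
    (Submodule.projection_apply_eq_zero_iff hC.isCompl.symm).2 hx
  simp only [cartanInner, LinearMap.sub_apply, LinearMap.compl₁₂_apply, map_add, h1, h2, h3, h4,
    LinearMap.zero_apply, map_zero, killingForm_of_mem_pPart_of_mem hx hb]
  ring

lemma form_of_mem (hC : IsCartanDecomposition 𝔨) {x : 𝔤} (hx : x ∈ 𝔨) (y : 𝔤) :
    (cartanInner hC).form x y = -killingForm ℝ 𝔤 x y := by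
  obtain ⟨a, ha, b, hb, rfl⟩ := hC.exists_add y
  have h1 : (𝔨.toSubmodule).projection (pPart 𝔨) hC.isCompl.symm x = x :=
    Submodule.projection_apply_left hC.isCompl.symm ⟨x, hx⟩
  have h2 : (𝔨.toSubmodule).projection (pPart 𝔨) hC.isCompl.symm b = b :=
    Submodule.projection_apply_left hC.isCompl.symm ⟨b, hb⟩
  have h3 : (𝔨.toSubmodule).projection (pPart 𝔨) hC.isCompl.symm a = 0 :=
    (Submodule.projection_apply_eq_zero_iff hC.isCompl.symm).2 ha
  have h4 : (pPart 𝔨).projection 𝔨.toSubmodule hC.isCompl x = 0 :=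
    (Submodule.projection_apply_eq_zero_iff hC.isCompl).2 hx
  simp only [cartanInner, LinearMap.sub_apply, LinearMap.compl₁₂_apply, map_add, h1, h2, h3, h4,
    LinearMap.zero_apply, map_zero, killingForm_of_mem_of_mem_pPart hx ha]
  ring

lemma form_of_mem_pPart_of_mem (hC : IsCartanDecomposition 𝔨) {x y : 𝔤} (hx : x ∈ pPart 𝔨)
    (hy : y ∈ 𝔨) :
    (cartanInner hC).form x y = 0 := by
  rw [hC.form_of_mem_pPart hx, killingForm_of_mem_pPart_of_mem hx hy]

lemma form_of_mem_of_mem_pPart (hC : IsCartanDecomposition 𝔨) {x y : 𝔤} (hx : x ∈ 𝔨)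
    (hy : y ∈ pPart 𝔨) :
    (cartanInner hC).form x y = 0 := by
  rw [InnerForm.symm, hC.form_of_mem_pPart_of_mem hy hx]

/-- For `z ∈ 𝔨`, `ad z` preserves `𝔭` and `𝔨`, on which `Q` is the invariant Killing form up to a
sign. -/
lemma form_lie (hC : IsCartanDecomposition 𝔨) {z : 𝔤} (hz : z ∈ 𝔨) (x y : 𝔤) :
    (cartanInner hC).form ⁅z, x⁆ y = -(cartanInner hC).form x ⁅z, y⁆ := by
  obtain ⟨a, ha, b, hb, rfl⟩ := hC.exists_add x
  simp only [lie_add, map_add, LinearMap.add_apply]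
  rw [hC.form_of_mem_pPart (hC.lie_k_p z hz a ha), hC.form_of_mem (𝔨.lie_mem hz hb),
    hC.form_of_mem_pPart ha, hC.form_of_mem hb, killingForm_lie, killingForm_lie]
  ring

lemma killingForm_nondegenerate (hC : IsCartanDecomposition 𝔨)
    {x : 𝔤} (h : ∀ y, killingForm ℝ 𝔤 x y = 0) : x = 0 := by
  obtain ⟨a, ha, b, hb, rfl⟩ := hC.exists_add x
  have h1 : a = 0 := by
    by_contra h0
    have := h a
    rw [map_add, LinearMap.add_apply, killingForm_of_mem_of_mem_pPart hb ha, add_zero] at this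
    exact (hC.killing_pos a ha h0).ne' this
  have h2 : b = 0 := by
    by_contra h0
    have := h b
    rw [map_add, LinearMap.add_apply, killingForm_of_mem_pPart_of_mem ha hb, zero_add] at this
    exact (hC.killing_neg b hb h0).ne this
  rw [h1, h2, add_zero]

lemma mem_of_killingForm_eq_zero (hC : IsCartanDecomposition 𝔨)
    {x : 𝔤} (h : ∀ y ∈ pPart 𝔨, killingForm ℝ 𝔤 x y = 0) :
    x ∈ 𝔨 := by
  obtain ⟨a, ha, b, hb, rfl⟩ := hC.exists_add x
  have h1 : a = 0 := by
    by_contra h0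
    have := h a ha
    rw [map_add, LinearMap.add_apply, killingForm_of_mem_of_mem_pPart hb ha, add_zero] at this
    exact (hC.killing_pos a ha h0).ne' this
  rwa [h1, zero_add]

section Simple

/-- `𝔨` acts faithfully on `𝔭`. -/
lemma eq_zero_of_lie_eq_zero (hC : IsCartanDecomposition 𝔨) (hG : LieAlgebra.IsSimple ℝ 𝔤)
    (hp : pPart 𝔨 ≠ ⊥)
    {z : 𝔤} (hz : z ∈ 𝔨) (h : ∀ x ∈ pPart 𝔨, ⁅z, x⁆ = 0) : z = 0 := by
  -- The kernel of the action is stable under `𝔨` and commutes with `𝔭`, so it is an ideal of `𝔤`;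
  -- it lies in `𝔨`, hence is proper because `𝔭` is nonzero.
  let I : LieIdeal ℝ 𝔤 :=
    { carrier := {z | z ∈ 𝔨 ∧ ∀ x ∈ pPart 𝔨, ⁅z, x⁆ = 0}
      add_mem' := fun {a b} ha hb => ⟨𝔨.add_mem ha.1 hb.1, fun x hx => by
        rw [add_lie, ha.2 x hx, hb.2 x hx, add_zero]⟩
      zero_mem' := ⟨𝔨.zero_mem, fun x _ => zero_lie x⟩
      smul_mem' := fun c a ha => ⟨𝔨.smul_mem c ha.1, fun x hx => by
        rw [smul_lie, ha.2 x hx, smul_zero]⟩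
      lie_mem := by
        rintro y z ⟨hz, hz'⟩
        obtain ⟨a, ha, b, hb, rfl⟩ := hC.exists_add y
        have h0 : ⁅a, z⁆ = 0 := by rw [← lie_skew, hz' a ha, neg_zero]
        rw [add_lie, h0, zero_add]
        refine ⟨𝔨.lie_mem hb hz, fun x hx => ?_⟩
        rw [lie_lie, hz' x hx, hz' _ (hC.lie_k_p b hb x hx), lie_zero, sub_zero] }
  have hzI : z ∈ I := ⟨hz, h⟩
  rcases hG.eq_bot_or_eq_top I with h0 | h1
  · rwa [h0, LieSubmodule.mem_bot] at hzI
  · refine absurd ?_ hp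
    rw [eq_bot_iff]
    intro x hx
    have : x ∈ I := by rw [h1]; exact LieSubmodule.mem_top _
    exact (Submodule.mem_bot ℝ).2 (hC.eq_zero_of_mem hx this.1)

variable [FiniteDimensional ℝ 𝔤]

/-- The isotropy representation of `𝔨` on `𝔭` is irreducible. -/
lemma pPart_irreducible (hC : IsCartanDecomposition 𝔨) (hG : LieAlgebra.IsSimple ℝ 𝔤)
    {W : Submodule ℝ 𝔤} (hW : W ≤ pPart 𝔨)
    (hinv : ∀ z ∈ 𝔨, ∀ x ∈ W, ⁅z, x⁆ ∈ W) : W = ⊥ ∨ W = pPart 𝔨 := by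
  set Q := cartanInner hC
  -- With `y = ⁅w, w'⁆ ∈ 𝔨`, invariance gives `B(y, y) = Q(⁅y, w⁆, w')`. This vanishes since `⁅y, w⁆
  -- ∈ W`, while `B` is negative definite on `𝔨`.
  have hcomm : ∀ w ∈ W, ∀ w' ∈ pPart 𝔨, (∀ v ∈ W, Q.form v w' = 0) → ⁅w, w'⁆ = 0 := by
    intro w hw w' hw' horth
    have hk := hC.lie_p_p w (hW hw) w' hw'
    by_contra h0
    apply (hC.killing_neg _ hk h0).ne
    have h1 := hinv _ hk w hw
    rw [killingForm_lie, ← lie_skew, map_neg, neg_neg, LieModule.traceForm_comm,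
      ← hC.form_of_mem_pPart (hW h1), horth _ h1]
  let S : Set 𝔤 := {u | ∃ w ∈ W, ∃ v ∈ W, ⁅w, v⁆ = u}
  -- `W + [W, W]` turns out to be an ideal: its normaliser `N` contains `𝔨`, `W` and the complement
  -- of `W` in `𝔭`. As `[W, W] ⊆ 𝔨`, its intersection with `𝔭` is `W`, so simplicity of `𝔤` decides
  -- the case.
  let I₀ : Submodule ℝ 𝔤 := W ⊔ Submodule.span ℝ S
  have hS : Submodule.span ℝ S ≤ 𝔨.toSubmodule := by
    rw [Submodule.span_le]
    rintro _ ⟨w, hw, v, hv, rfl⟩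
    exact hC.lie_p_p w (hW hw) v (hW hv)
  let N : Submodule ℝ 𝔤 :=
    { carrier := {z | ∀ x ∈ I₀, ⁅z, x⁆ ∈ I₀}
      add_mem' := fun {a b} ha hb x hx => by rw [add_lie]; exact I₀.add_mem (ha x hx) (hb x hx)
      zero_mem' := fun x _ => by rw [zero_lie]; exact I₀.zero_mem
      smul_mem' := fun c a ha x hx => by rw [smul_lie]; exact I₀.smul_mem c (ha x hx) }
  have hN : ∀ z, (∀ w ∈ W, ⁅z, w⁆ ∈ I₀) → (∀ w ∈ W, ∀ v ∈ W, ⁅z, ⁅w, v⁆⁆ ∈ I₀) → z ∈ N := by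
    intro z h1 h2 x hx
    have : I₀ ≤ I₀.comap (LieAlgebra.ad ℝ 𝔤 z) := by
      refine sup_le h1 (Submodule.span_le.2 ?_)
      rintro _ ⟨w, hw, v, hv, rfl⟩
      exact h2 w hw v hv
    exact this hx
  have hWI : W ≤ I₀ := le_sup_left
  have hSI : ∀ w ∈ W, ∀ v ∈ W, ⁅w, v⁆ ∈ I₀ := fun w hw v hv =>
    (le_sup_right : _ ≤ I₀) (Submodule.subset_span ⟨w, hw, v, hv, rfl⟩)
  have hNk : ∀ z ∈ 𝔨, z ∈ N := by
    intro z hz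
    refine hN z (fun w hw => hWI (hinv z hz w hw)) fun w hw v hv => ?_
    rw [leibniz_lie]
    exact I₀.add_mem (hSI _ (hinv z hz w hw) v hv) (hSI w hw _ (hinv z hz v hv))
  have hNW : ∀ z ∈ W, z ∈ N := by
    intro z hz
    refine hN z (fun w hw => hSI z hz w hw) fun w hw v hv => ?_
    rw [← lie_skew]
    exact I₀.neg_mem (hWI (hinv _ (hC.lie_p_p w (hW hw) v (hW hv)) z hz))
  have hNW' : ∀ z ∈ pPart 𝔨, (∀ v ∈ W, Q.form v z = 0) → z ∈ N := by
    intro z hz horth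
    have h0 : ∀ w ∈ W, ⁅z, w⁆ = 0 := fun w hw => by
      rw [← lie_skew, hcomm w hw z hz horth, neg_zero]
    refine hN z (fun w hw => by rw [h0 w hw]; exact I₀.zero_mem) fun w hw v hv => ?_
    rw [leibniz_lie, h0 w hw, h0 v hv, zero_lie, lie_zero, add_zero]
    exact I₀.zero_mem
  have hNtop : ∀ z, z ∈ N := by
    intro z
    obtain ⟨a, ha, b, hb, rfl⟩ := hC.exists_add z
    refine N.add_mem ?_ (hNk b hb)
    obtain ⟨w, hw, w', hw', rfl⟩ := Submodule.mem_sup.1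
      ((Q.isCompl_orthogonal W).sup_eq_top ▸ Submodule.mem_top : a ∈ _)
    refine N.add_mem (hNW w hw) (hNW' w' ?_ hw')
    have := (pPart 𝔨).sub_mem ha (hW hw)
    rwa [add_sub_cancel_left] at this
  let I : LieIdeal ℝ 𝔤 := { I₀ with lie_mem := fun {z x} hx => hNtop z x hx }
  rcases hG.eq_bot_or_eq_top I with h | h
  · left
    rw [eq_bot_iff]
    intro w hw
    have : w ∈ I := hWI hw
    rwa [h] at this
  · right
    refine le_antisymm hW fun x hx => ?_
    have : x ∈ I := by rw [h]; exact LieSubmodule.mem_top _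
    obtain ⟨w, hw, s, hs, rfl⟩ := Submodule.mem_sup.1 (show _ ∈ I₀ from this)
    have h1 : s ∈ pPart 𝔨 := by
      have := (pPart 𝔨).sub_mem hx (hW hw)
      rwa [add_sub_cancel_left] at this
    rw [hC.eq_zero_of_mem h1 (hS hs), add_zero]
    exact hw

lemma exists_eq_smul_on_pPart (hC : IsCartanDecomposition 𝔨) (hG : LieAlgebra.IsSimple ℝ 𝔤)
    {h : LinearMap.BilinForm ℝ 𝔤} (hs : ∀ x y, h x y = h y x)
    (hh : IsInvariantUnder 𝔨 h) :
    ∃ c : ℝ, ∀ x ∈ pPart 𝔨, ∀ y ∈ pPart 𝔨, h x y = c * (cartanInner hC).form x y := by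
  let q : InnerForm (pPart 𝔨) :=
    { form := (cartanInner hC).form.restrict (pPart 𝔨)
      symm := fun x y => (cartanInner hC).symm x y
      pos := fun x hx => (cartanInner hC).pos x fun h => hx (Subtype.ext h) }
  obtain ⟨c, hc⟩ := q.eq_smul_of_irreducible (h.restrict (pPart 𝔨)) (fun x y => hs x y)
    (fun (z : 𝔨) x => ⟨⁅(z : 𝔤), (x : 𝔤)⁆, hC.lie_k_p z z.2 x x.2⟩)
    (fun z x y => hC.form_lie z.2 x y) (fun z x y => hh z z.2 x y) (by
      intro W hW
      have hinj := (pPart 𝔨).injective_subtype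
      have := hC.pPart_irreducible hG (W := W.map (pPart 𝔨).subtype)
        (by rintro _ ⟨w, -, rfl⟩; exact w.2)
        (by rintro z hz _ ⟨w, hw, rfl⟩; exact ⟨_, hW ⟨z, hz⟩ w hw, rfl⟩)
      rcases this with h0 | h1
      · left
        rw [eq_bot_iff]
        intro w hw
        have : (w : 𝔤) ∈ W.map (pPart 𝔨).subtype := ⟨w, hw, rfl⟩
        rw [h0, Submodule.mem_bot] at this
        exact (Submodule.mem_bot ℝ).2 (Subtype.ext this)
      · right
        rw [eq_top_iff]
        intro x _
        obtain ⟨w, hw, hwx⟩ : (x : 𝔤) ∈ W.map (pPart 𝔨).subtype := by rw [h1]; exact x.2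
        exact (hinj hwx : w = x) ▸ hw)
  exact ⟨c, fun x hx y hy => hc ⟨x, hx⟩ ⟨y, hy⟩⟩

/-- The centre of `𝔨` is at most one-dimensional. -/
lemma center_proportional (hC : IsCartanDecomposition 𝔨) (hG : LieAlgebra.IsSimple ℝ 𝔤)
    (hp : pPart 𝔨 ≠ ⊥)
    {x y : 𝔨} (hx : x ∈ LieAlgebra.center ℝ 𝔨)
    (hy : y ∈ LieAlgebra.center ℝ 𝔨) (hy0 : y ≠ 0) : ∃ s : ℝ, x = s • y := by
  set Q := cartanInner hC
  have hcen : ∀ u ∈ LieAlgebra.center ℝ 𝔨, ∀ z ∈ 𝔨, ∀ v : 𝔤,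
      ⁅(u : 𝔤), ⁅z, v⁆⁆ = ⁅z, ⁅(u : 𝔤), v⁆⁆ := by
    intro u hu z hz v
    have h1 : ⁅z, (u : 𝔤)⁆ = 0 := congrArg Subtype.val (hu ⟨z, hz⟩)
    have h2 := leibniz_lie z (u : 𝔤) v
    rw [h1, zero_lie, zero_add] at h2
    exact h2.symm
  -- For central `u`, `w` the operators `ad u`, `ad w` commute with each other and with `𝔨`, so this
  -- form is symmetric and invariant; Schur's lemma applies on `𝔭`.
  have key : ∀ u ∈ LieAlgebra.center ℝ 𝔨, ∀ w ∈ LieAlgebra.center ℝ 𝔨, ∃ c : ℝ, ∀ a ∈ pPart 𝔨,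
      ∀ b ∈ pPart 𝔨, Q.form ⁅(u : 𝔤), a⁆ ⁅(w : 𝔤), b⁆ = c * Q.form a b := by
    intro u hu w hw
    refine hC.exists_eq_smul_on_pPart hG
      (h := Q.form.compl₁₂ (LieAlgebra.ad ℝ 𝔤 u) (LieAlgebra.ad ℝ 𝔤 w)) ?_ ?_
    · intro a b
      change Q.form ⁅(u : 𝔤), a⁆ ⁅(w : 𝔤), b⁆ = Q.form ⁅(u : 𝔤), b⁆ ⁅(w : 𝔤), a⁆
      rw [hC.form_lie u.2, hcen u hu w w.2, Q.symm, hC.form_lie w.2, neg_neg]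
    · intro z hz a b
      change Q.form ⁅(u : 𝔤), ⁅z, a⁆⁆ ⁅(w : 𝔤), b⁆ = -Q.form ⁅(u : 𝔤), a⁆ ⁅(w : 𝔤), ⁅z, b⁆⁆
      rw [hcen u hu z hz, hC.form_lie hz, hcen w hw z hz]
  obtain ⟨c₁, h1⟩ := key x hx y hy
  obtain ⟨c₂, h2⟩ := key y hy y hy
  have hyp : ∃ v ∈ pPart 𝔨, ⁅(y : 𝔤), v⁆ ≠ 0 := by
    by_contra! h
    exact hy0 (Subtype.ext (hC.eq_zero_of_lie_eq_zero hG hp y.2 h))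
  have hc2 : c₂ ≠ 0 := by
    rintro rfl
    obtain ⟨v, hv, hv0⟩ := hyp
    apply hv0
    apply Q.eq_zero
    rw [h2 v hv v hv, zero_mul]
  -- The combination for which `Q(⁅w, a⁆, ⁅y, b⁆)` vanishes on `𝔭`. Since `ad y` scales `Q` on `𝔭`
  -- by `c₂ ≠ 0`, `w` must annihilate `𝔭`, and faithfulness gives `w = 0`.
  set w : 𝔨 := c₂ • x - c₁ • y with hw
  have hwy : ∀ a ∈ pPart 𝔨, ∀ b ∈ pPart 𝔨, Q.form ⁅(w : 𝔤), a⁆ ⁅(y : 𝔤), b⁆ = 0 := by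
    intro a ha b hb
    have : (w : 𝔤) = c₂ • (x : 𝔤) - c₁ • (y : 𝔤) := rfl
    rw [this, sub_lie, smul_lie, smul_lie, map_sub, LinearMap.sub_apply, map_smul, map_smul,
      LinearMap.smul_apply, LinearMap.smul_apply, h1 a ha b hb, h2 a ha b hb]
    simp only [smul_eq_mul]
    ring
  have hw0 : w = 0 := by
    refine Subtype.ext (hC.eq_zero_of_lie_eq_zero hG hp w.2 fun a ha => ?_)
    have hm := hC.lie_k_p w w.2 a ha
    have h3 := hwy a ha _ (hC.lie_k_p y y.2 _ hm)
    rw [← neg_eq_iff_eq_neg.2 (hC.form_lie y.2 ⁅(w : 𝔤), a⁆ ⁅(y : 𝔤), ⁅(w : 𝔤), a⁆⁆),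
      h2 _ hm _ hm, neg_eq_zero, mul_eq_zero] at h3
    exact Q.eq_zero (h3.resolve_left hc2)
  refine ⟨c₂⁻¹ * c₁, ?_⟩
  rw [hw, sub_eq_zero] at hw0
  rw [mul_smul, ← hw0, smul_smul, inv_mul_cancel₀ hc2, one_smul]

end Simple

end IsCartanDecomposition

end Cartan

/-! ### Schur's lemma on the summands `𝔨ᵢ`, the constants `κᵢ`, and adapted bases. -/

section Factors

/-- The kernel of `tr ∘ ad` contains all brackets, so it is a nonzero ideal. This is the
unimodularity required by the curvature formula. -/
lemma trace_ad_eq_zero {𝔤 : Type*} [LieRing 𝔤] [LieAlgebra ℝ 𝔤]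
    (hG : LieAlgebra.IsSimple ℝ 𝔤) (x : 𝔤) :
    LinearMap.trace ℝ 𝔤 (LieAlgebra.ad ℝ 𝔤 x) = 0 := by
  have hbr : ∀ a b : 𝔤, LinearMap.trace ℝ 𝔤 (LieAlgebra.ad ℝ 𝔤 ⁅a, b⁆) = 0 := by
    intro a b
    have : LieAlgebra.ad ℝ 𝔤 ⁅a, b⁆ = LieAlgebra.ad ℝ 𝔤 a * LieAlgebra.ad ℝ 𝔤 b
        - LieAlgebra.ad ℝ 𝔤 b * LieAlgebra.ad ℝ 𝔤 a := by
      ext y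
      exact lie_lie a b y
    rw [this, map_sub, LinearMap.trace_mul_comm, sub_self]
  let I : LieIdeal ℝ 𝔤 :=
    { carrier := {x | LinearMap.trace ℝ 𝔤 (LieAlgebra.ad ℝ 𝔤 x) = 0}
      add_mem' := fun {a b} (ha : _ = _) (hb : _ = _) => by
        rw [Set.mem_ofPred_eq, map_add, map_add, ha, hb, add_zero]
      zero_mem' := by rw [Set.mem_ofPred_eq, map_zero, map_zero]
      smul_mem' := fun c a (ha : _ = _) => by
        rw [Set.mem_ofPred_eq, map_smul, map_smul, ha, smul_zero]
      lie_mem := fun {a b} _ => hbr a b }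
  rcases hG.eq_bot_or_eq_top I with h | h
  · refine absurd ⟨fun a b => ?_⟩ hG.non_abelian
    have : ⁅a, b⁆ ∈ I := hbr a b
    rwa [h, LieSubmodule.mem_bot] at this
  · have : x ∈ I := by rw [h]; exact LieSubmodule.mem_top _
    exact this

variable {𝔤 : Type*} [LieRing 𝔤] [LieAlgebra ℝ 𝔤] {𝔨 : LieSubalgebra ℝ 𝔤}

lemma Factor.mem_space {i : Factor 𝔨} {x : 𝔨} : (x : 𝔤) ∈ i.space ↔ x ∈ i.ideal := by
  constructor
  · rintro ⟨y, hy, hyx⟩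
    exact (Subtype.ext hyx : y = x) ▸ hy
  · exact fun h => ⟨x, h, rfl⟩

lemma Factor.exists_of_mem_space {i : Factor 𝔨} {x : 𝔤} (hx : x ∈ i.space) :
    ∃ y ∈ i.ideal, (y : 𝔤) = x := hx

lemma Factor.mem_of_mem_space {i : Factor 𝔨} {x : 𝔤} (hx : x ∈ i.space) : x ∈ 𝔨 := by
  obtain ⟨y, -, rfl⟩ := hx
  exact y.2

lemma Factor.lie_mem_space {i : Factor 𝔨} {z x : 𝔤} (hz : z ∈ 𝔨) (hx : x ∈ i.space) :
    ⁅z, x⁆ ∈ i.space := by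
  obtain ⟨y, hy, rfl⟩ := hx
  exact ⟨_, lie_mem_right ℝ 𝔨 i.ideal ⟨z, hz⟩ y hy, rfl⟩

lemma Factor.dim_eq (i : Factor 𝔨) : i.dim = Module.finrank ℝ i.ideal :=
  (Submodule.equivMapOfInjective 𝔨.toSubmodule.subtype 𝔨.toSubmodule.injective_subtype
    i.ideal.toSubmodule).finrank_eq.symm

lemma Factor.ideal_ne_bot (i : Factor 𝔨) : i.ideal ≠ ⊥ := by
  rcases i.2 with h | ⟨-, h⟩
  · intro h0
    obtain ⟨x, hx, y, -, hxy⟩ := exists_lie_ne_zero h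
    change x ∈ i.ideal at hx
    rw [h0, LieSubmodule.mem_bot] at hx
    exact hxy (by rw [hx, zero_lie])
  · exact h

namespace IsCartanDecomposition

/-- The restriction of `Q` to `𝔨`. -/
def innerK (hC : IsCartanDecomposition 𝔨) : InnerForm 𝔨 where
  form := (cartanInner hC).form.restrict 𝔨.toSubmodule
  symm x y := (cartanInner hC).symm x y
  pos x hx := (cartanInner hC).pos x fun h => hx (Subtype.ext h)

lemma innerK_form (hC : IsCartanDecomposition 𝔨) (x y : 𝔨) :
    hC.innerK.form x y = (cartanInner hC).form x y := rfl

lemma innerK_invariant (hC : IsCartanDecomposition 𝔨) : IsAdInvariant hC.innerK.form :=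
  fun z x y => hC.form_lie z.2 x y

/-- Distinct summands of `𝔨` are orthogonal for every `𝔨`-invariant symmetric form. -/
lemma apply_eq_zero_of_ne {h : LinearMap.BilinForm ℝ 𝔤} (hs : ∀ x y, h x y = h y x)
    (hh : IsInvariantUnder 𝔨 h) {i j : Factor 𝔨} (hij : i ≠ j) {x y : 𝔤} (hx : x ∈ i.space)
    (hy : y ∈ j.space) : h x y = 0 := by
  obtain ⟨x, hx, rfl⟩ := hx
  obtain ⟨y, hy, rfl⟩ := hy
  exact Factor.apply_eq_zero (L := 𝔨) (h.restrict 𝔨.toSubmodule) (fun x y => hs x y)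
    (fun z x y => hh z z.2 x y) (i := i) (j := j) hij hx hy

variable [FiniteDimensional ℝ 𝔤]

lemma _root_.NatRed.Factor.dim_pos (i : Factor 𝔨) : 0 < i.dim := by
  rw [i.dim_eq]
  have : Nontrivial i.ideal := (LieSubmodule.nontrivial_iff_ne_bot ℝ 𝔨 𝔨).2 i.ideal_ne_bot
  exact Module.finrank_pos

/-- Schur's lemma for a summand of `𝔨`. -/
lemma exists_eq_smul_on_ideal (hC : IsCartanDecomposition 𝔨) (hG : LieAlgebra.IsSimple ℝ 𝔤)
    (hp : pPart 𝔨 ≠ ⊥) (i : Factor 𝔨) {h : LinearMap.BilinForm ℝ i.ideal}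
    (hs : ∀ x y, h x y = h y x) (hh : IsAdInvariant h) :
    ∃ c : ℝ, ∀ x y : i.ideal, h x y = c * hC.innerK.form x y := by
  let q : InnerForm i.ideal :=
    { form := hC.innerK.form.restrict i.ideal.toSubmodule
      symm := fun x y => hC.innerK.symm x y
      pos := fun x hx => hC.innerK.pos x fun h => hx (Subtype.ext h) }
  have hq : IsAdInvariant q.form := fun z x y => hC.innerK_invariant z x y
  refine q.eq_smul_of_irreducible h hs (fun z x : i.ideal => ⁅z, x⁆) hq hh fun W hW => ?_
  rcases i.2 with hi | ⟨hi, -⟩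
  · let I : LieIdeal ℝ i.ideal := { W with lie_mem := fun {z x} hx => hW z x hx }
    rcases (hi : LieAlgebra.IsSimple ℝ i.ideal).eq_bot_or_eq_top I with h0 | h1
    · exact Or.inl (congrArg LieSubmodule.toSubmodule h0)
    · exact Or.inr (congrArg LieSubmodule.toSubmodule h1)
  -- On the centre the action is trivial, so irreducibility comes from the dimension being at most
  -- one.
  · rw [or_iff_not_imp_left]
    intro hW0
    obtain ⟨y, hy, hy0⟩ := (Submodule.ne_bot_iff W).1 hW0
    rw [eq_top_iff]
    intro x _
    have hc : ∀ u : i.ideal, (u : 𝔨) ∈ LieAlgebra.center ℝ 𝔨 := fun u => hi ▸ u.2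
    obtain ⟨s, hsy⟩ := hC.center_proportional hG hp (hc x) (hc y) fun h => hy0 (Subtype.ext h)
    have : x = s • y := Subtype.ext hsy
    rw [this]
    exact W.smul_mem s hy

lemma exists_eq_smul_on_space (hC : IsCartanDecomposition 𝔨) (hG : LieAlgebra.IsSimple ℝ 𝔤)
    (hp : pPart 𝔨 ≠ ⊥) (i : Factor 𝔨) {h : LinearMap.BilinForm ℝ 𝔤} (hs : ∀ x y, h x y = h y x)
    (hh : IsInvariantUnder 𝔨 h) :
    ∃ c : ℝ, ∀ x ∈ i.space, ∀ y ∈ i.space, h x y = c * (cartanInner hC).form x y := by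
  obtain ⟨c, hc⟩ := hC.exists_eq_smul_on_ideal hG hp i
    (h := (h.restrict 𝔨.toSubmodule).restrict i.ideal.toSubmodule) (fun x y => hs x y)
    (fun z x y => hh z (z : 𝔨).2 x y)
  refine ⟨c, ?_⟩
  rintro _ ⟨x, hx, rfl⟩ _ ⟨y, hy, rfl⟩
  exact hc ⟨x, hx⟩ ⟨y, hy⟩

/-- Schur's lemma applied to the Killing form of `𝔨ᵢ` shows that the default value in `Factor.kappa`
is not used. The sign appears because `Q = -B` on `𝔨`. -/
lemma kappa_spec (hC : IsCartanDecomposition 𝔨) (hG : LieAlgebra.IsSimple ℝ 𝔤)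
    (hp : pPart 𝔨 ≠ ⊥) (i : Factor 𝔨) (x y : i.ideal) :
    killingForm ℝ i.ideal x y = -i.kappa * hC.innerK.form x y := by
  have h : ∃ c : ℝ, ∀ X Y : i.ideal,
      killingForm ℝ i.ideal X Y = c * killingForm ℝ 𝔤 ((X : 𝔨) : 𝔤) ((Y : 𝔨) : 𝔤) := by
    obtain ⟨c, hc⟩ := hC.exists_eq_smul_on_ideal hG hp i (h := killingForm ℝ i.ideal)
      (LieModule.traceForm_comm ℝ _ _) (fun z x y => killingForm_lie z x y)
    refine ⟨-c, fun X Y => ?_⟩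
    rw [hc, hC.innerK_form, hC.form_of_mem X.1.2]
    ring
  have h2 := h.choose_spec x y
  rw [Factor.kappa, dif_pos h, h2, hC.innerK_form, hC.form_of_mem x.1.2]
  ring

/-- The killing form of `𝔨` on a summand. -/
lemma killingForm_of_mem_ideal (hC : IsCartanDecomposition 𝔨) (hG : LieAlgebra.IsSimple ℝ 𝔤)
    (hp : pPart 𝔨 ≠ ⊥) {i : Factor 𝔨} {x y : 𝔨} (hx : x ∈ i.ideal) (hy : y ∈ i.ideal) :
    killingForm ℝ 𝔨 x y = -i.kappa * hC.innerK.form x y := by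
  have h := hC.kappa_spec hG hp i ⟨x, hx⟩ ⟨y, hy⟩
  rw [LieIdeal.killingForm_eq] at h
  exact h

/-- The index type of a basis adapted to `𝔤 = 𝔭 ⊕ 𝔨₁ ⊕ … ⊕ 𝔨_{r+s}`. -/
abbrev _root_.NatRed.AdaptedIndex (𝔨 : LieSubalgebra ℝ 𝔤) : Type _ :=
  Fin (Module.finrank ℝ (pPart 𝔨)) ⊕ Σ i : Factor 𝔨, Fin (Module.finrank ℝ i.ideal)

/-- A `Q`-orthonormal basis adapted to `𝔤 = 𝔭 ⊕ 𝔨₁ ⊕ … ⊕ 𝔨_{r+s}`. -/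
structure IsAdapted (hC : IsCartanDecomposition 𝔨)
    (e : Module.Basis (AdaptedIndex 𝔨) ℝ 𝔤) : Prop where
  orthonormal : (cartanInner hC).IsOrthonormalBasis e
  inl_mem : ∀ α, e (Sum.inl α) ∈ pPart 𝔨
  inr_mem : ∀ a, e (Sum.inr a) ∈ a.1.space
  exists_basis : ∃ v : Module.Basis (Σ i : Factor 𝔨, Fin (Module.finrank ℝ i.ideal)) ℝ 𝔨,
    hC.innerK.IsOrthonormalBasis v ∧ ∀ a, (v a : 𝔤) = e (Sum.inr a)

lemma exists_isAdapted (hC : IsCartanDecomposition 𝔨) :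
    ∃ e : Module.Basis (AdaptedIndex 𝔨) ℝ 𝔤, hC.IsAdapted e := by
  let q : InnerForm (pPart 𝔨) :=
    { form := (cartanInner hC).form.restrict (pPart 𝔨)
      symm := fun x y => (cartanInner hC).symm x y
      pos := fun x hx => (cartanInner hC).pos x fun h => hx (Subtype.ext h) }
  obtain ⟨u, hu⟩ := q.exists_isOrthonormalBasis
  obtain ⟨v, hv, hvm⟩ := exists_adapted_basis hC.innerK hC.innerK_invariant
  let e := (u.prod v).map (Submodule.prodEquivOfIsCompl _ _ hC.isCompl)
  have hl : ∀ α, e (Sum.inl α) = u α := fun α => by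
    rw [Module.Basis.map_apply, Submodule.coe_prodEquivOfIsCompl']
    simp
  have hr : ∀ a, e (Sum.inr a) = v a := fun a => by
    rw [Module.Basis.map_apply, Submodule.coe_prodEquivOfIsCompl']
    simp
  refine ⟨e, ⟨?_, ?_⟩, fun α => ?_, fun a => ?_, v, hv, fun a => (hr a).symm⟩
  · rintro (α | a)
    · rw [hl]; exact hu.1 α
    · rw [hr]; exact hv.1 a
  · rintro (α | a) (β | b) hab
    · rw [hl, hl]; exact hu.2 α β fun h => hab (by rw [h])
    · rw [hl, hr]; exact hC.form_of_mem_pPart_of_mem (u α).2 (v b).2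
    · rw [hl, hr]; exact hC.form_of_mem_of_mem_pPart (v a).2 (u β).2
    · rw [hr, hr]; exact hv.2 a b fun h => hab (by rw [h])
  · rw [hl]; exact (u α).2
  · rw [hr]; exact Factor.mem_space.2 (hvm a)

end IsCartanDecomposition

end Factors

/-! ### Structure constants in an adapted basis and Casimir identities. -/

section StructureConstants

variable {𝔤 : Type*} [LieRing 𝔤] [LieAlgebra ℝ 𝔤]

/-- The structure constants `B([eₓ, e_y], e_z)`. -/
def structConst {ι : Type*} (e : Module.Basis ι ℝ 𝔤) (x y z : ι) : ℝ :=
  killingForm ℝ 𝔤 ⁅e x, e y⁆ (e z)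

lemma structConst_swap {ι : Type*} (e : Module.Basis ι ℝ 𝔤) (x y z : ι) :
    structConst e y x z = -structConst e x y z := by
  rw [structConst, structConst, ← lie_skew, map_neg, LinearMap.neg_apply]

/-- Using the invariant form `B` instead of `Q` makes the constants totally antisymmetric. -/
lemma structConst_rotate {ι : Type*} (e : Module.Basis ι ℝ 𝔤) (x y z : ι) :
    structConst e y z x = structConst e x y z := by
  rw [structConst, structConst, LieModule.traceForm_apply_lie_apply ℝ 𝔤 𝔤 (e x),
    LieModule.traceForm_comm]

variable {𝔨 : LieSubalgebra ℝ 𝔤} {hC : IsCartanDecomposition 𝔨}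
  {e : Module.Basis (AdaptedIndex 𝔨) ℝ 𝔤}

namespace IsCartanDecomposition.IsAdapted

lemma inr_mem_k (he : hC.IsAdapted e) (a) : e (Sum.inr a) ∈ 𝔨 :=
  Factor.mem_of_mem_space (he.inr_mem a)

lemma killingForm_inl (he : hC.IsAdapted e) (α) :
    killingForm ℝ 𝔤 (e (Sum.inl α)) (e (Sum.inl α)) = 1 := by
  rw [← hC.form_of_mem_pPart (he.inl_mem α), he.orthonormal.1]

lemma killingForm_inr (he : hC.IsAdapted e) (a) :
    killingForm ℝ 𝔤 (e (Sum.inr a)) (e (Sum.inr a)) = -1 := by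
  rw [← neg_inj, ← hC.form_of_mem (he.inr_mem_k a), he.orthonormal.1, neg_neg]

/-- On each basis vector `Q` is `B` up to sign, so `Q`-norms can be computed from the antisymmetric
constants. -/
lemma form_sq (he : hC.IsAdapted e) (v : 𝔤) (x : AdaptedIndex 𝔨) :
    (cartanInner hC).form v (e x) ^ 2 = killingForm ℝ 𝔤 v (e x) ^ 2 := by
  rw [InnerForm.symm, LieModule.traceForm_comm]
  rcases x with α | a
  · rw [hC.form_of_mem_pPart (he.inl_mem α)]
  · rw [hC.form_of_mem (he.inr_mem_k a), neg_sq]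

/-- Together with the next four lemmas: a constant can be nonzero only with exactly two indices in
`𝔭`, or with all three in the same summand of `𝔨`. -/
lemma structConst_lll (he : hC.IsAdapted e) (α β γ) :
    structConst e (Sum.inl α) (Sum.inl β) (Sum.inl γ) = 0 :=
  killingForm_of_mem_of_mem_pPart (hC.lie_p_p _ (he.inl_mem α) _ (he.inl_mem β)) (he.inl_mem γ)

lemma structConst_rrl (he : hC.IsAdapted e) (a b γ) :
    structConst e (Sum.inr a) (Sum.inr b) (Sum.inl γ) = 0 :=
  killingForm_of_mem_of_mem_pPart (𝔨.lie_mem (he.inr_mem_k a) (he.inr_mem_k b)) (he.inl_mem γ)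

lemma structConst_rlr (he : hC.IsAdapted e) (a β c) :
    structConst e (Sum.inr a) (Sum.inl β) (Sum.inr c) = 0 := by
  rw [← structConst_rotate, ← structConst_rotate, he.structConst_rrl]

lemma structConst_lrr (he : hC.IsAdapted e) (a β c) :
    structConst e (Sum.inl β) (Sum.inr a) (Sum.inr c) = 0 := by
  rw [← structConst_rotate, he.structConst_rrl]

lemma structConst_rrr (he : hC.IsAdapted e) {a b c} (hab : a.1 ≠ c.1 ∨ b.1 ≠ c.1) :
    structConst e (Sum.inr a) (Sum.inr b) (Sum.inr c) = 0 := by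
  have key : ∀ {a b c}, a.1 ≠ c.1 →
      structConst e (Sum.inr a) (Sum.inr b) (Sum.inr c) = 0 := by
    intro a b c hac
    rw [structConst]
    refine IsCartanDecomposition.apply_eq_zero_of_ne (LieModule.traceForm_comm ℝ 𝔤 𝔤)
      (fun z _ x y => killingForm_lie z x y) hac ?_ (he.inr_mem c)
    rw [← lie_skew]
    exact a.1.space.neg_mem (Factor.lie_mem_space (he.inr_mem_k b) (he.inr_mem a))
  rcases hab with h | h
  · exact key h
  · rw [← neg_inj, ← structConst_swap, key h, neg_zero]

variable [FiniteDimensional ℝ 𝔤]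

/-- The contribution of `𝔨` to the Casimir constant. -/
lemma sum_structConst_k (he : hC.IsAdapted e) (hG : LieAlgebra.IsSimple ℝ 𝔤) (hp : pPart 𝔨 ≠ ⊥)
    (a) : ∑ b, ∑ c, structConst e (Sum.inr a) (Sum.inr b) (Sum.inr c) ^ 2 = a.1.kappa := by
  obtain ⟨v, hv, hve⟩ := he.exists_basis
  have hva : v a ∈ a.1.ideal := Factor.mem_space.1 ((hve a).symm ▸ he.inr_mem a)
  have h1 := hC.killingForm_of_mem_ideal hG hp hva hva
  rw [hv.1, killingForm_apply_apply, hv.trace_eq, mul_one] at h1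
  rw [← neg_inj, ← h1, ← Finset.sum_neg_distrib]
  refine Finset.sum_congr rfl fun b _ => ?_
  rw [LinearMap.comp_apply, LieAlgebra.ad_apply, LieAlgebra.ad_apply,
    hC.innerK_invariant, hv.apply_eq]
  refine congrArg _ (Finset.sum_congr rfl fun c _ => ?_)
  have hb : ((⁅v a, v b⁆ : 𝔨) : 𝔤) = ⁅e (Sum.inr a), e (Sum.inr b)⁆ := by
    rw [LieSubalgebra.coe_bracket, hve, hve]
  rw [hC.innerK_form, hC.form_of_mem ⁅v a, v b⁆.2, hb, hve, structConst]
  ring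

/-- The contribution of `𝔭` to the Casimir constant. -/
lemma sum_structConst_p (he : hC.IsAdapted e) (hG : LieAlgebra.IsSimple ℝ 𝔤) (hp : pPart 𝔨 ≠ ⊥)
    (a) : ∑ α, ∑ β, structConst e (Sum.inr a) (Sum.inl α) (Sum.inl β) ^ 2 = 1 - a.1.kappa := by
  -- `B(e_a, e_a) = -1` is minus the sum of the squares of all constants with first index `a`; the
  -- part from `𝔨` is `κ` and the rest comes from `𝔭`.
  have h1 := he.killingForm_inr a
  rw [killingForm_apply_apply, he.orthonormal.trace_eq] at h1
  have h2 : ∀ x, (cartanInner hC).form (((LieAlgebra.ad ℝ 𝔤) (e (Sum.inr a)) ∘ₗ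
      (LieAlgebra.ad ℝ 𝔤) (e (Sum.inr a))) (e x)) (e x)
      = -∑ y, structConst e (Sum.inr a) x y ^ 2 := by
    intro x
    rw [LinearMap.comp_apply, LieAlgebra.ad_apply, LieAlgebra.ad_apply,
      hC.form_lie (he.inr_mem_k a), he.orthonormal.apply_eq]
    refine congrArg _ (Finset.sum_congr rfl fun y _ => ?_)
    rw [← sq, he.form_sq, structConst]
  simp only [h2, Fintype.sum_sum_type, he.structConst_rrl, he.structConst_rlr,
    Finset.sum_neg_distrib, he.sum_structConst_k hG hp a, ne_eq, OfNat.ofNat_ne_zero,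
    not_false_eq_true, zero_pow, Finset.sum_const_zero, add_zero, zero_add] at h1
  linarith

/-- For a basis vector of `𝔭`, `B = 1` is twice the sum of squared constants involving it, as the
`𝔨`-index can be in second or third place. Summing over `𝔭` and exchanging sums gives the
contributions `1 - κ`. -/
lemma finrank_pPart_eq (he : hC.IsAdapted e) (hG : LieAlgebra.IsSimple ℝ 𝔤) (hp : pPart 𝔨 ≠ ⊥) :
    (Module.finrank ℝ (pPart 𝔨) : ℝ) = ∑ a : Σ i : Factor 𝔨, Fin (Module.finrank ℝ i.ideal),
      2 * (1 - a.1.kappa) := by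
  have h1 : ∀ α, (1 : ℝ) = ∑ a : Σ i : Factor 𝔨, Fin (Module.finrank ℝ i.ideal),
      ∑ β, 2 * structConst e (Sum.inr a) (Sum.inl α) (Sum.inl β) ^ 2 := by
    intro α
    have h1 := he.killingForm_inl α
    rw [killingForm_apply_apply, he.orthonormal.trace_eq] at h1
    have h2 : ∀ x, (cartanInner hC).form (((LieAlgebra.ad ℝ 𝔤) (e (Sum.inl α)) ∘ₗ
        (LieAlgebra.ad ℝ 𝔤) (e (Sum.inl α))) (e x)) (e x)
        = ∑ y, structConst e (Sum.inl α) x y ^ 2 := by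
      intro x
      rw [LinearMap.comp_apply, LieAlgebra.ad_apply, LieAlgebra.ad_apply]
      have h3 : (cartanInner hC).form ⁅e (Sum.inl α), ⁅e (Sum.inl α), e x⁆⁆ (e x)
          = (cartanInner hC).form ⁅e (Sum.inl α), e x⁆ ⁅e (Sum.inl α), e x⁆ := by
        rw [InnerForm.symm]
        rcases x with β | b
        · rw [hC.form_of_mem_pPart (he.inl_mem β),
            hC.form_of_mem (hC.lie_p_p _ (he.inl_mem α) _ (he.inl_mem β)), killingForm_lie,
            neg_neg]
        · have : ⁅e (Sum.inl α), e (Sum.inr b)⁆ ∈ pPart 𝔨 := by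
            rw [← lie_skew]
            exact (pPart 𝔨).neg_mem (hC.lie_k_p _ (he.inr_mem_k b) _ (he.inl_mem α))
          rw [hC.form_of_mem (he.inr_mem_k b), hC.form_of_mem_pPart this, killingForm_lie]
      rw [h3, he.orthonormal.apply_eq]
      refine Finset.sum_congr rfl fun y _ => ?_
      rw [← sq, he.form_sq, structConst]
    have h4 : ∀ β a, structConst e (Sum.inl α) (Sum.inl β) (Sum.inr a)
        = structConst e (Sum.inr a) (Sum.inl α) (Sum.inl β) := fun β a => structConst_rotate _ _ _ _
    have h5 : ∀ β a, structConst e (Sum.inl α) (Sum.inr a) (Sum.inl β) ^ 2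
        = structConst e (Sum.inr a) (Sum.inl α) (Sum.inl β) ^ 2 := fun β a => by
      rw [structConst_swap, neg_sq]
    simp only [h2, Fintype.sum_sum_type, he.structConst_lrr, he.structConst_lll, h4, h5,
      ne_eq, OfNat.ofNat_ne_zero,
      not_false_eq_true, zero_pow, Finset.sum_const_zero, add_zero, zero_add] at h1
    rw [← h1, Finset.sum_comm, ← Finset.sum_add_distrib]
    refine Finset.sum_congr rfl fun a _ => ?_
    rw [← Finset.mul_sum]
    ring
  have h2 : (Module.finrank ℝ (pPart 𝔨) : ℝ)
      = ∑ _α : Fin (Module.finrank ℝ (pPart 𝔨)), (1 : ℝ) := by simp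
  rw [h2, Finset.sum_congr rfl fun α _ => h1 α, Finset.sum_comm]
  refine Finset.sum_congr rfl fun a _ => ?_
  rw [← he.sum_structConst_p hG hp a]
  simp only [Finset.mul_sum]

end IsCartanDecomposition.IsAdapted

end StructureConstants

/-! ### Diagonal metrics and their natural reductivity. -/

section Diagonal

variable {𝔤 : Type*} [LieRing 𝔤] [LieAlgebra ℝ 𝔤] {𝔨 : LieSubalgebra ℝ 𝔤}

/-- The metrics `β Q|_𝔭 + ∑ αᵢ Q|_{𝔨ᵢ}`. -/
structure IsDiagonal (hC : IsCartanDecomposition 𝔨) (g : InnerForm 𝔤) (β : ℝ)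
    (α : Factor 𝔨 → ℝ) : Prop where
  form_p : ∀ x ∈ pPart 𝔨, ∀ y, g.form x y = β * (cartanInner hC).form x y
  form_k : ∀ i : Factor 𝔨, ∀ x ∈ i.space, ∀ y, g.form x y = α i * (cartanInner hC).form x y

namespace IsCartanDecomposition

/-- The inverse weights of a diagonal metric on an adapted basis. -/
def weight (𝔨 : LieSubalgebra ℝ 𝔤) (c : ℝ) (a : Factor 𝔨 → ℝ) : AdaptedIndex 𝔨 → ℝ :=
  Sum.elim (fun _ => c) fun x => a x.1

variable {hC : IsCartanDecomposition 𝔨}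
  {e : Module.Basis (AdaptedIndex 𝔨) ℝ 𝔤}

lemma IsAdapted.form_eq_of_isDiagonal (he : hC.IsAdapted e) {g : InnerForm 𝔤} {c : ℝ}
    {a : Factor 𝔨 → ℝ} (hg : IsDiagonal hC g c⁻¹ fun i => (a i)⁻¹) (x : AdaptedIndex 𝔨) (v : 𝔤) :
    g.form (e x) v = (weight 𝔨 c a x)⁻¹ * (cartanInner hC).form (e x) v := by
  rcases x with α | b
  · exact hg.form_p _ (he.inl_mem α) v
  · exact hg.form_k _ _ (he.inr_mem b) v

lemma weight_pos {c : ℝ} {a : Factor 𝔨 → ℝ} (hc : 0 < c) (ha : ∀ i, 0 < a i)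
    (x : AdaptedIndex 𝔨) : 0 < weight 𝔨 c a x := by
  rcases x with _ | b
  · exact hc
  · exact ha b.1

lemma _root_.NatRed.IsDiagonal.orthogonal {g : InnerForm 𝔤} {c : ℝ} {a : Factor 𝔨 → ℝ}
    (hg : IsDiagonal hC g c⁻¹ fun i => (a i)⁻¹) {e : Module.Basis (AdaptedIndex 𝔨) ℝ 𝔤}
    (he : hC.IsAdapted e) :
    (∀ x, g.form (e x) (e x) = (weight 𝔨 c a x)⁻¹) ∧ ∀ x y, x ≠ y → g.form (e x) (e y) = 0 := by
  refine ⟨fun x => ?_, fun x y hxy => ?_⟩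
  · rw [he.form_eq_of_isDiagonal hg, he.orthonormal.1, mul_one]
  · rw [he.form_eq_of_isDiagonal hg, he.orthonormal.2 x y hxy, mul_zero]

variable [FiniteDimensional ℝ 𝔤]

lemma IsAdapted.exists_isDiagonal (he : hC.IsAdapted e) {β : ℝ} (hβ : 0 < β) {α : Factor 𝔨 → ℝ}
    (hα : ∀ i, 0 < α i) : ∃ g : InnerForm 𝔤, IsDiagonal hC g β α := by
  have hw : ∀ x, 0 < weight 𝔨 β α x := by
    rintro (_ | b)
    · exact hβ
    · exact hα b.1
  let B : LinearMap.BilinForm ℝ 𝔤 :=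
    ∑ x, weight 𝔨 β α x • (LinearMap.mul ℝ ℝ).compl₁₂ (e.coord x) (e.coord x)
  have hB : ∀ u v, B u v = ∑ x, weight 𝔨 β α x * (e.repr u x * e.repr v x) := by
    intro u v
    simp only [B, LinearMap.sum_apply, LinearMap.smul_apply, LinearMap.compl₁₂_apply,
      LinearMap.mul_apply', Module.Basis.coord_apply, smul_eq_mul]
  let g : InnerForm 𝔤 :=
    { form := B
      symm := fun u v => by simp only [hB, mul_comm (e.repr u _)]
      pos := fun u hu => by
        rw [hB]
        have : ∃ x, e.repr u x ≠ 0 := by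
          by_contra! h
          exact hu (e.repr.map_eq_zero_iff.1 (Finsupp.ext h))
        obtain ⟨x, hx⟩ := this
        exact Finset.sum_pos' (fun y _ => mul_nonneg (hw y).le (mul_self_nonneg _))
          ⟨x, Finset.mem_univ x, mul_pos (hw x) (mul_self_pos.2 hx)⟩ }
  have hg : ∀ u v, g.form u v = ∑ x, weight 𝔨 β α x *
      ((cartanInner hC).form u (e x) * (cartanInner hC).form v (e x)) := by
    intro u v
    refine (hB u v).trans ?_
    simp only [he.orthonormal.repr_eq]
  refine ⟨g, fun x hx y => ?_, fun i x hx y => ?_⟩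
  · rw [hg, he.orthonormal.apply_eq, Finset.mul_sum]
    refine Finset.sum_congr rfl ?_
    rintro (γ | b) -
    · rfl
    · rw [hC.form_of_mem_pPart_of_mem hx (he.inr_mem_k b)]
      ring
  · rw [hg, he.orthonormal.apply_eq, Finset.mul_sum]
    refine Finset.sum_congr rfl ?_
    rintro (γ | b) -
    · rw [hC.form_of_mem_of_mem_pPart (Factor.mem_of_mem_space hx) (he.inl_mem γ)]
      ring
    · by_cases hb : i = b.1
      · rw [hb]; rfl
      · rw [apply_eq_zero_of_ne (cartanInner hC).symm
          (fun z hz x y => hC.form_lie hz x y) hb hx (he.inr_mem b)]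
        ring

lemma _root_.NatRed.IsDiagonal.invariant {g : InnerForm 𝔤} {β : ℝ}
    {α : Factor 𝔨 → ℝ} (hg : IsDiagonal hC g β α) : IsInvariantUnder 𝔨 g.form := by
  obtain ⟨e, he⟩ := hC.exists_isAdapted
  intro z hz x y
  have key : (g.form.compl₁₂ (LieAlgebra.ad ℝ 𝔤 z) LinearMap.id) =
      -g.form.compl₁₂ LinearMap.id (LieAlgebra.ad ℝ 𝔤 z) := by
    refine e.ext fun w => LinearMap.ext fun y => ?_
    change g.form ⁅z, e w⁆ y = -g.form (e w) ⁅z, y⁆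
    rcases w with γ | b
    · rw [hg.form_p _ (he.inl_mem γ), hg.form_p _ (hC.lie_k_p z hz _ (he.inl_mem γ)),
        hC.form_lie hz]
      ring
    · rw [hg.form_k _ _ (he.inr_mem b), hg.form_k _ _ (Factor.lie_mem_space hz (he.inr_mem b)),
        hC.form_lie hz]
      ring
  exact LinearMap.congr_fun (LinearMap.congr_fun key x) y

/-- A `𝔨`-invariant metric that is a multiple of the Killing form on `𝔭` and for which `𝔭` and `𝔨`
are orthogonal is naturally reductive. -/
lemma isNaturallyReductive (hC : IsCartanDecomposition 𝔨) {g : InnerForm 𝔤} {β : ℝ} (hβ : 0 < β)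
    (hg : IsInvariantUnder 𝔨 g.form)
    (hgp : ∀ x ∈ pPart 𝔨, ∀ y, g.form x y = β * killingForm ℝ 𝔤 x y) :
    IsNaturallyReductive 𝔨 g := by
  refine ⟨fun Z hZ X Y => by rw [hg Z hZ]; ring, ?_⟩
  have hnd : (killingForm ℝ 𝔤).Nondegenerate :=
    ⟨fun x h => hC.killingForm_nondegenerate h, fun x h => hC.killingForm_nondegenerate fun y => by
      rw [LieModule.traceForm_comm]; exact h y⟩
  -- The operator with `g(x, y) = β B(ψ x, y)`. It commutes with `𝔨`, and because `g = β B` against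
  -- `𝔭` it is the identity modulo `𝔨`.
  let ψ : 𝔤 →ₗ[ℝ] 𝔤 := β⁻¹ • (((killingForm ℝ 𝔤).toDual hnd).symm.toLinearMap ∘ₗ g.form)
  have hψ : ∀ x y, β * killingForm ℝ 𝔤 (ψ x) y = g.form x y := by
    intro x y
    simp only [ψ, LinearMap.smul_apply, LinearMap.comp_apply, LinearEquiv.coe_coe, map_smul,
      smul_eq_mul]
    rw [LinearMap.BilinForm.apply_toDual_symm_apply, mul_inv_cancel_left₀ hβ.ne']
  have hinj : ∀ u v : 𝔤, (∀ y, β * killingForm ℝ 𝔤 u y = β * killingForm ℝ 𝔤 v y) → u = v := by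
    intro u v h
    rw [← sub_eq_zero]
    refine hC.killingForm_nondegenerate fun y => ?_
    rw [map_sub, LinearMap.sub_apply, mul_left_cancel₀ hβ.ne' (h y), sub_self]
  have hψk : ∀ z ∈ 𝔨, ∀ x, ψ ⁅z, x⁆ = ⁅z, ψ x⁆ := by
    intro z hz x
    refine hinj _ _ fun y => ?_
    rw [hψ, hg z hz, ← hψ, killingForm_lie]
    ring
  have hmem : ∀ x, ψ x - x ∈ 𝔨 := by
    intro x
    refine hC.mem_of_killingForm_eq_zero fun y hy => ?_
    refine mul_left_cancel₀ hβ.ne' ?_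
    rw [map_sub, LinearMap.sub_apply, mul_sub, hψ, g.symm, hgp y hy, LieModule.traceForm_comm]
    ring
  let φ : 𝔤 →ₗ[ℝ] 𝔨 := LinearMap.codRestrict 𝔨.toSubmodule (ψ - LinearMap.id) hmem
  have hφ : ∀ x, (φ x : 𝔤) = ψ x - x := fun x => rfl
  have horb : ∀ x, orbitDiff 𝔨 (ψ x, φ x) = x := by
    intro x
    change ψ x - (φ x : 𝔤) = x
    rw [hφ, sub_sub_cancel]
  -- The complement consists of the pairs `(ψ x, ψ x - x)`, the lifts of `x` under `orbitDiff`.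
  refine ⟨LinearMap.range (LinearMap.prod ψ φ), ?_, ?_, ?_⟩
  · constructor
    · rw [disjoint_iff, eq_bot_iff]
      rintro _ ⟨⟨z, rfl⟩, ⟨x, hx⟩⟩
      have h1 : ψ x = z := congrArg Prod.fst hx
      have h2 : φ x = z := congrArg Prod.snd hx
      have h3 : x = 0 := by
        rw [← horb x, h1, h2]
        exact sub_self _
      rw [← hx, h3, map_zero]
      exact Submodule.zero_mem _
    · rw [codisjoint_iff, eq_top_iff]
      rintro ⟨x, z⟩ -
      have : ((x, z) : 𝔤 × 𝔨) = (((z - φ (x - z) : 𝔨) : 𝔤), z - φ (x - z))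
          + (ψ (x - z), φ (x - z)) := by
        refine Prod.ext ?_ ?_
        · have : (((z - φ (x - z) : 𝔨)) : 𝔤) = z - φ (x - z) := rfl
          simp only [Prod.fst_add, this, hφ]
          abel
        · simp
      rw [this]
      exact Submodule.add_mem_sup ⟨z - φ (x - z), rfl⟩ ⟨x - z, rfl⟩
  · rintro _ ⟨z, rfl⟩ _ ⟨x, rfl⟩
    refine ⟨⁅(z : 𝔤), x⁆, Prod.ext (hψk z z.2 x) (Subtype.ext ?_)⟩
    change (φ ⁅(z : 𝔤), x⁆ : 𝔤) = ⁅(z : 𝔤), (φ x : 𝔤)⁆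
    rw [hφ, hφ, hψk z z.2, lie_sub]
  · rintro _ ⟨x, rfl⟩ _ ⟨y, rfl⟩ _ ⟨z, rfl⟩
    change g.form (orbitDiff 𝔨 ⁅(ψ x, φ x), (ψ y, φ y)⁆) (orbitDiff 𝔨 (ψ z, φ z))
      + g.form (orbitDiff 𝔨 (ψ y, φ y)) (orbitDiff 𝔨 ⁅(ψ x, φ x), (ψ z, φ z)⁆) = 0
    have hbr : ∀ u v : 𝔤, orbitDiff 𝔨 ⁅(ψ u, φ u), (ψ v, φ v)⁆ = ⁅u, ψ v⁆ + ⁅(φ u : 𝔤), v⁆ := by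
      intro u v
      change ⁅ψ u, ψ v⁆ - ⁅(φ u : 𝔤), (φ v : 𝔤)⁆ = _
      rw [hφ, hφ]
      simp only [lie_sub, sub_lie]
      abel
    -- The terms with `φ x` cancel by `𝔨`-invariance of `g`; the others become `β (B(⁅x, ψ y⁆, ψ z)
    -- + B(ψ y, ⁅x, ψ z⁆))`, which is zero by invariance of `B`.
    rw [hbr, hbr, horb, horb, map_add, map_add, LinearMap.add_apply, hg _ (φ x).2 y z,
      g.symm ⁅x, ψ y⁆ z, ← hψ z, ← hψ y ⁅x, ψ z⁆]
    have := killingForm_lie x (ψ y) (ψ z)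
    rw [LieModule.traceForm_comm] at this
    linear_combination β * this

end IsCartanDecomposition

end Diagonal

/-! ### Trace of `T` and scalar curvature of a diagonal metric. -/

section Formula

variable {𝔤 : Type*} [LieRing 𝔤] [LieAlgebra ℝ 𝔤] {𝔨 : LieSubalgebra ℝ 𝔤}
  [FiniteDimensional ℝ 𝔤] {hC : IsCartanDecomposition 𝔨}

lemma sum_adapted (f : Factor 𝔨 → ℝ) :
    ∑ a : Σ i : Factor 𝔨, Fin (Module.finrank ℝ i.ideal), f a.1 = ∑ i, (i.dim : ℝ) * f i := by
  rw [Fintype.sum_sigma]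
  refine Finset.sum_congr rfl fun i _ => ?_
  change ∑ _y : Fin (Module.finrank ℝ i.ideal), f i = _
  rw [Finset.sum_const, Finset.card_univ, Fintype.card_fin, nsmul_eq_mul, i.dim_eq]

namespace IsCartanDecomposition

lemma finrank_eq_sum (hC : IsCartanDecomposition 𝔨) :
    (Module.finrank ℝ 𝔨 : ℝ) = ∑ i : Factor 𝔨, (i.dim : ℝ) := by
  obtain ⟨e, he⟩ := hC.exists_isAdapted
  obtain ⟨v, -, -⟩ := he.exists_basis
  rw [Module.finrank_eq_card_basis v]
  have := sum_adapted (𝔨 := 𝔨) fun _ => 1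
  simp only [mul_one, Finset.sum_const, nsmul_eq_mul, Finset.card_univ] at this
  exact this

lemma finrank_pPart_eq_sum (hC : IsCartanDecomposition 𝔨) (hG : LieAlgebra.IsSimple ℝ 𝔤)
    (hp : pPart 𝔨 ≠ ⊥) :
    (Module.finrank ℝ (pPart 𝔨) : ℝ) = ∑ i : Factor 𝔨, (i.dim : ℝ) * (2 * (1 - i.kappa)) := by
  obtain ⟨e, he⟩ := hC.exists_isAdapted
  rw [he.finrank_pPart_eq hG hp]
  exact sum_adapted fun i => 2 * (1 - i.kappa)

lemma exists_index (i : Factor 𝔨) :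
    ∃ a : Σ i : Factor 𝔨, Fin (Module.finrank ℝ i.ideal), a.1 = i :=
  ⟨⟨i, ⟨0, i.dim_eq ▸ i.dim_pos⟩⟩, rfl⟩

lemma kappa_nonneg (hC : IsCartanDecomposition 𝔨) (hG : LieAlgebra.IsSimple ℝ 𝔤)
    (hp : pPart 𝔨 ≠ ⊥) (i : Factor 𝔨) : 0 ≤ i.kappa := by
  obtain ⟨e, he⟩ := hC.exists_isAdapted
  obtain ⟨a, rfl⟩ := exists_index i
  rw [← he.sum_structConst_k hG hp a]
  exact Finset.sum_nonneg fun b _ => Finset.sum_nonneg fun c _ => sq_nonneg _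

/-- `1 - κ` is a sum of squared constants; if it vanished, a nonzero element of `𝔨` would annihilate
`𝔭`. -/
lemma kappa_lt_one (hC : IsCartanDecomposition 𝔨) (hG : LieAlgebra.IsSimple ℝ 𝔤)
    (hp : pPart 𝔨 ≠ ⊥) (i : Factor 𝔨) : i.kappa < 1 := by
  obtain ⟨e, he⟩ := hC.exists_isAdapted
  obtain ⟨a, rfl⟩ := exists_index i
  have hnn : ∀ α, 0 ≤ ∑ β, structConst e (Sum.inr a) (Sum.inl α) (Sum.inl β) ^ 2 :=
    fun α => Finset.sum_nonneg fun β _ => sq_nonneg _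
  rw [← sub_pos, ← he.sum_structConst_p hG hp a]
  refine lt_of_le_of_ne (Finset.sum_nonneg fun α _ => hnn α) fun h => ?_
  have h0 : ∀ α β, structConst e (Sum.inr a) (Sum.inl α) (Sum.inl β) = 0 := by
    intro α β
    have h1 := (Finset.sum_eq_zero_iff_of_nonneg fun α _ => hnn α).1 h.symm α (Finset.mem_univ α)
    have h2 := (Finset.sum_eq_zero_iff_of_nonneg fun β _ => sq_nonneg _).1 h1 β (Finset.mem_univ β)
    exact pow_eq_zero_iff two_ne_zero |>.1 h2
  have h1 : ∀ α, ⁅e (Sum.inr a), e (Sum.inl α)⁆ = 0 := by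
    intro α
    have hm := hC.lie_k_p _ (he.inr_mem_k a) _ (he.inl_mem α)
    rw [← he.orthonormal.sum_eq ⁅e (Sum.inr a), e (Sum.inl α)⁆]
    refine Finset.sum_eq_zero ?_
    rintro (β | b) -
    · have := h0 α β
      rw [structConst] at this
      rw [hC.form_of_mem_pPart hm, this, zero_smul]
    · rw [hC.form_of_mem_pPart_of_mem hm (he.inr_mem_k b), zero_smul]
  refine (one_ne_zero : (1 : ℝ) ≠ 0) ?_
  rw [← he.orthonormal.1 (Sum.inr a),
    hC.eq_zero_of_lie_eq_zero hG hp (he.inr_mem_k a) (fun x hx => ?_), map_zero]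
  rw [← he.orthonormal.sum_eq x, lie_sum]
  refine Finset.sum_eq_zero ?_
  rintro (β | b) -
  · rw [lie_smul, h1, smul_zero]
  · rw [hC.form_of_mem_pPart_of_mem hx (he.inr_mem_k b), zero_smul, lie_zero]

/-- The value of the tensor `-T_𝔭 Q|_𝔭 + ∑ Tᵢ Q|_{𝔨ᵢ}` on an adapted basis. -/
lemma IsAdapted.tensor_apply {e : Module.Basis (AdaptedIndex 𝔨) ℝ 𝔤} (he : hC.IsAdapted e)
    (Tp : ℝ) (Tk : Factor 𝔨 → ℝ) (x y : AdaptedIndex 𝔨) :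
    (-(Tp • (cartanInner hC).restr (pPart 𝔨)) + ∑ i, Tk i • (cartanInner hC).restr i.space)
      (e x) (e y) = weight 𝔨 (-Tp) Tk x * (cartanInner hC).form (e x) (e y) := by
  classical
  set Q := cartanInner hC with hQ
  have h1 : ∀ (U : Submodule ℝ 𝔤) (v : 𝔤), v ∈ U → Q.proj U v = v := fun U v hv =>
    Submodule.projection_apply_left (Q.isCompl_orthogonal U) ⟨v, hv⟩
  have h0 : ∀ (U : Submodule ℝ 𝔤) (v : 𝔤), (∀ u ∈ U, Q.form u v = 0) → Q.proj U v = 0 :=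
    fun U v hv => (Submodule.projection_apply_eq_zero_iff (Q.isCompl_orthogonal U)).2 hv
  have hpl : ∀ α, Q.proj (pPart 𝔨) (e (Sum.inl α)) = e (Sum.inl α) := fun α => h1 _ _ (he.inl_mem α)
  have hpr : ∀ a, Q.proj (pPart 𝔨) (e (Sum.inr a)) = 0 := fun a => h0 _ _ fun u hu =>
    hC.form_of_mem_pPart_of_mem hu (he.inr_mem_k a)
  have hkl : ∀ (i : Factor 𝔨) α, Q.proj i.space (e (Sum.inl α)) = 0 := fun i α =>
    h0 _ _ fun u hu => hC.form_of_mem_of_mem_pPart (Factor.mem_of_mem_space hu) (he.inl_mem α)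
  have hkr : ∀ (i : Factor 𝔨) a, Q.proj i.space (e (Sum.inr a))
      = if a.1 = i then e (Sum.inr a) else 0 := by
    intro i a
    split_ifs with h
    · exact h1 _ _ (h ▸ he.inr_mem a)
    · exact h0 _ _ fun u hu => apply_eq_zero_of_ne Q.symm (fun z hz x y => hC.form_lie hz x y)
        (Ne.symm h) hu (he.inr_mem a)
  simp only [LinearMap.add_apply, LinearMap.neg_apply, LinearMap.smul_apply, LinearMap.sum_apply,
    InnerForm.restr, LinearMap.compl₁₂_apply, smul_eq_mul]
  rcases x with α | a
  · rcases y with β | b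
    · simp only [hpl, hkl, map_zero, mul_zero, Finset.sum_const_zero,
        add_zero, weight, Sum.elim_inl]
      ring
    · simp only [hpr, hkl, map_zero, LinearMap.zero_apply, mul_zero, Finset.sum_const_zero,
        add_zero, neg_zero]
      rw [hC.form_of_mem_pPart_of_mem (he.inl_mem α) (he.inr_mem_k b), mul_zero]
  · rcases y with β | b
    · simp only [hpr, hkl, map_zero, LinearMap.zero_apply, mul_zero, Finset.sum_const_zero,
        add_zero, neg_zero]
      rw [hC.form_of_mem_of_mem_pPart (he.inr_mem_k a) (he.inl_mem β), mul_zero]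
    · rw [Finset.sum_eq_single a.1]
      · by_cases hab : b.1 = a.1
        · simp [hpr, hkr, hab, weight]
        · rw [hkr _ b, if_neg hab, hpr, apply_eq_zero_of_ne Q.symm
            (fun z hz x y => hC.form_lie hz x y) (Ne.symm hab) (he.inr_mem a) (he.inr_mem b)]
          simp
      · intro i _ hi
        rw [hkr i a, if_neg (Ne.symm hi)]
        simp
      · intro h
        exact absurd (Finset.mem_univ _) h

/-- The trace of `T` with respect to a diagonal metric. -/
lemma _root_.NatRed.IsDiagonal.traceForm_eq {g : InnerForm 𝔤} {c : ℝ} {a : Factor 𝔨 → ℝ}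
    (hc : 0 < c) (ha : ∀ i, 0 < a i) (hg : IsDiagonal hC g c⁻¹ fun i => (a i)⁻¹)
    (Tp : ℝ) (Tk : Factor 𝔨 → ℝ) :
    g.traceForm (-(Tp • (cartanInner hC).restr (pPart 𝔨))
      + ∑ i, Tk i • (cartanInner hC).restr i.space)
      = -(Module.finrank ℝ (pPart 𝔨) * Tp * c) + ∑ i, (i.dim : ℝ) * (Tk i * a i) := by
  obtain ⟨e, he⟩ := hC.exists_isAdapted
  obtain ⟨hd, ho⟩ := hg.orthogonal he
  rw [traceForm_eq_of_orthogonal (weight_pos hc ha) hd ho, ← sum_adapted fun i => Tk i * a i]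
  simp only [he.tensor_apply, he.orthonormal.1, Fintype.sum_sum_type, weight, Sum.elim_inl,
    Sum.elim_inr, Finset.sum_const, Finset.card_univ, Fintype.card_fin, nsmul_eq_mul, mul_one]
  congr 1
  · ring
  · exact Finset.sum_congr rfl fun b _ => mul_comm _ _

/-- The scalar curvature of a diagonal metric. -/
lemma _root_.NatRed.IsDiagonal.scalarCurvature_eq (hG : LieAlgebra.IsSimple ℝ 𝔤)
    (hp : pPart 𝔨 ≠ ⊥) {g : InnerForm 𝔤} {c : ℝ} {a : Factor 𝔨 → ℝ}
    (hc : 0 < c) (ha : ∀ i, 0 < a i) (hg : IsDiagonal hC g c⁻¹ fun i => (a i)⁻¹) :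
    scalarCurvature g = -(Module.finrank ℝ (pPart 𝔨) * c / 2)
      + ∑ i, (i.dim : ℝ) * (i.kappa * a i / 4 - (1 - i.kappa) * c ^ 2 / (4 * a i)) := by
  obtain ⟨e, he⟩ := hC.exists_isAdapted
  obtain ⟨hd, ho⟩ := hg.orthogonal he
  have hw := weight_pos hc ha
  have hnorm : ∀ x y, weight 𝔨 c a x * weight 𝔨 c a y * g.form ⁅e x, e y⁆ ⁅e x, e y⁆
      = ∑ z, weight 𝔨 c a x * weight 𝔨 c a y * (weight 𝔨 c a z)⁻¹ * structConst e x y z ^ 2 := by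
    intro x y
    have h1 : ∀ v, g.form v v = ∑ z, (weight 𝔨 c a z)⁻¹ * (cartanInner hC).form v (e z) ^ 2 := by
      intro v
      refine (congrArg (fun u => g.form u v) (he.orthonormal.sum_eq v)).symm.trans ?_
      simp only [map_sum, LinearMap.sum_apply]
      refine Finset.sum_congr rfl fun z _ => ?_
      rw [map_smul, LinearMap.smul_apply, he.form_eq_of_isDiagonal hg,
        InnerForm.symm, smul_eq_mul]
      ring
    rw [h1, Finset.mul_sum]
    refine Finset.sum_congr rfl fun z _ => ?_
    rw [he.form_sq, structConst]
    ring
  -- For two indices in `𝔭` and one in `𝔨ᵢ`, the weight is `c² / aᵢ` if the latter is last and `aᵢ`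
  -- in the other two positions. Three indices in `𝔨ᵢ` have weight `aᵢ`.
  have hN : ∑ x, ∑ y, weight 𝔨 c a x * weight 𝔨 c a y * g.form ⁅e x, e y⁆ ⁅e x, e y⁆
      = ∑ b : Σ i : Factor 𝔨, Fin (Module.finrank ℝ i.ideal),
        ((1 - b.1.kappa) * (c ^ 2 / a b.1 + 2 * a b.1) + b.1.kappa * a b.1) := by
    have e1 : ∀ α β b, structConst e (Sum.inl α) (Sum.inl β) (Sum.inr b)
        = structConst e (Sum.inr b) (Sum.inl α) (Sum.inl β) :=
      fun α β b => structConst_rotate _ _ _ _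
    have e2 : ∀ α b β, structConst e (Sum.inl α) (Sum.inr b) (Sum.inl β) ^ 2
        = structConst e (Sum.inr b) (Sum.inl α) (Sum.inl β) ^ 2 := fun α b β => by
      rw [structConst_swap, neg_sq]
    have e3 : ∀ b b' b'' : Σ i : Factor 𝔨, Fin (Module.finrank ℝ i.ideal),
        a b.1 * a b'.1 * (a b''.1)⁻¹ * structConst e (Sum.inr b) (Sum.inr b') (Sum.inr b'') ^ 2
        = a b.1 * structConst e (Sum.inr b) (Sum.inr b') (Sum.inr b'') ^ 2 := by
      intro b b' b''
      by_cases h : b.1 ≠ b''.1 ∨ b'.1 ≠ b''.1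
      · rw [he.structConst_rrr h]; ring
      · push Not at h
        rw [h.2, mul_inv_cancel_right₀ (ha _).ne']
    have e4 : ∀ b : Σ i : Factor 𝔨, Fin (Module.finrank ℝ i.ideal),
        c * a b.1 * c⁻¹ = a b.1 := fun b => by rw [mul_right_comm, mul_inv_cancel₀ hc.ne', one_mul]
    have e5 : ∀ b : Σ i : Factor 𝔨, Fin (Module.finrank ℝ i.ideal),
        a b.1 * c * c⁻¹ = a b.1 := fun b => mul_inv_cancel_right₀ hc.ne' _
    have s1 : ∑ α, ∑ β, ∑ b : Σ i : Factor 𝔨, Fin (Module.finrank ℝ i.ideal),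
        c * c * (a b.1)⁻¹ * structConst e (Sum.inr b) (Sum.inl α) (Sum.inl β) ^ 2
        = ∑ b : Σ i : Factor 𝔨, Fin (Module.finrank ℝ i.ideal),
          c * c * (a b.1)⁻¹ * (1 - b.1.kappa) := by
      rw [Finset.sum_congr rfl fun α _ => Finset.sum_comm, Finset.sum_comm]
      refine Finset.sum_congr rfl fun b _ => ?_
      rw [← he.sum_structConst_p hG hp b]
      simp only [Finset.mul_sum]
    have s2 : ∑ α, ∑ b : Σ i : Factor 𝔨, Fin (Module.finrank ℝ i.ideal), ∑ β,
        a b.1 * structConst e (Sum.inr b) (Sum.inl α) (Sum.inl β) ^ 2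
        = ∑ b : Σ i : Factor 𝔨, Fin (Module.finrank ℝ i.ideal), a b.1 * (1 - b.1.kappa) := by
      rw [Finset.sum_comm]
      refine Finset.sum_congr rfl fun b _ => ?_
      rw [← he.sum_structConst_p hG hp b]
      simp only [Finset.mul_sum]
    have s3 : ∑ b : Σ i : Factor 𝔨, Fin (Module.finrank ℝ i.ideal), ∑ α, ∑ β,
        a b.1 * structConst e (Sum.inr b) (Sum.inl α) (Sum.inl β) ^ 2
        = ∑ b : Σ i : Factor 𝔨, Fin (Module.finrank ℝ i.ideal), a b.1 * (1 - b.1.kappa) := by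
      refine Finset.sum_congr rfl fun b _ => ?_
      rw [← he.sum_structConst_p hG hp b]
      simp only [Finset.mul_sum]
    have s4 : ∑ b : Σ i : Factor 𝔨, Fin (Module.finrank ℝ i.ideal), ∑ b', ∑ b'',
        a b.1 * structConst e (Sum.inr b) (Sum.inr b') (Sum.inr b'') ^ 2
        = ∑ b : Σ i : Factor 𝔨, Fin (Module.finrank ℝ i.ideal), a b.1 * b.1.kappa := by
      refine Finset.sum_congr rfl fun b _ => ?_
      rw [← he.sum_structConst_k hG hp b]
      simp only [Finset.mul_sum]
    rw [Finset.sum_congr rfl fun x _ => Finset.sum_congr rfl fun y _ => hnorm x y]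
    simp only [Fintype.sum_sum_type, weight, Sum.elim_inl, Sum.elim_inr,
      he.structConst_lll, he.structConst_rrl, he.structConst_rlr, he.structConst_lrr, e1, e2, e3,
      e4, e5, ne_eq, OfNat.ofNat_ne_zero, not_false_eq_true, zero_pow, mul_zero,
      Finset.sum_const_zero, add_zero, zero_add, Finset.sum_add_distrib, s1, s2, s3, s4]
    simp only [← Finset.sum_add_distrib]
    refine Finset.sum_congr rfl fun b _ => ?_
    ring
  have hK : ∑ x, weight 𝔨 c a x * killingForm ℝ 𝔤 (e x) (e x)
      = Module.finrank ℝ (pPart 𝔨) * c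
        - ∑ b : Σ i : Factor 𝔨, Fin (Module.finrank ℝ i.ideal), a b.1 := by
    simp only [Fintype.sum_sum_type, he.killingForm_inl, he.killingForm_inr, weight, Sum.elim_inl,
      Sum.elim_inr, mul_one, mul_neg, Finset.sum_neg_distrib, Finset.sum_const, Finset.card_univ,
      Fintype.card_fin, nsmul_eq_mul, sub_eq_add_neg]
  rw [scalarCurvature_eq_of_orthogonal hw hd ho (trace_ad_eq_zero hG), hN, hK,
    ← sum_adapted fun i => i.kappa * a i / 4 - (1 - i.kappa) * c ^ 2 / (4 * a i)]
  have h : (1 / 2) * ∑ b : Σ i : Factor 𝔨, Fin (Module.finrank ℝ i.ideal), a b.1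
      - (1 / 4) * ∑ b : Σ i : Factor 𝔨, Fin (Module.finrank ℝ i.ideal),
        ((1 - b.1.kappa) * (c ^ 2 / a b.1 + 2 * a b.1) + b.1.kappa * a b.1)
      = ∑ b : Σ i : Factor 𝔨, Fin (Module.finrank ℝ i.ideal),
        (b.1.kappa * a b.1 / 4 - (1 - b.1.kappa) * c ^ 2 / (4 * a b.1)) := by
    rw [Finset.mul_sum, Finset.mul_sum, ← Finset.sum_sub_distrib]
    refine Finset.sum_congr rfl fun b _ => ?_
    have := (ha b.1).ne'
    field_simp
    ring
  rw [← h]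
  ring

end IsCartanDecomposition

end Formula

/-! ### Maximising the explicit function of `(c, a)` under the trace constraint. -/

section Optimization

variable {ι : Type*} [Fintype ι]

/-- The scalar curvature of a diagonal metric as a function of the inverse coefficients. -/
def diagCurvature (n : ℝ) (d κ : ι → ℝ) (c : ℝ) (a : ι → ℝ) : ℝ :=
  -(n * c / 2) + ∑ i, d i * (κ i * a i / 4 - (1 - κ i) * c ^ 2 / (4 * a i))

/-- The trace of the tensor `T` as a function of the inverse coefficients. -/
def diagTrace (n Tp : ℝ) (d T : ι → ℝ) (c : ℝ) (a : ι → ℝ) : ℝ :=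
  -(n * Tp * c) + ∑ i, d i * (T i * a i)

variable {n Tp : ℝ} {d κ T : ι → ℝ} {m : ι}

/-- Some diagonal metric exceeds the limiting value `κ_m / (4 T_m)`. -/
lemma exists_diagCurvature_gt (hd : ∀ i, 0 < d i) (hT : ∀ i, 0 < T i)
    (hκ1 : ∀ i, κ i < 1) (hsum : n = ∑ i, d i * (2 * (1 - κ i)))
    (hinf : κ m * (-(n * Tp) + ∑ i, d i * T i) / T m
      < ∑ i, d i + d m * (1 - κ m) - 3 * n) :
    ∃ c a, 0 < c ∧ (∀ i, 0 < a i) ∧ diagTrace n Tp d T c a = 1 ∧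
      κ m / (4 * T m) < diagCurvature n d κ c a := by
  classical
  have hdm := hd m
  have hTm := hT m
  set R := n * Tp - ∑ i, d i * T i + d m * T m with hR
  set E := ∑ i, d i + d m * (1 - κ m) - 3 * n
    - κ m * (-(n * Tp) + ∑ i, d i * T i) / T m with hE
  have hEpos : 0 < E := sub_pos.2 hinf
  set L := 2 * d m ^ 2 * T m * (1 - κ m) with hL
  have hLpos : 0 < L := by
    have := sub_pos.2 (hκ1 m)
    positivity
  -- On the curve `aᵢ = c` for `i ≠ m`, `a m = s` fixed by the trace, `S - κ_m / (4 T_m)` is `c E /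
  -- 4` minus a term at most `c² L / 4`. With `c = 1 / M`, both `c R ≥ -1/2` (so that `s` stays away
  -- from `0`) and `c L < E` hold.
  set M := 2 * |R| + L / E + 1 with hM
  have hLE : 0 < L / E := div_pos hLpos hEpos
  have hMpos : 0 < M := by positivity
  set c := M⁻¹ with hc
  have hcpos : 0 < c := inv_pos.2 hMpos
  have hcM : c * M = 1 := inv_mul_cancel₀ hMpos.ne'
  have hcR : -(1 / 2) ≤ c * R := by
    have h1 : c * (2 * |R|) ≤ c * M := mul_le_mul_of_nonneg_left (by rw [hM]; linarith) hcpos.le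
    have h2 : c * -|R| ≤ c * R := mul_le_mul_of_nonneg_left (neg_abs_le R) hcpos.le
    linarith
  have hcL : c * L < E := by
    have h1 : c * (L / E) < c * M :=
      mul_lt_mul_of_pos_left (by rw [hM]; linarith [abs_nonneg R]) hcpos
    rw [hcM, ← mul_div_assoc, div_lt_one hEpos] at h1
    exact h1
  set s := (1 + c * R) / (d m * T m) with hs
  have hdT : 0 < d m * T m := mul_pos hdm hTm
  have hsT : d m * (T m * s) = 1 + c * R := by
    rw [← mul_assoc, hs, mul_div_cancel₀ _ hdT.ne']
  have hs0 : 1 / (2 * (d m * T m)) ≤ s := by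
    rw [hs, div_le_div_iff₀ (by positivity) hdT]
    nlinarith
  have hspos : 0 < s := lt_of_lt_of_le (by positivity) hs0
  have hsplit : ∀ f : ι → ℝ → ℝ, ∑ i, f i (if i = m then s else c)
      = ∑ i, f i c + (f m s - f m c) := by
    intro f
    have : ∀ i, f i (if i = m then s else c) = f i c + if i = m then f m s - f m c else 0 := by
      intro i
      split_ifs with h
      · rw [h]; ring
      · ring
    simp only [this, Finset.sum_add_distrib, Finset.sum_ite_eq', Finset.mem_univ, if_true]
  refine ⟨c, fun i => if i = m then s else c, hcpos, fun i => ?_, ?_, ?_⟩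
  · dsimp only
    split_ifs
    · exact hspos
    · exact hcpos
  · rw [diagTrace, hsplit fun i x => d i * (T i * x), hsT]
    have : ∑ i, d i * (T i * c) = c * ∑ i, d i * T i := by
      rw [Finset.mul_sum]
      exact Finset.sum_congr rfl fun i _ => by ring
    rw [this, hR]
    ring
  · rw [diagCurvature, hsplit fun i x => d i * (κ i * x / 4 - (1 - κ i) * c ^ 2 / (4 * x))]
    have h1 : ∀ i, d i * (κ i * c / 4 - (1 - κ i) * c ^ 2 / (4 * c))
        = c / 4 * (d i - d i * (2 * (1 - κ i))) := by
      intro i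
      field_simp
      ring
    have h2 : ∑ i, d i * (κ i * c / 4 - (1 - κ i) * c ^ 2 / (4 * c))
        = c / 4 * (∑ i, d i - n) := by
      rw [hsum, ← Finset.sum_sub_distrib, Finset.mul_sum]
      exact Finset.sum_congr rfl fun i _ => h1 i
    rw [h2, h1 m]
    have h3 : d m * (1 - κ m) * c ^ 2 / (4 * s) < c * E / 4 := by
      rw [div_lt_iff₀ (by positivity)]
      have h4 : c * (c * L) < c * E := mul_lt_mul_of_pos_left hcL hcpos
      have h5 : 1 ≤ 2 * (d m * T m) * s := by
        rw [div_le_iff₀ (by positivity)] at hs0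
        linarith
      have h6 : d m * (1 - κ m) * c ^ 2 * 1 ≤ d m * (1 - κ m) * c ^ 2 * (2 * (d m * T m) * s) :=
        mul_le_mul_of_nonneg_left h5
          (mul_nonneg (mul_nonneg hdm.le (sub_pos.2 (hκ1 m)).le) (sq_nonneg c))
      have h7 : c * (c * L) * s < c * E * s := mul_lt_mul_of_pos_right h4 hspos
      rw [hL] at h7
      linarith
    have h8 : d m * (κ m * s / 4) = κ m / (4 * T m) + c * (κ m * R / T m) / 4 := by
      have : d m * s = (1 + c * R) / T m := by
        rw [eq_div_iff hTm.ne', ← hsT]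
        ring
      rw [show d m * (κ m * s / 4) = κ m / 4 * (d m * s) by ring, this]
      field_simp
    have h9 : κ m * R / T m = -(κ m * (-(n * Tp) + ∑ i, d i * T i) / T m) + κ m * d m := by
      rw [hR]
      field_simp
      ring
    rw [h9] at h8
    have h10 : d m * (κ m * s / 4 - (1 - κ m) * c ^ 2 / (4 * s))
        = d m * (κ m * s / 4) - d m * (1 - κ m) * c ^ 2 / (4 * s) := by ring
    rw [h10, h8]
    rw [hE] at h3
    linarith

/-- The scalar curvature is negative when the coefficient of `𝔭` is small. -/
lemma exists_bound_of_diagCurvature_nonneg (hn : 0 < n) (hTp : 0 < Tp) (hd : ∀ i, 0 < d i)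
    (hT : ∀ i, 0 < T i) (hκ0 : ∀ i, 0 ≤ κ i) (hκ1 : ∀ i, κ i < 1)
    (hzero : ∑ i, (n ^ 2 * κ i * Tp ^ 2 - d i ^ 2 * (1 - κ i) * T i ^ 2) / (n * Tp * T i)
      - 2 * n < 0) :
    ∃ C : ℝ, ∀ (c : ℝ) (a : ι → ℝ), 0 < c → (∀ i, 0 < a i) → diagTrace n Tp d T c a = 1 →
      0 ≤ diagCurvature n d κ c a → c ≤ C := by
  -- The trace condition gives `dᵢ Tᵢ aᵢ ≤ c u` with `u = n Tp + 1 / c`. The curvature is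
  -- nondecreasing in each `aᵢ`, so it is at most `c / 4 * H u`. For large `c`, `u` is close to `n
  -- Tp`, where `H` is the left side of `hzero`.
  let H : ℝ → ℝ := fun u => ∑ i, (κ i * u / T i - (1 - κ i) * d i ^ 2 * T i / u) - 2 * n
  have hnT : 0 < n * Tp := mul_pos hn hTp
  have hcont : ContinuousAt H (n * Tp) := by
    refine ContinuousAt.sub (tendsto_finsetSum _ fun i _ => ?_) continuousAt_const
    exact ((continuousAt_const.mul continuousAt_id).div_const _).sub
      (continuousAt_const.div continuousAt_id hnT.ne')
  have hH0 : H (n * Tp) < 0 := by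
    convert hzero using 2
    refine Finset.sum_congr rfl fun i _ => ?_
    have := (hT i).ne'
    field_simp
  obtain ⟨δ, hδ, hball⟩ := Metric.eventually_nhds_iff.1 (hcont.eventually_lt_const hH0)
  refine ⟨2 / δ, fun c a hc ha htr hS => ?_⟩
  by_contra! hlt
  have hcδ : 1 / c < δ := by
    rw [div_lt_iff₀ hδ] at hlt
    rw [div_lt_iff₀ hc]
    linarith
  set u := n * Tp + 1 / c with hu
  have hupos : 0 < u := by positivity
  have hHu : H u < 0 := by
    apply hball
    rw [Real.dist_eq, hu, add_sub_cancel_left, abs_of_pos (by positivity)]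
    exact hcδ
  have hub : ∀ i, d i * (T i * a i) ≤ c * u := by
    intro i
    have h1 : d i * (T i * a i) ≤ ∑ j, d j * (T j * a j) :=
      Finset.single_le_sum (f := fun j => d j * (T j * a j))
        (fun j _ => (mul_pos (hd j) (mul_pos (hT j) (ha j))).le) (Finset.mem_univ i)
    have h2 : c * u = 1 + n * Tp * c := by rw [hu]; field_simp; ring
    rw [diagTrace] at htr
    linarith
  have hterm : ∀ i, d i * (κ i * a i / 4 - (1 - κ i) * c ^ 2 / (4 * a i))
      ≤ c / 4 * (κ i * u / T i - (1 - κ i) * d i ^ 2 * T i / u) := by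
    intro i
    have hdi := hd i
    have hTi := hT i
    have hai := ha i
    have hκi := sub_pos.2 (hκ1 i)
    have h1 : d i * (κ i * a i / 4) ≤ c / 4 * (κ i * u / T i) := by
      rw [show c / 4 * (κ i * u / T i) = κ i / 4 * (c * u) / T i by ring, le_div_iff₀ hTi]
      calc d i * (κ i * a i / 4) * T i = κ i / 4 * (d i * (T i * a i)) := by ring
        _ ≤ κ i / 4 * (c * u) := mul_le_mul_of_nonneg_left (hub i) (by linarith [hκ0 i])
    have h2 : c / 4 * ((1 - κ i) * d i ^ 2 * T i / u)
        ≤ d i * ((1 - κ i) * c ^ 2 / (4 * a i)) := by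
      rw [show c / 4 * ((1 - κ i) * d i ^ 2 * T i / u)
          = (c * (1 - κ i) * d i ^ 2 * T i) / (4 * u) by field_simp,
        show d i * ((1 - κ i) * c ^ 2 / (4 * a i)) = (d i * (1 - κ i) * c ^ 2) / (4 * a i) by
          ring, div_le_div_iff₀ (by positivity) (by positivity)]
      calc c * (1 - κ i) * d i ^ 2 * T i * (4 * a i)
          = (4 * c * (1 - κ i) * d i) * (d i * (T i * a i)) := by ring
        _ ≤ (4 * c * (1 - κ i) * d i) * (c * u) :=
          mul_le_mul_of_nonneg_left (hub i) (by positivity)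
        _ = d i * (1 - κ i) * c ^ 2 * (4 * u) := by ring
    rw [mul_sub, mul_sub]
    linarith
  have hle : diagCurvature n d κ c a ≤ c / 4 * H u := by
    have := Finset.sum_le_sum fun i (_ : i ∈ Finset.univ) => hterm i
    rw [← Finset.mul_sum] at this
    simp only [diagCurvature, H, mul_sub (c / 4) (∑ _, _)]
    linarith
  exact absurd hS (not_le.2 (hle.trans_lt (mul_neg_of_pos_of_neg (by positivity) hHu)))

/-- The maximum of the scalar curvature over the diagonal metrics with `tr_g T = 1`. -/
lemma exists_isMax_diagCurvature (hn : 0 < n) (hTp : 0 < Tp) (hd : ∀ i, 0 < d i)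
    (hT : ∀ i, 0 < T i) (hκ0 : ∀ i, 0 ≤ κ i) (hκ1 : ∀ i, κ i < 1)
    (hsum : n = ∑ i, d i * (2 * (1 - κ i)))
    (hmax : ∀ i, κ i / T i ≤ κ m / T m)
    (hinf : κ m * (-(n * Tp) + ∑ i, d i * T i) / T m
      < ∑ i, d i + d m * (1 - κ m) - 3 * n)
    (hzero : ∑ i, (n ^ 2 * κ i * Tp ^ 2 - d i ^ 2 * (1 - κ i) * T i ^ 2) / (n * Tp * T i)
      - 2 * n < 0) :
    ∃ c a, 0 < c ∧ (∀ i, 0 < a i) ∧ diagTrace n Tp d T c a = 1 ∧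
      ∀ c' a', 0 < c' → (∀ i, 0 < a' i) → diagTrace n Tp d T c' a' = 1 →
        diagCurvature n d κ c' a' ≤ diagCurvature n d κ c a := by
  obtain ⟨c₁, a₁, hc₁, ha₁, htr₁, hgt⟩ := exists_diagCurvature_gt hd hT hκ1 hsum hinf
  obtain ⟨C, hC⟩ := exists_bound_of_diagCurvature_nonneg hn hTp hd hT hκ0 hκ1 hzero
  set v₀ := κ m / (4 * T m) with hv₀
  set v₁ := diagCurvature n d κ c₁ a₁ with hv₁
  have hv₀0 : 0 ≤ v₀ := div_nonneg (hκ0 m) (by linarith [hT m])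
  have hv₁0 : 0 < v₁ := hv₀0.trans_lt hgt
  have hnT : 0 < n * Tp := mul_pos hn hTp
  have hCpos : 0 < C := hc₁.trans_le (hC c₁ a₁ hc₁ ha₁ htr₁ hv₁0.le)
  have hneg : ∀ (c : ℝ) (a : ι → ℝ), 0 < c → (∀ i, 0 < a i) →
      ∀ i, 0 ≤ d i * ((1 - κ i) * c ^ 2 / (4 * a i)) := by
    intro c a hc ha i
    have := sub_pos.2 (hκ1 i)
    have := hd i
    have := ha i
    positivity
  -- Maximality of `m` gives `κⱼ ≤ 4 v₀ Tⱼ`, so the positive part of the curvature is at most `v₀ ∑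
  -- dⱼ Tⱼ aⱼ = v₀ (1 + n Tp c)`.
  have hupper : ∀ (c : ℝ) (a : ι → ℝ), 0 < c → (∀ i, 0 < a i) → diagTrace n Tp d T c a = 1 → ∀ i,
      diagCurvature n d κ c a + d i * ((1 - κ i) * c ^ 2 / (4 * a i)) ≤ v₀ * (1 + n * Tp * c)
      ∧ diagCurvature n d κ c a ≤ v₀ * (1 + n * Tp * c) := by
    intro c a hc ha htr i
    have h1 : ∑ j, d j * (κ j * a j / 4) ≤ v₀ * (1 + n * Tp * c) := by
      rw [diagTrace] at htr
      rw [show 1 + n * Tp * c = ∑ j, d j * (T j * a j) by linarith, Finset.mul_sum]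
      refine Finset.sum_le_sum fun j _ => ?_
      have h2 : κ j ≤ 4 * v₀ * T j := by
        have h3 := hmax j
        rw [div_le_iff₀ (hT j)] at h3
        rw [show 4 * v₀ = κ m / T m by rw [hv₀]; field_simp]
        exact h3
      have h4 : 0 < d j * a j := mul_pos (hd j) (ha j)
      nlinarith
    have h5 : d i * ((1 - κ i) * c ^ 2 / (4 * a i))
        ≤ ∑ j, d j * ((1 - κ j) * c ^ 2 / (4 * a j)) :=
      Finset.single_le_sum (f := fun j => d j * ((1 - κ j) * c ^ 2 / (4 * a j)))
        (fun j _ => hneg c a hc ha j) (Finset.mem_univ i)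
    have h6 : diagCurvature n d κ c a = -(n * c / 2) + (∑ j, d j * (κ j * a j / 4)
        - ∑ j, d j * ((1 - κ j) * c ^ 2 / (4 * a j))) := by
      rw [diagCurvature, ← Finset.sum_sub_distrib]
      simp only [mul_sub]
    have h7 : 0 < n * c := mul_pos hn hc
    have h8 := hneg c a hc ha i
    constructor <;> linarith
  -- Lower bound for `c` obtained from `v₁ ≤ v₀ (1 + n Tp c)`. The `+ 1` here and in `W` secures
  -- positivity even if `v₀ = 0`.
  set c₀ := (v₁ - v₀) / (v₀ * (n * Tp) + 1) with hc₀
  have hden : 0 < v₀ * (n * Tp) + 1 := by positivity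
  have hc₀pos : 0 < c₀ := div_pos (sub_pos.2 hgt) hden
  set W := v₀ * (1 + n * Tp * C) + 1 with hW
  have hWpos : 0 < W := by positivity
  -- If the curvature is at least `v₁ > 0`, the negative term of index `i` is at most `W`, which
  -- bounds `aᵢ` below by `l i`; the trace bounds it above by `A i`.
  let l : ι → ℝ := fun i => d i * (1 - κ i) * c₀ ^ 2 / (4 * W)
  let A : ι → ℝ := fun i => (1 + n * Tp * C) / (d i * T i)
  have hl : ∀ i, 0 < l i := fun i => by
    have := sub_pos.2 (hκ1 i)
    have := hd i
    positivity
  let K : Set (ℝ × (ι → ℝ)) := Set.Icc c₀ C ×ˢ Set.pi Set.univ fun i => Set.Icc (l i) (A i)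
  have hK : IsCompact K := isCompact_Icc.prod (isCompact_univ_pi fun i => isCompact_Icc)
  let S : Set (ℝ × (ι → ℝ)) := K ∩ {p | diagTrace n Tp d T p.1 p.2 = 1}
  have hS : IsCompact S := by
    refine hK.inter_right (isClosed_eq ?_ continuous_const)
    unfold diagTrace
    fun_prop
  have hmem : ∀ (c : ℝ) (a : ι → ℝ), 0 < c → (∀ i, 0 < a i) → diagTrace n Tp d T c a = 1 →
      v₁ ≤ diagCurvature n d κ c a → (c, a) ∈ S := by
    intro c a hc ha htr hv
    have hcC : c ≤ C := hC c a hc ha htr (hv₁0.le.trans hv)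
    have hcc₀ : c₀ ≤ c := by
      rw [hc₀, div_le_iff₀ hden]
      have := (hupper c a hc ha htr m).2
      nlinarith
    have hmono : n * Tp * c ≤ n * Tp * C := mul_le_mul_of_nonneg_left hcC hnT.le
    refine ⟨⟨⟨hcc₀, hcC⟩, fun i _ => ⟨?_, ?_⟩⟩, htr⟩
    · have h1 := (hupper c a hc ha htr i).1
      have h2 : d i * ((1 - κ i) * c ^ 2 / (4 * a i)) ≤ W := by
        have := mul_le_mul_of_nonneg_left hmono hv₀0
        rw [hW]
        linarith
      have h3 : c₀ ^ 2 ≤ c ^ 2 := pow_le_pow_left₀ hc₀pos.le hcc₀ 2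
      have hai := ha i
      change d i * (1 - κ i) * c₀ ^ 2 / (4 * W) ≤ a i
      rw [div_le_iff₀ (by positivity)]
      rw [← mul_div_assoc, div_le_iff₀ (by positivity)] at h2
      have h4 : 0 < d i * (1 - κ i) := mul_pos (hd i) (sub_pos.2 (hκ1 i))
      have h5 := mul_le_mul_of_nonneg_left h3 h4.le
      linarith
    · change a i ≤ (1 + n * Tp * C) / (d i * T i)
      rw [le_div_iff₀ (mul_pos (hd i) (hT i))]
      have h1 : d i * (T i * a i) ≤ ∑ j, d j * (T j * a j) :=
        Finset.single_le_sum (f := fun j => d j * (T j * a j))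
          (fun j _ => (mul_pos (hd j) (mul_pos (hT j) (ha j))).le) (Finset.mem_univ i)
      rw [diagTrace] at htr
      linarith
  have hpos : ∀ p ∈ S, 0 < p.1 ∧ ∀ i, 0 < p.2 i := fun p hp =>
    ⟨hc₀pos.trans_le hp.1.1.1, fun i => (hl i).trans_le (hp.1.2 i (Set.mem_univ i)).1⟩
  have hcont : ContinuousOn (fun p : ℝ × (ι → ℝ) => diagCurvature n d κ p.1 p.2) S := by
    unfold diagCurvature
    refine ContinuousOn.add (by fun_prop) (continuousOn_finsetSum _ fun i _ => ?_)
    refine continuousOn_const.mul (ContinuousOn.sub (by fun_prop) ?_)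
    refine ContinuousOn.div (by fun_prop) (by fun_prop) fun p hp => ?_
    have := (hpos p hp).2 i
    positivity
  have hne : S.Nonempty := ⟨_, hmem c₁ a₁ hc₁ ha₁ htr₁ le_rfl⟩
  obtain ⟨p, hp, hpmax⟩ := hS.exists_isMaxOn hne hcont
  refine ⟨p.1, p.2, (hpos p hp).1, (hpos p hp).2, hp.2, fun c a hc ha htr => ?_⟩
  have hp₁ : v₁ ≤ diagCurvature n d κ p.1 p.2 := hpmax (hmem c₁ a₁ hc₁ ha₁ htr₁ le_rfl)
  rcases le_total v₁ (diagCurvature n d κ c a) with h | h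
  · exact hpmax (hmem c a hc ha htr h)
  · exact h.trans hp₁

end Optimization

/-! ### Invariant metrics on a complex simple Lie algebra. -/

section Complex

lemma InnerForm.exists_basis_of_orthonormal {V : Type*} [AddCommGroup V] [Module ℝ V]
    [FiniteDimensional ℝ V] {ι : Type*} [Fintype ι] (g : InnerForm V) (f : ι → V)
    (h1 : ∀ i, g.form (f i) (f i) = 1) (h0 : ∀ i j, i ≠ j → g.form (f i) (f j) = 0)
    (hcard : Fintype.card ι = Module.finrank ℝ V) :
    ∃ b : Module.Basis ι ℝ V, g.IsOrthonormalBasis b ∧ ⇑b = f := by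
  have hli : LinearIndependent ℝ f :=
    LinearMap.linearIndependent_of_isOrthoᵢ (B := g.form) (fun i j hij => h0 i j hij)
      fun i hi => one_ne_zero ((h1 i).symm.trans hi)
  rcases isEmpty_or_nonempty ι with hι | hι
  · have : Subsingleton V := by
      rw [← Module.finrank_zero_iff (R := ℝ), ← hcard, Fintype.card_eq_zero]
    exact ⟨Module.Basis.empty V, ⟨fun i => isEmptyElim i, fun i => isEmptyElim i⟩,
      funext fun i => isEmptyElim i⟩
  · refine ⟨basisOfLinearIndependentOfCardEqFinrank hli hcard, ⟨fun i => ?_, fun i j hij => ?_⟩,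
      coe_basisOfLinearIndependentOfCardEqFinrank hli hcard⟩
    · simpa using h1 i
    · simpa using h0 i j hij

variable {𝔤 : Type*} [LieRing 𝔤] [LieAlgebra ℝ 𝔤] {𝔨 : LieSubalgebra ℝ 𝔤}

/-- An equivariant isometry from `𝔨` onto `𝔭`: the restriction to `𝔨` of a complex structure
on `𝔤`, for which `𝔤` is the complexification of `𝔨`. -/
structure IsComplexStructure (hC : IsCartanDecomposition 𝔨) (J : 𝔤 →ₗ[ℝ] 𝔤) : Prop where
  map_mem : ∀ x ∈ 𝔨, J x ∈ pPart 𝔨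
  isometry : ∀ x ∈ 𝔨, ∀ y ∈ 𝔨,
    (cartanInner hC).form (J x) (J y) = (cartanInner hC).form x y
  lie_map : ∀ x ∈ 𝔨, ∀ y ∈ 𝔨, ⁅x, J y⁆ = J ⁅x, y⁆
  finrank_eq : Module.finrank ℝ (pPart 𝔨) = Module.finrank ℝ 𝔨

namespace IsComplexStructure

variable {hC : IsCartanDecomposition 𝔨} {J : 𝔤 →ₗ[ℝ] 𝔤}

lemma map_lie (hJ : IsComplexStructure hC J) {x y : 𝔤} (hx : x ∈ 𝔨) (hy : y ∈ 𝔨) :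
    ⁅J x, y⁆ = J ⁅x, y⁆ := by
  rw [← lie_skew, hJ.lie_map y hy x hx, ← map_neg, lie_skew]

/-- Both sides lie in `𝔨`. For `z ∈ 𝔨`, `B(⁅J x, J y⁆, z) = B(J x, J ⁅y, z⁆)`, and since `J` is a
`Q`-isometry while `B` has opposite signs on `𝔭` and `𝔨`, this is `-B(⁅x, y⁆, z)`. -/
lemma map_lie_map (hJ : IsComplexStructure hC J) {x y : 𝔤} (hx : x ∈ 𝔨) (hy : y ∈ 𝔨) :
    ⁅J x, J y⁆ = -⁅x, y⁆ := by
  have hm := hC.lie_p_p _ (hJ.map_mem x hx) _ (hJ.map_mem y hy)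
  have hs : ⁅J x, J y⁆ + ⁅x, y⁆ ∈ 𝔨 := 𝔨.add_mem hm (𝔨.lie_mem hx hy)
  have key : ∀ z ∈ 𝔨, (cartanInner hC).form (⁅J x, J y⁆ + ⁅x, y⁆) z = 0 := by
    intro z hz
    rw [hC.form_of_mem hs, map_add, LinearMap.add_apply,
      LieModule.traceForm_apply_lie_apply ℝ 𝔤 𝔤 (J x), hJ.map_lie hy hz,
      ← hC.form_of_mem_pPart (hJ.map_mem x hx), hJ.isometry x hx _ (𝔨.lie_mem hy hz),
      hC.form_of_mem hx, LieModule.traceForm_apply_lie_apply ℝ 𝔤 𝔤 x]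
    ring
  exact eq_neg_of_add_eq_zero_left ((cartanInner hC).eq_zero (key _ hs))

variable [FiniteDimensional ℝ 𝔤] {ι : Type*} [Fintype ι] {v : Module.Basis ι ℝ 𝔨}

/-- An orthonormal frame of a `𝔨`-invariant metric on a complex Lie algebra. -/
lemma exists_frame (hJ : IsComplexStructure hC J) (hv : hC.innerK.IsOrthonormalBasis v)
    {g : InnerForm 𝔤} {α β γ s t r : ℝ}
    (hα : ∀ x ∈ 𝔨, ∀ y ∈ 𝔨, g.form x y = α * (cartanInner hC).form x y)
    (hβ : ∀ x ∈ 𝔨, ∀ y ∈ 𝔨, g.form (J x) (J y) = β * (cartanInner hC).form x y)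
    (hγ : ∀ x ∈ 𝔨, ∀ y ∈ 𝔨, g.form x (J y) = γ * (cartanInner hC).form x y)
    (h1 : s ^ 2 * α + 2 * s * t * γ + t ^ 2 * β = 1) (h2 : s * γ + t * β = 0)
    (h3 : r ^ 2 * β = 1) :
    ∃ f : Module.Basis (ι ⊕ ι) ℝ 𝔤, g.IsOrthonormalBasis f ∧
      (∀ a, f (Sum.inl a) = s • (v a : 𝔤) + t • J (v a)) ∧ ∀ a, f (Sum.inr a) = r • J (v a) := by
  have hγ' : ∀ x ∈ 𝔨, ∀ y ∈ 𝔨, g.form (J x) y = γ * (cartanInner hC).form x y := by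
    intro x hx y hy
    rw [g.symm, hγ y hy x hx, InnerForm.symm]
  have hv1 : ∀ a, (cartanInner hC).form (v a) (v a) = 1 := hv.1
  have hv0 : ∀ a b, a ≠ b → (cartanInner hC).form (v a) (v b) = 0 := hv.2
  have e11 : ∀ a b, g.form (s • (v a : 𝔤) + t • J (v a)) (s • (v b : 𝔤) + t • J (v b))
      = (s ^ 2 * α + 2 * s * t * γ + t ^ 2 * β) * (cartanInner hC).form (v a) (v b) := by
    intro a b
    simp only [map_add, map_smul, LinearMap.add_apply, LinearMap.smul_apply, smul_eq_mul,
      hα _ (v a).2 _ (v b).2, hβ _ (v a).2 _ (v b).2, hγ _ (v a).2 _ (v b).2,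
      hγ' _ (v a).2 _ (v b).2]
    ring
  have e12 : ∀ a b, g.form (s • (v a : 𝔤) + t • J (v a)) (r • J (v b)) = 0 := by
    intro a b
    simp only [map_add, map_smul, LinearMap.add_apply, LinearMap.smul_apply, smul_eq_mul,
      hβ _ (v a).2 _ (v b).2, hγ _ (v a).2 _ (v b).2]
    linear_combination r * (cartanInner hC).form (v a) (v b) * h2
  have e22 : ∀ a b, g.form (r • J (v a)) (r • J (v b)) =
      r ^ 2 * β * (cartanInner hC).form (v a) (v b) := by
    intro a b
    simp only [map_smul, LinearMap.smul_apply, smul_eq_mul, hβ _ (v a).2 _ (v b).2]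
    ring
  -- `h1`, `h2`, `h3` are the orthonormality relations of the vectors `s v + t J v` and `r J v`;
  -- equality of `dim 𝔭` and `dim 𝔨` makes them a basis.
  obtain ⟨f, hf, hfe⟩ := g.exists_basis_of_orthonormal
    (Sum.elim (fun a => s • (v a : 𝔤) + t • J (v a)) fun a => r • J (v a)) (by
      rintro (a | a)
      · exact (e11 a a).trans (by rw [h1, hv1, mul_one])
      · exact (e22 a a).trans (by rw [h3, hv1, mul_one])) (by
      rintro (a | a) (b | b) hab
      · exact (e11 a b).trans (by rw [hv0 a b fun h => hab (by rw [h]), mul_zero])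
      · exact e12 a b
      · exact (g.symm _ _).trans (e12 b a)
      · exact (e22 a b).trans (by rw [hv0 a b fun h => hab (by rw [h]), mul_zero])) (by
      rw [Fintype.card_sum, ← Module.finrank_eq_card_basis v,
        ← Submodule.finrank_add_eq_of_isCompl hC.isCompl, hJ.finrank_eq]
      rfl)
  exact ⟨f, hf, fun a => by rw [hfe]; rfl, fun a => by rw [hfe]; rfl⟩

/-- Only `s²` and `t² + r²` enter, as `T` has no mixed terms. These numbers become the inverse
coefficients of the comparison metric. -/
lemma traceForm_eq (hJ : IsComplexStructure hC J) (hv : hC.innerK.IsOrthonormalBasis v)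
    {g : InnerForm 𝔤} {α β γ s t r : ℝ}
    (hα : ∀ x ∈ 𝔨, ∀ y ∈ 𝔨, g.form x y = α * (cartanInner hC).form x y)
    (hβ : ∀ x ∈ 𝔨, ∀ y ∈ 𝔨, g.form (J x) (J y) = β * (cartanInner hC).form x y)
    (hγ : ∀ x ∈ 𝔨, ∀ y ∈ 𝔨, g.form x (J y) = γ * (cartanInner hC).form x y)
    (h1 : s ^ 2 * α + 2 * s * t * γ + t ^ 2 * β = 1) (h2 : s * γ + t * β = 0)
    (h3 : r ^ 2 * β = 1) {T : LinearMap.BilinForm ℝ 𝔤}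
    (hT : ∀ x ∈ 𝔨, ∀ y ∈ pPart 𝔨, T x y = 0 ∧ T y x = 0) :
    g.traceForm T = ∑ a, (s ^ 2 * T (v a) (v a) + (t ^ 2 + r ^ 2) * T (J (v a)) (J (v a))) := by
  obtain ⟨f, hf, hf1, hf2⟩ := hJ.exists_frame hv hα hβ hγ h1 h2 h3
  rw [hf.traceForm_eq, Fintype.sum_sum_type, ← Finset.sum_add_distrib]
  refine Finset.sum_congr rfl fun a _ => ?_
  obtain ⟨h5, h6⟩ := hT _ (v a).2 _ (hJ.map_mem _ (v a).2)
  simp only [hf1, hf2, map_add, map_smul, LinearMap.add_apply, LinearMap.smul_apply, smul_eq_mul,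
    h5, h6]
  ring

/-- Brackets of frame vectors are combinations of `⁅v a, v b⁆` and `J ⁅v a, v b⁆`, so the metric
enters only through scalar coefficients of one fixed sum of squares. -/
lemma scalarCurvature_eq (hJ : IsComplexStructure hC J) (hG : LieAlgebra.IsSimple ℝ 𝔤)
    (hv : hC.innerK.IsOrthonormalBasis v)
    {g : InnerForm 𝔤} {α β γ s t r : ℝ}
    (hα : ∀ x ∈ 𝔨, ∀ y ∈ 𝔨, g.form x y = α * (cartanInner hC).form x y)
    (hβ : ∀ x ∈ 𝔨, ∀ y ∈ 𝔨, g.form (J x) (J y) = β * (cartanInner hC).form x y)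
    (hγ : ∀ x ∈ 𝔨, ∀ y ∈ 𝔨, g.form x (J y) = γ * (cartanInner hC).form x y)
    (h1 : s ^ 2 * α + 2 * s * t * γ + t ^ 2 * β = 1) (h2 : s * γ + t * β = 0)
    (h3 : r ^ 2 * β = 1) :
    scalarCurvature g = -(1 / 2) * (Fintype.card ι * (t ^ 2 + r ^ 2 - s ^ 2))
      - (1 / 4) * (((s ^ 2 - t ^ 2) ^ 2 * α + 4 * (s ^ 2 - t ^ 2) * (s * t) * γ
          + 4 * (s * t) ^ 2 * β
          + 2 * ((r * t) ^ 2 * α - 2 * r ^ 2 * (s * t) * γ + (r * s) ^ 2 * β) + r ^ 4 * α)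
        * ∑ a, ∑ b, (cartanInner hC).form ⁅(v a : 𝔤), (v b : 𝔤)⁆ ⁅(v a : 𝔤), (v b : 𝔤)⁆) := by
  obtain ⟨f, hf, hf1, hf2⟩ := hJ.exists_frame hv hα hβ hγ h1 h2 h3
  have hγ' : ∀ x ∈ 𝔨, ∀ y ∈ 𝔨, g.form (J x) y = γ * (cartanInner hC).form x y := by
    intro x hx y hy
    rw [g.symm, hγ y hy x hx, InnerForm.symm]
  have hv1 : ∀ a, (cartanInner hC).form (v a) (v a) = 1 := hv.1
  have k1 : ∀ a, killingForm ℝ 𝔤 (v a : 𝔤) (v a : 𝔤) = -1 := fun a => by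
    rw [← neg_inj, ← hC.form_of_mem (v a).2, hv1, neg_neg]
  have k2 : ∀ a, killingForm ℝ 𝔤 (J (v a)) (J (v a)) = 1 := fun a => by
    rw [← hC.form_of_mem_pPart (hJ.map_mem _ (v a).2), hJ.isometry _ (v a).2 _ (v a).2, hv1]
  have k3 : ∀ a, killingForm ℝ 𝔤 (v a : 𝔤) (J (v a)) = 0 := fun a =>
    killingForm_of_mem_of_mem_pPart (v a).2 (hJ.map_mem _ (v a).2)
  have k4 : ∀ a, killingForm ℝ 𝔤 (J (v a)) (v a : 𝔤) = 0 := fun a =>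
    killingForm_of_mem_pPart_of_mem (hJ.map_mem _ (v a).2) (v a).2
  have hK : ∑ x, killingForm ℝ 𝔤 (f x) (f x) = Fintype.card ι * (t ^ 2 + r ^ 2 - s ^ 2) := by
    rw [Fintype.sum_sum_type, ← Finset.sum_add_distrib]
    simp only [hf1, hf2, map_add, map_smul, LinearMap.add_apply, LinearMap.smul_apply,
      smul_eq_mul, k1, k2, k3, k4]
    rw [Finset.sum_const, Finset.card_univ, nsmul_eq_mul]
    ring
  have hnorm : ∀ a b, ∀ p q : ℝ, g.form (p • ⁅(v a : 𝔤), (v b : 𝔤)⁆ + q • J ⁅(v a : 𝔤), (v b : 𝔤)⁆)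
      (p • ⁅(v a : 𝔤), (v b : 𝔤)⁆ + q • J ⁅(v a : 𝔤), (v b : 𝔤)⁆)
      = (p ^ 2 * α + 2 * p * q * γ + q ^ 2 * β)
        * (cartanInner hC).form ⁅(v a : 𝔤), (v b : 𝔤)⁆ ⁅(v a : 𝔤), (v b : 𝔤)⁆ := by
    intro a b p q
    have hw := 𝔨.lie_mem (v a).2 (v b).2
    simp only [map_add, map_smul, LinearMap.add_apply, LinearMap.smul_apply, smul_eq_mul,
      hα _ hw _ hw, hβ _ hw _ hw, hγ _ hw _ hw, hγ' _ hw _ hw]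
    ring
  have b11 : ∀ a b, ⁅f (Sum.inl a), f (Sum.inl b)⁆
      = (s ^ 2 - t ^ 2) • ⁅(v a : 𝔤), (v b : 𝔤)⁆ + (2 * s * t) • J ⁅(v a : 𝔤), (v b : 𝔤)⁆ := by
    intro a b
    rw [hf1, hf1]
    simp only [lie_add, add_lie, lie_smul, smul_lie, hJ.lie_map _ (v a).2 _ (v b).2,
      hJ.map_lie (v a).2 (v b).2, hJ.map_lie_map (v a).2 (v b).2]
    module
  have b12 : ∀ a b, ⁅f (Sum.inl a), f (Sum.inr b)⁆
      = (-(r * t)) • ⁅(v a : 𝔤), (v b : 𝔤)⁆ + (r * s) • J ⁅(v a : 𝔤), (v b : 𝔤)⁆ := by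
    intro a b
    rw [hf1, hf2]
    simp only [add_lie, lie_smul, smul_lie, hJ.lie_map _ (v a).2 _ (v b).2,
      hJ.map_lie_map (v a).2 (v b).2]
    module
  have b21 : ∀ a b, ⁅f (Sum.inr a), f (Sum.inl b)⁆
      = (-(r * t)) • ⁅(v a : 𝔤), (v b : 𝔤)⁆ + (r * s) • J ⁅(v a : 𝔤), (v b : 𝔤)⁆ := by
    intro a b
    rw [hf1, hf2]
    simp only [lie_add, lie_smul, smul_lie, hJ.map_lie (v a).2 (v b).2,
      hJ.map_lie_map (v a).2 (v b).2]
    module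
  have b22 : ∀ a b, ⁅f (Sum.inr a), f (Sum.inr b)⁆
      = (-r ^ 2) • ⁅(v a : 𝔤), (v b : 𝔤)⁆ + (0 : ℝ) • J ⁅(v a : 𝔤), (v b : 𝔤)⁆ := by
    intro a b
    rw [hf2, hf2]
    simp only [lie_smul, smul_lie, hJ.map_lie_map (v a).2 (v b).2]
    module
  rw [NatRed.scalarCurvature_eq hf (trace_ad_eq_zero hG), hK]
  simp only [Fintype.sum_sum_type, b11, b12, b21, b22, hnorm, ← Finset.mul_sum,
    ← Finset.sum_add_distrib, ← add_mul]
  ring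

end IsComplexStructure

end Complex

/-! ### Domination by diagonal metrics and conclusion. -/

section Comparison

variable {𝔤 : Type*} [LieRing 𝔤] [LieAlgebra ℝ 𝔤] {𝔨 : LieSubalgebra ℝ 𝔤} [FiniteDimensional ℝ 𝔤]

/-- The tensor `-T_𝔭 Q|_𝔭 + ∑ Tᵢ Q|_{𝔨ᵢ}`. -/
def diagTensor (hC : IsCartanDecomposition 𝔨) (Tp : ℝ) (Tk : Factor 𝔨 → ℝ) :
    LinearMap.BilinForm ℝ 𝔤 :=
  -(Tp • (cartanInner hC).restr (pPart 𝔨)) + ∑ i, Tk i • (cartanInner hC).restr i.space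

lemma diagTensor_eq_zero (hC : IsCartanDecomposition 𝔨) (Tp : ℝ) (Tk : Factor 𝔨 → ℝ) {x y : 𝔤}
    (hx : x ∈ 𝔨) (hy : y ∈ pPart 𝔨) :
    diagTensor hC Tp Tk x y = 0 ∧ diagTensor hC Tp Tk y x = 0 := by
  set Q := cartanInner hC
  have h0 : ∀ (U : Submodule ℝ 𝔤) (v : 𝔤), (∀ u ∈ U, Q.form u v = 0) → Q.proj U v = 0 :=
    fun U v hv => (Submodule.projection_apply_eq_zero_iff (Q.isCompl_orthogonal U)).2 hv
  have h1 : Q.proj (pPart 𝔨) x = 0 := h0 _ _ fun u hu => hC.form_of_mem_pPart_of_mem hu hx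
  have h2 : ∀ i : Factor 𝔨, Q.proj i.space y = 0 := fun i => h0 _ _ fun u hu =>
    hC.form_of_mem_of_mem_pPart (Factor.mem_of_mem_space hu) hy
  constructor <;>
  simp only [diagTensor, LinearMap.add_apply, LinearMap.neg_apply, LinearMap.smul_apply,
    LinearMap.sum_apply, InnerForm.restr, LinearMap.compl₁₂_apply, smul_eq_mul, Q, h1, h2,
    map_zero, LinearMap.zero_apply, mul_zero, neg_zero, Finset.sum_const_zero, add_zero]

namespace IsCartanDecomposition

variable {hC : IsCartanDecomposition 𝔨}

/-- On a complex Lie algebra, every `𝔨`-invariant metric is dominated by a diagonal one. -/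
lemma exists_dominating_of_isComplexStructure {J : 𝔤 →ₗ[ℝ] 𝔤} (hJ : IsComplexStructure hC J)
    (hG : LieAlgebra.IsSimple ℝ 𝔤) (hp : pPart 𝔨 ≠ ⊥)
    {g : InnerForm 𝔤} {α β γ : ℝ}
    (hα : ∀ x ∈ 𝔨, ∀ y ∈ 𝔨, g.form x y = α * (cartanInner hC).form x y)
    (hβ : ∀ x ∈ 𝔨, ∀ y ∈ 𝔨, g.form (J x) (J y) = β * (cartanInner hC).form x y)
    (hγ : ∀ x ∈ 𝔨, ∀ y ∈ 𝔨, g.form x (J y) = γ * (cartanInner hC).form x y)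
    (hβ0 : 0 < β) (hdet : 0 < α * β - γ ^ 2) :
    ∃ (c : ℝ) (a : Factor 𝔨 → ℝ), 0 < c ∧ (∀ i, 0 < a i) ∧
      (∀ Tp Tk, g.traceForm (diagTensor hC Tp Tk)
        = diagTrace (Module.finrank ℝ (pPart 𝔨)) Tp (fun i : Factor 𝔨 => (i.dim : ℝ)) Tk c a) ∧
      scalarCurvature g ≤ diagCurvature (Module.finrank ℝ (pPart 𝔨))
        (fun i : Factor 𝔨 => (i.dim : ℝ)) Factor.kappa c a := by
  obtain ⟨v, hv⟩ := hC.innerK.exists_isOrthonormalBasis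
  obtain ⟨e, he⟩ := hC.exists_isAdapted
  -- Gram–Schmidt starting from `J v`: the solution of the three frame relations.
  set s := √(β / (α * β - γ ^ 2)) with hs
  set r := √(1 / β) with hr
  set t := -(s * γ / β) with ht
  have hs2 : s ^ 2 = β / (α * β - γ ^ 2) := Real.sq_sqrt (div_pos hβ0 hdet).le
  have hr2 : r ^ 2 = 1 / β := Real.sq_sqrt (one_div_pos.2 hβ0).le
  have hs0 : 0 < s := Real.sqrt_pos.2 (div_pos hβ0 hdet)
  have hr0 : 0 < r := Real.sqrt_pos.2 (one_div_pos.2 hβ0)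
  have hsq : s ^ 2 * (α * β - γ ^ 2) = β := by rw [hs2, div_mul_cancel₀ _ hdet.ne']
  have h2 : s * γ + t * β = 0 := by rw [ht]; field_simp; ring
  have h3 : r ^ 2 * β = 1 := by rw [hr2, one_div_mul_cancel hβ0.ne']
  have h1 : s ^ 2 * α + 2 * s * t * γ + t ^ 2 * β = 1 := by
    have : (s ^ 2 * α + 2 * s * t * γ + t ^ 2 * β) * β = β := by
      linear_combination hsq + (s * γ + t * β) * h2
    exact mul_right_cancel₀ hβ0.ne' (this.trans (one_mul β).symm)
  set ρ := t ^ 2 + r ^ 2 with hρ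
  have hρ0 : 0 < ρ := by positivity
  have hs20 : 0 < s ^ 2 := by positivity
  -- The diagonal metric with the same `s²` and `t² + r²`, hence the same trace of `T` and the same
  -- Killing term in the curvature.
  obtain ⟨g', hg'⟩ := he.exists_isDiagonal (inv_pos.2 hρ0) (α := fun _ => (s ^ 2)⁻¹)
    fun _ => inv_pos.2 hs20
  have hk : ∀ x ∈ 𝔨, ∀ y, g'.form x y = (s ^ 2)⁻¹ * (cartanInner hC).form x y := by
    intro x hx y
    rw [← he.orthonormal.sum_eq x]
    simp only [map_sum, LinearMap.sum_apply, map_smul, LinearMap.smul_apply, smul_eq_mul,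
      Finset.mul_sum]
    refine Finset.sum_congr rfl ?_
    rintro (δ | b) -
    · rw [hC.form_of_mem_of_mem_pPart hx (he.inl_mem δ)]
      ring
    · rw [hg'.form_k _ _ (he.inr_mem b)]
      ring
  have hα' : ∀ x ∈ 𝔨, ∀ y ∈ 𝔨, g'.form x y = (s ^ 2)⁻¹ * (cartanInner hC).form x y :=
    fun x hx y _ => hk x hx y
  have hβ' : ∀ x ∈ 𝔨, ∀ y ∈ 𝔨, g'.form (J x) (J y) = ρ⁻¹ * (cartanInner hC).form x y := by
    intro x hx y hy
    rw [hg'.form_p _ (hJ.map_mem x hx), hJ.isometry x hx y hy]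
  have hγ' : ∀ x ∈ 𝔨, ∀ y ∈ 𝔨, g'.form x (J y) = 0 * (cartanInner hC).form x y := by
    intro x hx y hy
    rw [hk x hx, hC.form_of_mem_of_mem_pPart hx (hJ.map_mem y hy)]
    ring
  have hρs : √ρ ^ 2 = ρ := Real.sq_sqrt hρ0.le
  have h1' : s ^ 2 * (s ^ 2)⁻¹ + 2 * s * 0 * 0 + 0 ^ 2 * ρ⁻¹ = 1 := by
    rw [mul_inv_cancel₀ hs20.ne']; ring
  have h2' : s * 0 + 0 * ρ⁻¹ = 0 := by ring
  have h3' : √ρ ^ 2 * ρ⁻¹ = 1 := by rw [hρs, mul_inv_cancel₀ hρ0.ne']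
  refine ⟨ρ, fun _ => s ^ 2, hρ0, fun _ => hs20, fun Tp Tk => ?_, ?_⟩
  · have e1 := hJ.traceForm_eq hv hα hβ hγ h1 h2 h3 (T := diagTensor hC Tp Tk)
      fun x hx y hy => diagTensor_eq_zero hC Tp Tk hx hy
    have e2 := hJ.traceForm_eq hv hα' hβ' hγ' h1' h2' h3' (T := diagTensor hC Tp Tk)
      fun x hx y hy => diagTensor_eq_zero hC Tp Tk hx hy
    have e3 := hg'.traceForm_eq hρ0 (fun _ => hs20) Tp Tk
    rw [hρs] at e2
    rw [e1, diagTrace, ← e3]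
    refine Eq.trans ?_ e2.symm
    refine Finset.sum_congr rfl fun a _ => ?_
    rw [← hρ]
    ring
  · have e1 := hJ.scalarCurvature_eq hG hv hα hβ hγ h1 h2 h3
    have e2 := hJ.scalarCurvature_eq hG hv hα' hβ' hγ' h1' h2' h3'
    have e3 := hg'.scalarCurvature_eq hG hp hρ0 (fun _ => hs20)
    rw [diagCurvature, ← e3, e1, e2, hρs]
    have hN : 0 ≤ ∑ a, ∑ b, (cartanInner hC).form ⁅(v a : 𝔤), (v b : 𝔤)⁆ ⁅(v a : 𝔤), (v b : 𝔤)⁆ :=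
      Finset.sum_nonneg fun a _ => Finset.sum_nonneg fun b _ => (cartanInner hC).nonneg _
    set A := s ^ 2 with hA
    set D := r ^ 2 with hD
    have hD0 : 0 < D := by positivity
    have hβD : β = D⁻¹ := eq_inv_of_mul_eq_one_right h3
    have hγD : s * γ = -(t * D⁻¹) := by rw [← hβD]; linarith
    have hαD : α = (1 + t ^ 2 * D⁻¹) / A := by
      rw [eq_div_iff hs20.ne', ← hβD]
      linear_combination h1 - 2 * t * h2
    have hr4 : √ρ ^ 4 = ρ ^ 2 := by linear_combination (√ρ ^ 2 + ρ) * hρs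
    -- The bracket coefficients are `(A + ρ)² / A + 2 (A - ρ)` for `g'` and the same with the first
    -- term multiplied by `ρ / D ≥ 1` for `g`. They enter the curvature with a negative sign.
    have key : (s ^ 2 - 0 ^ 2) ^ 2 * (s ^ 2)⁻¹ + 4 * (s ^ 2 - 0 ^ 2) * (s * 0) * 0
          + 4 * (s * 0) ^ 2 * ρ⁻¹
          + 2 * ((√ρ * 0) ^ 2 * (s ^ 2)⁻¹ - 2 * √ρ ^ 2 * (s * 0) * 0 + (√ρ * s) ^ 2 * ρ⁻¹)
          + √ρ ^ 4 * (s ^ 2)⁻¹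
        ≤ (s ^ 2 - t ^ 2) ^ 2 * α + 4 * (s ^ 2 - t ^ 2) * (s * t) * γ + 4 * (s * t) ^ 2 * β
          + 2 * ((r * t) ^ 2 * α - 2 * r ^ 2 * (s * t) * γ + (r * s) ^ 2 * β) + r ^ 4 * α := by
      have l1 : (s ^ 2 - 0 ^ 2) ^ 2 * (s ^ 2)⁻¹ + 4 * (s ^ 2 - 0 ^ 2) * (s * 0) * 0
          + 4 * (s * 0) ^ 2 * ρ⁻¹
          + 2 * ((√ρ * 0) ^ 2 * (s ^ 2)⁻¹ - 2 * √ρ ^ 2 * (s * 0) * 0 + (√ρ * s) ^ 2 * ρ⁻¹)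
          + √ρ ^ 4 * (s ^ 2)⁻¹ = (A + ρ) ^ 2 / A + 2 * (A - ρ) := by
        rw [hr4, mul_pow √ρ s, hρs, ← hA]
        field_simp
        ring
      have l2 : (s ^ 2 - t ^ 2) ^ 2 * α + 4 * (s ^ 2 - t ^ 2) * (s * t) * γ
          + 4 * (s * t) ^ 2 * β
          + 2 * ((r * t) ^ 2 * α - 2 * r ^ 2 * (s * t) * γ + (r * s) ^ 2 * β) + r ^ 4 * α
          = (A + ρ) ^ 2 / A * (ρ / D) + 2 * (A - ρ) := by
        have : (s ^ 2 - t ^ 2) ^ 2 * α + 4 * (s ^ 2 - t ^ 2) * (s * t) * γ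
          + 4 * (s * t) ^ 2 * β
          + 2 * ((r * t) ^ 2 * α - 2 * r ^ 2 * (s * t) * γ + (r * s) ^ 2 * β) + r ^ 4 * α
          = (A - t ^ 2) ^ 2 * α + 4 * (A - t ^ 2) * t * (s * γ) + 4 * (A * t ^ 2) * β
          + 2 * (D * t ^ 2 * α - 2 * D * t * (s * γ) + D * A * β) + D ^ 2 * α := by
          rw [hA, hD]; ring
        rw [this, hγD, hαD, hβD, hρ]
        field_simp
        ring
      rw [l1, l2]
      have h4 : 1 ≤ ρ / D := by rw [one_le_div hD0, hρ]; linarith [sq_nonneg t]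
      have h5 : 0 ≤ (A + ρ) ^ 2 / A := by positivity
      linarith [mul_le_mul_of_nonneg_left h4 h5]
    have h6 := mul_le_mul_of_nonneg_right key hN
    have h7 : (0 : ℝ) ^ 2 + ρ - A = t ^ 2 + D - A := by rw [hρ]; ring
    rw [h7]
    linarith

/-- A `𝔨`-invariant metric for which `𝔭` and `𝔨` are orthogonal is diagonal. -/
lemma exists_isDiagonal_of_orthogonal (hC : IsCartanDecomposition 𝔨)
    (hG : LieAlgebra.IsSimple ℝ 𝔤) (hp : pPart 𝔨 ≠ ⊥) {g : InnerForm 𝔤}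
    (hg : IsInvariantUnder 𝔨 g.form) (h0 : ∀ x ∈ 𝔨, ∀ y ∈ pPart 𝔨, g.form x y = 0) :
    ∃ (c : ℝ) (a : Factor 𝔨 → ℝ), 0 < c ∧ (∀ i, 0 < a i) ∧
      IsDiagonal hC g c⁻¹ fun i => (a i)⁻¹ := by
  obtain ⟨e, he⟩ := hC.exists_isAdapted
  obtain ⟨β, hβ⟩ := hC.exists_eq_smul_on_pPart hG g.symm hg
  choose α hα using fun i => hC.exists_eq_smul_on_space hG hp i g.symm hg
  have hpos : ∀ {x : 𝔤} {b : ℝ}, x ≠ 0 → g.form x x = b * (cartanInner hC).form x x → 0 < b := by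
    intro x b hx h
    have h1 := g.pos x hx
    rw [h] at h1
    exact (pos_iff_pos_of_mul_pos h1).2 ((cartanInner hC).pos x hx)
  have hβ0 : 0 < β := by
    obtain ⟨x, hx, hx0⟩ := (Submodule.ne_bot_iff _).1 hp
    exact hpos hx0 (hβ x hx x hx)
  have hα0 : ∀ i, 0 < α i := by
    intro i
    obtain ⟨a, rfl⟩ := exists_index i
    exact hpos (e.ne_zero (Sum.inr a)) (hα _ _ (he.inr_mem a) _ (he.inr_mem a))
  have hexp : ∀ (b : ℝ) (x : 𝔤),
      (∀ z, g.form x (e z) = b * (cartanInner hC).form x (e z)) →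
      ∀ y, g.form x y = b * (cartanInner hC).form x y := by
    intro b x h y
    rw [← he.orthonormal.sum_eq y]
    simp only [map_sum, map_smul, smul_eq_mul, h, Finset.mul_sum]
    exact Finset.sum_congr rfl fun z _ => by ring
  refine ⟨β⁻¹, fun i => (α i)⁻¹, inv_pos.2 hβ0, fun i => inv_pos.2 (hα0 i), ?_⟩
  simp only [inv_inv]
  refine ⟨fun x hx => hexp _ _ ?_, fun i x hx => hexp _ _ ?_⟩
  · rintro (δ | b)
    · exact hβ x hx _ (he.inl_mem δ)
    · rw [g.symm, h0 _ (he.inr_mem_k b) x hx, hC.form_of_mem_pPart_of_mem hx (he.inr_mem_k b),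
        mul_zero]
  · have hxk := Factor.mem_of_mem_space hx
    rintro (δ | b)
    · rw [h0 x hxk _ (he.inl_mem δ), hC.form_of_mem_of_mem_pPart hxk (he.inl_mem δ), mul_zero]
    · by_cases hb : i = b.1
      · exact hα i x hx _ (hb ▸ he.inr_mem b)
      · rw [apply_eq_zero_of_ne g.symm hg hb hx (he.inr_mem b),
          apply_eq_zero_of_ne (cartanInner hC).symm (fun z hz x y => hC.form_lie hz x y) hb hx
            (he.inr_mem b), mul_zero]

/-- If `𝔭` and `𝔨` are not orthogonal for some `𝔨`-invariant metric, then `𝔤` is complex. -/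
lemma exists_isComplexStructure (hC : IsCartanDecomposition 𝔨)
    (hG : LieAlgebra.IsSimple ℝ 𝔤) (hp : pPart 𝔨 ≠ ⊥) {g : InnerForm 𝔤}
    (hg : IsInvariantUnder 𝔨 g.form) (h0 : ¬∀ x ∈ 𝔨, ∀ y ∈ pPart 𝔨, g.form x y = 0) :
    ∃ (J : 𝔤 →ₗ[ℝ] 𝔤) (α β γ : ℝ), IsComplexStructure hC J ∧
      (∀ x ∈ 𝔨, ∀ y ∈ 𝔨, g.form x y = α * (cartanInner hC).form x y) ∧
      (∀ x ∈ 𝔨, ∀ y ∈ 𝔨, g.form (J x) (J y) = β * (cartanInner hC).form x y) ∧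
      (∀ x ∈ 𝔨, ∀ y ∈ 𝔨, g.form x (J y) = γ * (cartanInner hC).form x y) ∧
      0 < β ∧ 0 < α * β - γ ^ 2 := by
  set Q := cartanInner hC with hQ
  obtain ⟨e, he⟩ := hC.exists_isAdapted
  -- The `𝔨`-equivariant map into `𝔭` with `Q(L x, y) = g(x, y)` for `y ∈ 𝔭`; on `𝔨` it measures the
  -- mixing of `𝔨` and `𝔭`.
  let L : 𝔤 →ₗ[ℝ] 𝔤 :=
    (pPart 𝔨).projection 𝔨.toSubmodule hC.isCompl ∘ₗ Q.sharp.toLinearMap ∘ₗ g.form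
  have hLp : ∀ x, L x ∈ pPart 𝔨 := fun x => Submodule.projection_apply_mem _ _
  have hL : ∀ x, ∀ y ∈ pPart 𝔨, Q.form (L x) y = g.form x y := by
    intro x y hy
    have h1 : g.form x y = Q.form (Q.sharp (g.form x)) y := (Q.form_sharp _ _).symm
    obtain ⟨a, ha, b, hb, hab⟩ := hC.exists_add (Q.sharp (g.form x))
    have h2 : L x = a := by
      change (pPart 𝔨).projection 𝔨.toSubmodule hC.isCompl (Q.sharp (g.form x)) = a
      rw [← hab, map_add, (Submodule.projection_apply_eq_zero_iff hC.isCompl).2 hb, add_zero]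
      exact Submodule.projection_apply_left hC.isCompl ⟨a, ha⟩
    rw [h1, h2, ← hab, map_add, LinearMap.add_apply, hC.form_of_mem_of_mem_pPart hb hy, add_zero]
  have hLlie : ∀ z ∈ 𝔨, ∀ x, L ⁅z, x⁆ = ⁅z, L x⁆ := by
    intro z hz x
    have hd : L ⁅z, x⁆ - ⁅z, L x⁆ ∈ pPart 𝔨 :=
      (pPart 𝔨).sub_mem (hLp _) (hC.lie_k_p z hz _ (hLp x))
    have key : ∀ y ∈ pPart 𝔨, Q.form (L ⁅z, x⁆ - ⁅z, L x⁆) y = 0 := by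
      intro y hy
      rw [map_sub, LinearMap.sub_apply, hL _ y hy, hg z hz, hC.form_lie hz,
        hL x _ (hC.lie_k_p z hz y hy), sub_self]
    exact sub_eq_zero.1 (Q.eq_zero (key _ hd))
  let h : LinearMap.BilinForm ℝ 𝔤 := Q.form.compl₁₂ L L
  have hh : ∀ x y, h x y = Q.form (L x) (L y) := fun x y => rfl
  have hhs : ∀ x y, h x y = h y x := fun x y => Q.symm _ _
  have hhi : IsInvariantUnder 𝔨 h := by
    intro z hz x y
    rw [hh, hh, hLlie z hz, hLlie z hz, hC.form_lie hz]
  obtain ⟨a, ha⟩ : ∃ a, L (e (Sum.inr a)) ≠ 0 := by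
    by_contra! hall
    apply h0
    intro x hx y hy
    rw [← hL x y hy, ← he.orthonormal.sum_eq x]
    have : L (∑ i, Q.form x (e i) • e i) = 0 := by
      rw [map_sum]
      refine Finset.sum_eq_zero ?_
      rintro (δ | b) -
      · rw [hC.form_of_mem_of_mem_pPart hx (he.inl_mem δ), zero_smul, map_zero]
      · rw [map_smul, hall, smul_zero]
    rw [this, map_zero, LinearMap.zero_apply]
  set i := a.1
  obtain ⟨μ, hμ⟩ := hC.exists_eq_smul_on_space hG hp i hhs hhi
  have hμ0 : 0 < μ := by
    have h1 := hμ _ (he.inr_mem a) _ (he.inr_mem a)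
    rw [he.orthonormal.1, mul_one, hh] at h1
    rw [← h1]
    exact Q.pos _ ha
  have himage : i.space.map L = pPart 𝔨 := by
    refine (hC.pPart_irreducible hG ?_ ?_).resolve_left ?_
    · rintro _ ⟨x, -, rfl⟩
      exact hLp x
    · rintro z hz _ ⟨x, hx, rfl⟩
      exact ⟨⁅z, x⁆, Factor.lie_mem_space hz hx, hLlie z hz x⟩
    · intro h1
      have : L (e (Sum.inr a)) ∈ i.space.map L := ⟨_, he.inr_mem a, rfl⟩
      rw [h1] at this
      exact ha ((Submodule.mem_bot ℝ).1 this)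
  -- Another summand commutes with `𝔨ᵢ`, hence by equivariance with `L(𝔨ᵢ) = 𝔭`, which contradicts
  -- faithfulness.
  have huniq : ∀ j : Factor 𝔨, j = i := by
    intro j
    by_contra hj
    obtain ⟨b, rfl⟩ := exists_index j
    refine e.ne_zero (Sum.inr b) (hC.eq_zero_of_lie_eq_zero hG hp (he.inr_mem_k b) fun y hy => ?_)
    rw [← himage] at hy
    obtain ⟨x, hx, rfl⟩ := hy
    rw [← hLlie _ (he.inr_mem_k b)]
    obtain ⟨x', hx', rfl⟩ := Factor.exists_of_mem_space hx
    obtain ⟨y', hy', hye⟩ := Factor.exists_of_mem_space (he.inr_mem b)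
    have : ⁅(y' : 𝔤), (x' : 𝔤)⁆ = 0 := congrArg Subtype.val (Factor.lie_eq_zero hj hy' hx')
    rw [← hye, this, map_zero]
  have hspace : ∀ x ∈ 𝔨, x ∈ i.space := by
    intro x hx
    rw [← he.orthonormal.sum_eq x]
    refine Submodule.sum_mem _ ?_
    rintro (δ | b) -
    · rw [hC.form_of_mem_of_mem_pPart hx (he.inl_mem δ), zero_smul]
      exact Submodule.zero_mem _
    · exact Submodule.smul_mem _ _ (huniq b.1 ▸ he.inr_mem b)
  obtain ⟨α, hα⟩ := hC.exists_eq_smul_on_space hG hp i g.symm hg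
  obtain ⟨β, hβ⟩ := hC.exists_eq_smul_on_pPart hG g.symm hg
  have hsμ : √μ * √μ = μ := Real.mul_self_sqrt hμ0.le
  have hiso : ∀ x ∈ 𝔨, ∀ y ∈ 𝔨, Q.form (((√μ)⁻¹ • L) x) (((√μ)⁻¹ • L) y) = Q.form x y := by
    intro x hx y hy
    have h1 := hμ x (hspace x hx) y (hspace y hy)
    rw [hh] at h1
    simp only [LinearMap.smul_apply, map_smul, smul_eq_mul, h1]
    have h2 : (√μ)⁻¹ * ((√μ)⁻¹ * μ) = 1 := by
      rw [← mul_assoc, ← mul_inv, hsμ, inv_mul_cancel₀ hμ0.ne']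
    linear_combination (cartanInner hC).form x y * h2
  -- `L` scales `Q` by `μ` on `𝔨`, so this normalisation makes it an isometry.
  have hJ : IsComplexStructure hC ((√μ)⁻¹ • L) := by
    refine ⟨fun x _ => (pPart 𝔨).smul_mem _ (hLp x), hiso, fun x hx y hy => ?_, ?_⟩
    · rw [LinearMap.smul_apply, LinearMap.smul_apply, lie_smul, hLlie x hx]
    · have hinj : Function.Injective (L ∘ₗ 𝔨.toSubmodule.subtype) := by
        rw [← LinearMap.ker_eq_bot, LinearMap.ker_eq_bot']
        intro x hx
        have h1 := hμ x (hspace x x.2) x (hspace x x.2)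
        have hx' : L (x : 𝔤) = 0 := hx
        rw [hh, hx', map_zero] at h1
        exact Subtype.ext (Q.eq_zero ((mul_eq_zero.1 h1.symm).resolve_left hμ0.ne'))
      have hrange : LinearMap.range (L ∘ₗ 𝔨.toSubmodule.subtype) = pPart 𝔨 := by
        rw [← himage]
        refine le_antisymm ?_ ?_
        · rintro _ ⟨x, rfl⟩
          exact ⟨x, hspace x x.2, rfl⟩
        · rintro _ ⟨x, hx, rfl⟩
          exact ⟨⟨x, Factor.mem_of_mem_space hx⟩, rfl⟩
      rw [← hrange]
      exact LinearMap.finrank_range_of_inj hinj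
  have hgJ : ∀ x ∈ 𝔨, ∀ y ∈ 𝔨,
      g.form (((√μ)⁻¹ • L) x) (((√μ)⁻¹ • L) y) = β * Q.form x y := by
    intro x hx y hy
    rw [hβ _ (hJ.map_mem x hx) _ (hJ.map_mem y hy), hiso x hx y hy]
  have hgm : ∀ x ∈ 𝔨, ∀ y ∈ 𝔨, g.form x (((√μ)⁻¹ • L) y) = √μ * Q.form x y := by
    intro x hx y hy
    rw [← hL x _ (hJ.map_mem y hy), ← hiso x hx y hy]
    simp only [LinearMap.smul_apply, map_smul, smul_eq_mul]
    field_simp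
  refine ⟨(√μ)⁻¹ • L, α, β, √μ, hJ, fun x hx y hy => hα x (hspace x hx) y (hspace y hy), hgJ,
    hgm, ?_, ?_⟩
  all_goals
    set x := e (Sum.inr a) with hx
    set J := (√μ)⁻¹ • L with hJd
    have hxk : x ∈ 𝔨 := he.inr_mem_k a
    have hx1 : Q.form x x = 1 := he.orthonormal.1 _
    have hJx : J x ≠ 0 := fun h1 => by
      have := hiso x hxk x hxk
      rw [h1, map_zero, hx1] at this
      exact zero_ne_one this
    have hβ0 : 0 < β := by
      have := g.pos _ hJx
      rwa [hgJ x hxk x hxk, hx1, mul_one] at this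
  · exact hβ0
  -- For a unit `x ∈ 𝔨`, this vector is `g`-orthogonal to `J x` and has `g`-norm squared `β (α β -
  -- μ)`.
  · have hne : β • x - √μ • J x ≠ 0 := by
      intro h1
      have h2 : Q.form x (β • x - √μ • J x) = β := by
        rw [map_sub, map_smul, map_smul, hx1,
          hC.form_of_mem_of_mem_pPart hxk (hJ.map_mem x hxk)]
        simp
      rw [h1, map_zero] at h2
      exact hβ0.ne h2
    have h3 := g.pos _ hne
    have hax := hα x (hspace x hxk) x (hspace x hxk)
    have h4 : g.form (J x) x = √μ := by rw [g.symm, hgm x hxk x hxk, hx1, mul_one]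
    simp only [map_sub, map_smul, LinearMap.sub_apply, LinearMap.smul_apply, smul_eq_mul, hax,
      hgJ x hxk x hxk, hgm x hxk x hxk, h4, ← hQ, hx1] at h3
    have h5 : 0 < β * (α * β - √μ ^ 2) := by linarith
    exact (pos_iff_pos_of_mul_pos h5).1 hβ0

/-- Every `𝔨`-invariant metric is dominated by a diagonal one. -/
lemma exists_dominating (hC : IsCartanDecomposition 𝔨)
    (hG : LieAlgebra.IsSimple ℝ 𝔤) (hp : pPart 𝔨 ≠ ⊥) {g : InnerForm 𝔤}
    (hg : IsInvariantUnder 𝔨 g.form) :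
    ∃ (c : ℝ) (a : Factor 𝔨 → ℝ), 0 < c ∧ (∀ i, 0 < a i) ∧
      (∀ Tp Tk, g.traceForm (diagTensor hC Tp Tk)
        = diagTrace (Module.finrank ℝ (pPart 𝔨)) Tp (fun i : Factor 𝔨 => (i.dim : ℝ)) Tk c a) ∧
      scalarCurvature g ≤ diagCurvature (Module.finrank ℝ (pPart 𝔨))
        (fun i : Factor 𝔨 => (i.dim : ℝ)) Factor.kappa c a := by
  by_cases h0 : ∀ x ∈ 𝔨, ∀ y ∈ pPart 𝔨, g.form x y = 0
  · obtain ⟨c, a, hc, ha, hd⟩ := hC.exists_isDiagonal_of_orthogonal hG hp hg h0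
    exact ⟨c, a, hc, ha, fun Tp Tk => hd.traceForm_eq hc ha Tp Tk,
      (hd.scalarCurvature_eq hG hp hc ha).le⟩
  · obtain ⟨J, α, β, γ, hJ, hα, hβ, hγ, hβ0, hdet⟩ := hC.exists_isComplexStructure hG hp hg h0
    exact exists_dominating_of_isComplexStructure hJ hG hp hα hβ hγ hβ0 hdet

/-- The scalar curvature attains its maximum over the naturally reductive metrics
with `tr_g T = 1`. -/
theorem exists_isMax_scalarCurvature (hC : IsCartanDecomposition 𝔨)
    (hG : LieAlgebra.IsSimple ℝ 𝔤)
    (Tp : ℝ) (hTp : 0 < Tp) (Tk : Factor 𝔨 → ℝ) (hTk : ∀ i, 0 < Tk i)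
    (m : Factor 𝔨)
    (hmax : ∀ i : Factor 𝔨, LieAlgebra.IsSimple ℝ i.ideal → i.kappa / Tk i ≤ m.kappa / Tk m)
    (hinf : m.kappa * (cartanInner hC).traceForm (diagTensor hC Tp Tk) / Tk m
      < (Module.finrank ℝ 𝔨 : ℝ) + m.dim * (1 - m.kappa) - 3 * Module.finrank ℝ (pPart 𝔨))
    (hzero : ∑ i : Factor 𝔨,
        ((Module.finrank ℝ (pPart 𝔨) : ℝ) ^ 2 * i.kappa * Tp ^ 2
            - (i.dim : ℝ) ^ 2 * (1 - i.kappa) * Tk i ^ 2)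
          / (Module.finrank ℝ (pPart 𝔨) * Tp * Tk i)
      - 2 * (Module.finrank ℝ (pPart 𝔨) : ℝ) < 0) :
    ∃ g ∈ metricsPlus 𝔨 (diagTensor hC Tp Tk), ∀ h ∈ metricsPlus 𝔨 (diagTensor hC Tp Tk),
      scalarCurvature h ≤ scalarCurvature g := by
  -- If `n = 0`, every quotient in `hzero` has denominator `0`, hence value `0`, and `hzero` reads
  -- `0 < 0`.
  have hp : pPart 𝔨 ≠ ⊥ := by
    intro h
    rw [h, finrank_bot] at hzero
    simp at hzero
  have hn : (0 : ℝ) < Module.finrank ℝ (pPart 𝔨) := by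
    have : Nontrivial (pPart 𝔨) := Submodule.nontrivial_iff_ne_bot.2 hp
    exact_mod_cast Module.finrank_pos (R := ℝ) (M := pPart 𝔨)
  obtain ⟨e, he⟩ := hC.exists_isAdapted
  have hQ : IsDiagonal hC (cartanInner hC) (1 : ℝ)⁻¹ fun _ => (1 : ℝ)⁻¹ :=
    ⟨fun x _ y => by rw [inv_one, one_mul], fun i x _ y => by rw [inv_one, one_mul]⟩
  have htr : (cartanInner hC).traceForm (diagTensor hC Tp Tk)
      = -(Module.finrank ℝ (pPart 𝔨) * Tp) + ∑ i : Factor 𝔨, (i.dim : ℝ) * Tk i := by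
    have := hQ.traceForm_eq one_pos (fun _ => one_pos) Tp Tk
    simp only [mul_one] at this
    exact this
  rw [htr, hC.finrank_eq_sum] at hinf
  -- The centre contributes `κ = 0`, so the maximum over the simple summands is the maximum over all
  -- of them.
  have hmax' : ∀ i : Factor 𝔨, i.kappa / Tk i ≤ m.kappa / Tk m := by
    intro i
    rcases i.2 with hi | ⟨hi, -⟩
    · exact hmax i hi
    · have hk : i.kappa = 0 := by
        obtain ⟨a, rfl⟩ := exists_index i
        rw [← he.sum_structConst_k hG hp a]
        refine Finset.sum_eq_zero fun b _ => Finset.sum_eq_zero fun c _ => ?_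
        obtain ⟨v, -, hv⟩ := he.exists_basis
        have hva : v a ∈ LieAlgebra.center ℝ 𝔨 :=
          hi ▸ Factor.mem_space.1 ((hv a).symm ▸ he.inr_mem a)
        have h0 : ⁅(v b : 𝔤), (v a : 𝔤)⁆ = 0 := congrArg Subtype.val (hva (v b))
        rw [hv, hv] at h0
        rw [structConst, ← lie_skew, h0]
        simp
      rw [hk, zero_div]
      exact div_nonneg (hC.kappa_nonneg hG hp m) (hTk m).le
  obtain ⟨c, a, hc, ha, htr1, hbest⟩ := exists_isMax_diagCurvature (m := m) hn hTp
    (fun i : Factor 𝔨 => Nat.cast_pos.2 i.dim_pos) hTk (hC.kappa_nonneg hG hp)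
    (hC.kappa_lt_one hG hp) (hC.finrank_pPart_eq_sum hG hp) hmax' hinf hzero
  obtain ⟨g, hg⟩ := he.exists_isDiagonal (inv_pos.2 hc) fun i => inv_pos.2 (ha i)
  refine ⟨g, ⟨?_, ?_⟩, fun h hh => ?_⟩
  · exact hC.isNaturallyReductive (inv_pos.2 hc) hg.invariant fun x hx y => by
      rw [hg.form_p x hx, hC.form_of_mem_pPart hx]
  · exact (hg.traceForm_eq hc ha Tp Tk).trans htr1
  -- For a competitor only its `𝔨`-invariance matters.
  · obtain ⟨c', a', hc', ha', htr', hle⟩ := hC.exists_dominating hG hp (g := h)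
      fun z hz x y => eq_neg_of_add_eq_zero_left (hh.1.invariant z hz x y)
    refine hle.trans ((hbest c' a' hc' ha' ((htr' Tp Tk).symm.trans hh.2)).trans ?_)
    exact (hg.scalarCurvature_eq hG hp hc ha).ge

end IsCartanDecomposition

end Comparison

end

end NatRed

theorem mainTheorem6 {N : ℕ} {G : Type*} [TopologicalSpace G]
    [ChartedSpace (EuclideanSpace ℝ (Fin N)) G] [Group G] [LieGroup (𝓡 N) ∞ G]
    [ConnectedSpace G] [NoncompactSpace G]
    (hG : LieAlgebra.IsSimple ℝ (GroupLieAlgebra (𝓡 N) G))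
    (K : Subgroup G) (hK : Maximal (fun H : Subgroup G => IsCompact (H : Set G)) K)
    (𝔨 : LieSubalgebra ℝ (GroupLieAlgebra (𝓡 N) G))
    (h𝔨 : (𝔨 : Set (GroupLieAlgebra (𝓡 N) G)) = lieAlgebraOf N K)
    (hC : IsCartanDecomposition 𝔨)
    (Tp : ℝ) (hTp : 0 < Tp) (Tk : Factor 𝔨 → ℝ) (hTk : ∀ i, 0 < Tk i)
    (T : LinearMap.BilinForm ℝ (GroupLieAlgebra (𝓡 N) G))
    (hT : T = -(Tp • (cartanInner hC).restr (pPart 𝔨))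
      + ∑ i, Tk i • (cartanInner hC).restr i.space)
    (m : Factor 𝔨) (hm : LieAlgebra.IsSimple ℝ m.ideal)
    (hmax : ∀ i : Factor 𝔨, LieAlgebra.IsSimple ℝ i.ideal → i.kappa / Tk i ≤ m.kappa / Tk m)
    (hinf : m.kappa * (cartanInner hC).traceForm T / Tk m
      < (Module.finrank ℝ 𝔨 : ℝ) + m.dim * (1 - m.kappa) - 3 * Module.finrank ℝ (pPart 𝔨))
    (hzero : ∑ i : Factor 𝔨,
        ((Module.finrank ℝ (pPart 𝔨) : ℝ) ^ 2 * i.kappa * Tp ^ 2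
            - (i.dim : ℝ) ^ 2 * (1 - i.kappa) * Tk i ^ 2)
          / (Module.finrank ℝ (pPart 𝔨) * Tp * Tk i)
      - 2 * (Module.finrank ℝ (pPart 𝔨) : ℝ) < 0) :
    ∃ g ∈ metricsPlus 𝔨 T, ∀ h ∈ metricsPlus 𝔨 T, scalarCurvature h ≤ scalarCurvature g := by
  subst hT
  exact hC.exists_isMax_scalarCurvature hG Tp hTp Tk hTk m hmax hinf hzero
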